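/- **Local Chern–Gauss–Bonnet formula for a singular region.** Let $B=B_1(0)$ be the unit ball in $\mathbb{R}^4$, and let $g=e^{2w}|dx|^2$ be a conformal metric on the punctured ball $\overline B\setminus\{0\}$, where $w$ is real-valued and smooth up to $\partial B$ (that is, $C^\infty$ on an open neighbourhood of $\overline B\setminus\{0\}$). Let $\mathrm{R}_g$ and $\mathrm{Rc}_g$ be the scalar and Ricci curvature of $g$, let $\triangle_g$ be its Laplace–Beltrami operator, and let $$Q_g=-\tfrac1{12}\big(\triangle_g \mathrm{R}_g-\mathrm{R}_g^2+3|\mathrm{Rc}_g|_g^2\big)$$ be its $Q$ curvature. On $\partial B$ let $T_g$ be the Chang–Qing boundary curvature $$T_g=-\tfrac1{12}\partial_N \mathrm{R}_g+\tfrac16 \mathrm{R}_gH-R_{aNbN}A_{ab}+\tfrac19H^3-\tfrac13\operatorname{tr}A^3+\tfrac13\tilde\triangle H,$$ where $N$ is the $g$-unit normal pointing into $B$, $A(X,Y)=-g(\nabla_XN,Y)$ is the second fundamental form, $H=\operatorname{tr}A$ is the mean curvature (so for $w=0$, $A$ is the identity and $H=3$), $R_{aNaN}$ is the sectional curvature of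 the plane spanned by the orthonormal vectors $e_a,N$, the indices $a,b$ are summed over an orthonormal frame of $\partial B$, and $\tilde\triangle$ is the Laplacian of $\partial B$ with the induced metric. Suppose that $g$ has finite volume, $\int_B e^{4w}\,dx<\infty$; that its scalar curvature is nonnegative near the origin, i.e. $\mathrm{R}_g\ge 0$ on $B_{r_1}(0)\setminus\{0\}$ for some $r_1>0$; and that its total $Q$ curvature is finite, $\int_B|Q_g|e^{4w}\,dx<\infty$. Then the limit on the right-hand side below exists, and $$\frac1{4\pi^2}\int_{\partial B}T_g\,e^{3w}\,d\sigma+\frac1{4\pi^2}\int_BQ_g\,e^{4w}\,dx=\lim_{r\to0^+}\frac{\mathrm{vol}_g(\partial B_r(0))^{4/3}}{4(2\pi^2)^{1/3}\,\mathrm{vol}_g(B_r(0))},$$ where $\mathrm{vol}_g(\partial B_r(0))=\int_{\partial B_r(0)}e^{3w}\,d\sigma$, $\mathrm{vol}_g(B_r(0))=\int_{B_r(0)}e^{4w}\,dx$, and $d\sigma$ is the Euclidean surface measure. -/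

import Mathlib

open Set Filter Topology MeasureTheory

noncomputable section

namespace LocalCGB

/-- Euclidean four-space. -/
abbrev E4 : Type := EuclideanSpace ℝ (Fin 4)

/-- A field of (metric) matrices `g x i j` in the standard coordinates of `ℝ⁴`. -/
abbrev MetricField : Type := E4 → Matrix (Fin 4) (Fin 4) ℝ

/-- The coordinate partial derivative `∂ᵢ f (x)`. -/
def pd (i : Fin 4) (f : E4 → ℝ) (x : E4) : ℝ :=
  fderiv ℝ f x (EuclideanSpace.single i 1)

/-! ### Curvature of a Riemannian metric in coordinates -/

/-- Christoffel symbols `Γˡᵢⱼ = ½ gˡᵐ (∂ᵢ gⱼₘ + ∂ⱼ gᵢₘ - ∂ₘ gᵢⱼ)` of the Levi-Civita connection. -/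
def christoffel (g : MetricField) (l i j : Fin 4) (x : E4) : ℝ :=
  (1 / 2) * ∑ m, (g x)⁻¹ l m *
    (pd i (fun y => g y j m) x + pd j (fun y => g y i m) x - pd m (fun y => g y i j) x)

/-- Components of the curvature operator: `R(∂ᵢ, ∂ⱼ) ∂ₖ = ∑ₗ (curvatureOp g l k i j) ∂ₗ`, where
`R(X, Y) = ∇_X ∇_Y - ∇_Y ∇_X - ∇_[X,Y]`. -/
def curvatureOp (g : MetricField) (l k i j : Fin 4) (x : E4) : ℝ :=
  pd i (christoffel g l j k) x - pd j (christoffel g l i k) x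
    + ∑ m, (christoffel g l i m x * christoffel g m j k x
      - christoffel g l j m x * christoffel g m i k x)

/-- The Riemann tensor `R_{abcd} = g(R(∂ₐ, ∂_b) ∂_d, ∂_c)`; in this convention `R_{abab}` is the
sectional curvature of an orthonormal pair (positive on round spheres). -/
def riemann (g : MetricField) (a b c d : Fin 4) (x : E4) : ℝ :=
  ∑ l, g x c l * curvatureOp g l d a b x

/-- The Ricci tensor. -/
def ricci (g : MetricField) (j k : Fin 4) (x : E4) : ℝ :=
  ∑ i, curvatureOp g i k i j x

/-- The scalar curvature. -/
def scalarCurv (g : MetricField) (x : E4) : ℝ :=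
  ∑ j, ∑ k, (g x)⁻¹ j k * ricci g j k x

/-- The squared norm `|Rc|²` of the Ricci tensor with respect to `g`. -/
def ricciNormSq (g : MetricField) (x : E4) : ℝ :=
  ∑ i, ∑ j, ∑ k, ∑ l, (g x)⁻¹ i k * (g x)⁻¹ j l * ricci g i j x * ricci g k l x

/-- The Laplace-Beltrami operator `gⁱʲ (∂ᵢ ∂ⱼ f - Γᵏᵢⱼ ∂ₖ f)`. -/
def laplaceBeltrami (g : MetricField) (f : E4 → ℝ) (x : E4) : ℝ :=
  ∑ i, ∑ j, (g x)⁻¹ i j * (pd i (pd j f) x - ∑ k, christoffel g k i j x * pd k f x)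

/-- The Paneitz-Branson `Q` curvature `-(1/12) (Δ R - R² + 3 |Rc|²)`. -/
def qCurv (g : MetricField) (x : E4) : ℝ :=
  -(1 / 12) * (laplaceBeltrami g (scalarCurv g) x - scalarCurv g x ^ 2 + 3 * ricciNormSq g x)

/-! ### Geometry of the boundary of a sublevel set `{ρ ≤ c}`

All fields are given near the boundary, for the level sets of the defining function `ρ`; at a
point of the boundary, only the values on the boundary matter for the tangential quantities. -/

/-- Components `(∇ᵢ V)ᵏ = ∂ᵢ Vᵏ + Γᵏᵢₗ Vˡ` of the covariant derivative of a vector field. -/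
def covDeriv (g : MetricField) (V : Fin 4 → E4 → ℝ) (i k : Fin 4) (x : E4) : ℝ :=
  pd i (V k) x + ∑ l, christoffel g k i l x * V l x

/-- Components of the unit normal `N = -∇ρ / |∇ρ|`, pointing into `{ρ < c}`. -/
def innerNormal (g : MetricField) (ρ : E4 → ℝ) (i : Fin 4) (x : E4) : ℝ :=
  -(∑ j, (g x)⁻¹ i j * pd j ρ x) / √(∑ k, ∑ l, (g x)⁻¹ k l * pd k ρ x * pd l ρ x)

/-- The components `Πⁱⱼ = δⁱⱼ - Nⁱ Nⱼ` of the orthogonal projection onto the tangent space of the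
level sets of `ρ`. -/
def tangProj (g : MetricField) (ρ : E4 → ℝ) (i j : Fin 4) (x : E4) : ℝ :=
  (if i = j then 1 else 0) - innerNormal g ρ i x * ∑ k, g x j k * innerNormal g ρ k x

/-- The second fundamental form `A(X, Y) = -g(∇_X N, Y)` for tangential `X`, `Y`, extended by
zero in the normal direction (so `A` is positive on the boundary of a Euclidean ball). -/
def secondFF (g : MetricField) (ρ : E4 → ℝ) (a b : Fin 4) (x : E4) : ℝ :=
  -∑ i, ∑ j, ∑ k, tangProj g ρ i a x * tangProj g ρ j b x * g x j k *
    covDeriv g (innerNormal g ρ) i k x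

/-- The shape operator `Aⁱⱼ = gⁱᵏ Aₖⱼ`. -/
def shapeOp (g : MetricField) (ρ : E4 → ℝ) (x : E4) : Matrix (Fin 4) (Fin 4) ℝ :=
  (g x)⁻¹ * Matrix.of fun a b => secondFF g ρ a b x

/-- The mean curvature `H = tr A` (the sum of the principal curvatures). -/
def meanCurv (g : MetricField) (ρ : E4 → ℝ) (x : E4) : ℝ :=
  (shapeOp g ρ x).trace

/-- The tangential gradient of `f` along the level sets of `ρ`. -/
def tangGrad (g : MetricField) (ρ f : E4 → ℝ) (k : Fin 4) (x : E4) : ℝ :=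
  ∑ i, ∑ j, tangProj g ρ k i x * (g x)⁻¹ i j * pd j f x

/-- The Laplacian of the level sets of `ρ` (with the induced metric): the tangential divergence of
the tangential gradient. -/
def boundaryLaplace (g : MetricField) (ρ f : E4 → ℝ) (x : E4) : ℝ :=
  ∑ i, ∑ k, tangProj g ρ i k x * covDeriv g (tangGrad g ρ f) i k x

/-- The contraction `R_{aNbN} A_{ab}`. -/
def normalCurvContraction (g : MetricField) (ρ : E4 → ℝ) (x : E4) : ℝ :=
  ∑ a, ∑ b, ∑ p, ∑ q, riemann g a p b q x * innerNormal g ρ p x * innerNormal g ρ q x *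
    (shapeOp g ρ x * (g x)⁻¹) a b

/-- The Chang-Qing boundary curvature
`T = -(1/12) ∂_N R + (1/6) R H - R_{aNbN} A_{ab} + (1/9) H³ - (1/3) tr A³ + (1/3) Δ̃ H`. -/
def tCurv (g : MetricField) (ρ : E4 → ℝ) (x : E4) : ℝ :=
  -(1 / 12) * (∑ i, innerNormal g ρ i x * pd i (scalarCurv g) x)
    + (1 / 6) * scalarCurv g x * meanCurv g ρ x
    - normalCurvContraction g ρ x
    + (1 / 9) * meanCurv g ρ x ^ 3
    - (1 / 3) * (shapeOp g ρ x ^ 3).trace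
    + (1 / 3) * boundaryLaplace g ρ (meanCurv g ρ) x

/-! ### Conformally flat metrics and integrals over spheres -/

/-- The conformally flat metric `e^{2w} |dx|²`. -/
def conformalMetric (w : E4 → ℝ) : MetricField :=
  fun x => Real.exp (2 * w x) • (1 : Matrix (Fin 4) (Fin 4) ℝ)

/-- The integral `∫_{∂B_r(0)} f dσ` (`r > 0`) against Euclidean surface measure, which is the
image under `θ ↦ r θ` of `r³` times the surface measure of the unit sphere. -/
def sphereIntegral (r : ℝ) (f : E4 → ℝ) : ℝ :=
  r ^ 3 * ∫ θ : Metric.sphere (0 : E4) 1, f (r • (θ : E4)) ∂((volume : Measure E4).toSphere)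

/-- `vol_g(∂B_r(0))` for `g = e^{2w} |dx|²`. -/
def sphereVol (w : E4 → ℝ) (r : ℝ) : ℝ :=
  sphereIntegral r fun x => Real.exp (3 * w x)

/-- `vol_g(B_r(0))` for `g = e^{2w} |dx|²`. -/
def ballVol (w : E4 → ℝ) (r : ℝ) : ℝ :=
  ∫ x in Metric.ball (0 : E4) r, Real.exp (4 * w x)

end LocalCGB

end

/-! Both curvatures become linear in w up to terms that integrate to zero. For g = e^{2w}|dx|² one
has Q_g e^{4w} = ½Δ²w (`qCurv_conformal`), and on the unit sphere T_g e^{3w} = 2 - ½∂_rΔw plus a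
divergence along the sphere (`tCurv_conformal`). Let W agree with w on a neighbourhood of the
punctured closed ball and vanish far out, let F = Δ²W away from the origin, and let m = (8π²)⁻¹∫F.
The divergence theorem outside the unit ball turns the curvature side into 1 + m, so the claim is
that the isoperimetric ratio of small spheres tends to 1 + m.

The analytic core is the representation 8π²W(x) = ∫ (log|x| - log|y - x|) F(y) dy for x ≠ 0
(`integral_logKernel_mul_lap_lap`). The kernel vanishes at y = 0, so removing the singularity at
scale ε costs only ε⁻³ times the integral of |W| over the shell ε ≤ |y| ≤ 2ε. Nonnegative scalar
curvature makes e^w superharmonic, so w is bounded below (`exists_lower_bound`); finite volume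
controls w from above in the mean. Together they bound the shell integral by a multiple of ε⁴
log(1/ε), and the cost tends to 0 (`tendsto_integral_shell_abs`).

The kernel is then split as min(0, log|x| - log|y|) + log(max(|x|,|y|)/|x - y|). The first part
produces a radial function P(r), which grows like m log r up to an error governed by the mass of |F|
near the origin (`IsPotential.abs_radialPot_sub_le`). The second is small when |x| and |y| are far
from comparable and has only a logarithmic singularity otherwise. Jensen and Fubini give ∫
e^{q(W-P)} dσ → 2π² for every q ≥ 0 (`IsPotential.tendsto_integral_exp`); no smallness of F is
needed, because only its interaction with the sphere of radius r enters, and that tends to 0.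

Hence vol(∂B_r) is asymptotic to 2π² r³e^{3P}, while r⁴e^{4P}/vol(B_r) tends to 4(1 + m)/(2π²). The
factors r⁴e^{4P} cancel in the ratio, leaving 1 + m. The borderline m = -1 is included, with limit
0. -/

open Set Filter Topology MeasureTheory

noncomputable section

namespace LocalCGB

/-! ### Calculus of coordinate partial derivatives -/

/-- Smoothness on a set. -/
abbrev SmoothOn (V : Set E4) (f : E4 → ℝ) : Prop :=
  ContDiffOn ℝ ((⊤ : ℕ∞) : WithTop ℕ∞) f V

/-- The Euclidean Laplacian. -/
def lap (f : E4 → ℝ) (x : E4) : ℝ := ∑ i, pd i (pd i f) x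

/-- The Euler (radial) derivative. -/
def euler (f : E4 → ℝ) (x : E4) : ℝ := ∑ i, x i * pd i f x

/-- The Euclidean inner product of two gradients. -/
def gradDot (f g : E4 → ℝ) (x : E4) : ℝ := ∑ i, pd i f x * pd i g x

/-- The infinitesimal rotation in the `(i, j)` plane. -/
def rot (i j : Fin 4) (f : E4 → ℝ) (x : E4) : ℝ := x i * pd j f x - x j * pd i f x

section

variable {V : Set E4} {f g : E4 → ℝ} {x : E4} {i j : Fin 4}

theorem pd_eventuallyEq (h : f =ᶠ[𝓝 x] g) (i : Fin 4) : pd i f =ᶠ[𝓝 x] pd i g := by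
  filter_upwards [h.fderiv (𝕜 := ℝ)] with y hy
  simp [pd, hy]

theorem EqOn.pd (hV : IsOpen V) (h : EqOn f g V) (i : Fin 4) : EqOn (pd i f) (pd i g) V :=
  fun _ hx => (pd_eventuallyEq (h.eventuallyEq_of_mem (hV.mem_nhds hx)) i).eq_of_nhds

theorem lap_eventuallyEq (h : f =ᶠ[𝓝 x] g) : lap f =ᶠ[𝓝 x] lap g := by
  have := fun i => pd_eventuallyEq (pd_eventuallyEq h i) i
  filter_upwards [eventually_all.2 this] with y hy
  simp [lap, hy]

theorem euler_eventuallyEq (h : f =ᶠ[𝓝 x] g) : euler f =ᶠ[𝓝 x] euler g := by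
  have := fun i => pd_eventuallyEq h i
  filter_upwards [eventually_all.2 this] with y hy
  simp [euler, hy]

theorem EqOn.lap (hV : IsOpen V) (h : EqOn f g V) : EqOn (lap f) (lap g) V :=
  fun _ hx => (lap_eventuallyEq (h.eventuallyEq_of_mem (hV.mem_nhds hx))).eq_of_nhds

theorem EqOn.euler (hV : IsOpen V) (h : EqOn f g V) : EqOn (euler f) (euler g) V :=
  fun _ hx => (euler_eventuallyEq (h.eventuallyEq_of_mem (hV.mem_nhds hx))).eq_of_nhds

theorem SmoothOn.differentiableAt (hf : SmoothOn V f) (hV : IsOpen V) (hx : x ∈ V) :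
    DifferentiableAt ℝ f x :=
  ((hf x hx).contDiffAt (hV.mem_nhds hx)).differentiableAt (by simp)

theorem SmoothOn.contDiffAt (hf : SmoothOn V f) (hV : IsOpen V) (hx : x ∈ V) :
    ContDiffAt ℝ ((⊤ : ℕ∞) : WithTop ℕ∞) f x :=
  (hf x hx).contDiffAt (hV.mem_nhds hx)

theorem SmoothOn.pd (hf : SmoothOn V f) (hV : IsOpen V) (i : Fin 4) : SmoothOn V (pd i f) := by
  have h := hf.fderiv_of_isOpen (m := ((⊤ : ℕ∞) : WithTop ℕ∞)) hV (by simp)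
  exact h.clm_apply contDiffOn_const

theorem smoothOn_coord (i : Fin 4) : SmoothOn V (fun y : E4 => y i) := by
  have : ContDiff ℝ ((⊤ : ℕ∞) : WithTop ℕ∞) (fun y : E4 => y i) := by fun_prop
  exact this.contDiffOn

theorem SmoothOn.lap (hf : SmoothOn V f) (hV : IsOpen V) : SmoothOn V (lap f) :=
  ContDiffOn.sum fun i _ => (hf.pd hV i).pd hV i

theorem SmoothOn.euler (hf : SmoothOn V f) (hV : IsOpen V) : SmoothOn V (euler f) :=
  ContDiffOn.sum fun i _ => (smoothOn_coord i).mul (hf.pd hV i)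

theorem SmoothOn.gradDot (hf : SmoothOn V f) (hg : SmoothOn V g) (hV : IsOpen V) :
    SmoothOn V (gradDot f g) :=
  ContDiffOn.sum fun i _ => (hf.pd hV i).mul (hg.pd hV i)

theorem SmoothOn.rot (hf : SmoothOn V f) (hV : IsOpen V) (i j : Fin 4) :
    SmoothOn V (rot i j f) :=
  ((smoothOn_coord i).mul (hf.pd hV j)).sub ((smoothOn_coord j).mul (hf.pd hV i))

theorem pd_add (hf : DifferentiableAt ℝ f x) (hg : DifferentiableAt ℝ g x) :
    pd i (fun y => f y + g y) x = pd i f x + pd i g x := by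
  simp [pd, fderiv_fun_add hf hg]

theorem pd_sub (hf : DifferentiableAt ℝ f x) (hg : DifferentiableAt ℝ g x) :
    pd i (fun y => f y - g y) x = pd i f x - pd i g x := by
  simp [pd, fderiv_fun_sub hf hg]

theorem pd_mul (hf : DifferentiableAt ℝ f x) (hg : DifferentiableAt ℝ g x) :
    pd i (fun y => f y * g y) x = f x * pd i g x + pd i f x * g x := by
  simp [pd, fderiv_fun_mul hf hg]
  ring

theorem pd_const_mul (hf : DifferentiableAt ℝ f x) (c : ℝ) :
    pd i (fun y => c * f y) x = c * pd i f x := by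
  simp [pd, fderiv_const_mul hf c]

theorem pd_sum {ι : Type*} {s : Finset ι} {F : ι → E4 → ℝ}
    (hF : ∀ k ∈ s, DifferentiableAt ℝ (F k) x) :
    pd i (fun y => ∑ k ∈ s, F k y) x = ∑ k ∈ s, pd i (F k) x := by
  simp [pd, fderiv_fun_sum hF]

theorem pd_const (c : ℝ) : pd i (fun _ => c) x = 0 := by
  simp [pd]

theorem pd_exp (hf : DifferentiableAt ℝ f x) :
    pd i (fun y => Real.exp (f y)) x = Real.exp (f x) * pd i f x := by
  simp [pd, fderiv_exp hf]

theorem pd_coord : pd i (fun y => y j) x = if i = j then 1 else 0 := by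
  have : HasFDerivAt (fun y : E4 => y j) (EuclideanSpace.proj j : E4 →L[ℝ] ℝ) x :=
    (EuclideanSpace.proj j : E4 →L[ℝ] ℝ).hasFDerivAt
  simp [pd, this.fderiv, eq_comm]

theorem normSq_eq (x : E4) : ‖x‖ ^ 2 = ∑ i, x i * x i := by
  simp [EuclideanSpace.norm_sq_eq, ← sq]

theorem pd_normSq : pd i (fun y : E4 => ‖y‖ ^ 2) x = 2 * x i := by
  have h : (fun y : E4 => ‖y‖ ^ 2) = fun y : E4 => ∑ i, y i * y i := funext normSq_eq
  have hk : ∀ k, pd i (fun y : E4 => y k * y k) x = 2 * (if i = k then x k else 0) := by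
    intro k
    rw [pd_mul (by fun_prop) (by fun_prop), pd_coord]
    split_ifs <;> ring
  rw [h, pd_sum (fun k _ => by fun_prop)]
  simp [hk]

theorem pd_comm (hf : SmoothOn V f) (hV : IsOpen V) (hx : x ∈ V) (i j : Fin 4) :
    pd i (pd j f) x = pd j (pd i f) x := by
  have hc := hf.contDiffAt hV hx
  have hs : IsSymmSndFDerivAt ℝ f x := hc.isSymmSndFDerivAt
    (by simpa using WithTop.coe_le_coe.2 (le_top : (2 : ℕ∞) ≤ ⊤))
  have hd : DifferentiableAt ℝ (fderiv ℝ f) x :=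
    (hc.fderiv_right (m := 1) (by norm_cast)).differentiableAt (by simp)
  have key : ∀ a b, LocalCGB.pd a (LocalCGB.pd b f) x
      = fderiv ℝ (fderiv ℝ f) x (EuclideanSpace.single a 1) (EuclideanSpace.single b 1) := by
    intro a b
    have : LocalCGB.pd b f = fun y => fderiv ℝ f y (EuclideanSpace.single b 1) := rfl
    rw [this, LocalCGB.pd, fderiv_clm_apply hd (differentiableAt_const _)]
    simp
  rw [key, key]
  exact hs _ _

theorem fderiv_eq_sum (f : E4 → ℝ) (x v : E4) : fderiv ℝ f x v = ∑ i, v i * pd i f x := by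
  have hv : v = ∑ i, v i • EuclideanSpace.single i (1 : ℝ) := by
    ext j
    simp [Finset.sum_apply, Pi.single_apply]
  conv_lhs => rw [hv]
  simp [pd]

end

/-! ### Curvature of a conformally flat metric -/

/-- The Kronecker symbol. -/
def delta (i j : Fin 4) : ℝ := if i = j then 1 else 0

section

variable {V : Set E4} {w f : E4 → ℝ} {x : E4}

theorem conformalMetric_apply (w : E4 → ℝ) (x : E4) (i j : Fin 4) :
    conformalMetric w x i j = Real.exp (2 * w x) * delta i j := by
  simp [conformalMetric, delta, Matrix.one_apply]

theorem conformalMetric_inv (w : E4 → ℝ) (x : E4) :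
    (conformalMetric w x)⁻¹ = Real.exp (-2 * w x) • (1 : Matrix (Fin 4) (Fin 4) ℝ) := by
  apply Matrix.inv_eq_right_inv
  simp [conformalMetric, smul_smul, ← Real.exp_add]

theorem conformalMetric_inv_apply (w : E4 → ℝ) (x : E4) (i j : Fin 4) :
    (conformalMetric w x)⁻¹ i j = Real.exp (-2 * w x) * delta i j := by
  simp [conformalMetric_inv, delta, Matrix.one_apply]

theorem pd_conformalMetric (hw : DifferentiableAt ℝ w x) (i j k : Fin 4) :
    pd i (fun y => conformalMetric w y j k) x
      = 2 * Real.exp (2 * w x) * pd i w x * delta j k := by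
  simp_rw [conformalMetric_apply, mul_comm _ (delta j k)]
  rw [pd_const_mul (by fun_prop), pd_exp (by fun_prop), pd_const_mul hw]
  ring

theorem christoffel_conformal (hw : DifferentiableAt ℝ w x) (l i j : Fin 4) :
    christoffel (conformalMetric w) l i j x
      = delta l j * pd i w x + delta l i * pd j w x - delta i j * pd l w x := by
  have he : Real.exp (-2 * w x) * Real.exp (2 * w x) = 1 := by
    rw [← Real.exp_add]; simp
  simp_rw [christoffel, pd_conformalMetric hw, conformalMetric_inv_apply]
  have : ∀ m, Real.exp (-2 * w x) * delta l m * (2 * Real.exp (2 * w x) * pd i w x * delta j m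
      + 2 * Real.exp (2 * w x) * pd j w x * delta i m - 2 * Real.exp (2 * w x) * pd m w x * delta i j)
      = 2 * delta l m * (pd i w x * delta j m + pd j w x * delta i m - pd m w x * delta i j) := by
    intro m
    linear_combination 2 * delta l m *
      (pd i w x * delta j m + pd j w x * delta i m - pd m w x * delta i j) * he
  simp_rw [this]
  simp [delta, eq_comm]

theorem pd_christoffel_conformal (hw : SmoothOn V w) (hV : IsOpen V) (hx : x ∈ V)
    (l i j k : Fin 4) :
    pd i (christoffel (conformalMetric w) l j k) x
      = delta l k * pd i (pd j w) x + delta l j * pd i (pd k w) x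
        - delta j k * pd i (pd l w) x := by
  have hd : ∀ a, DifferentiableAt ℝ (pd a w) x := fun a => (hw.pd hV a).differentiableAt hV hx
  have h : EqOn (christoffel (conformalMetric w) l j k)
      (fun y => delta l k * pd j w y + delta l j * pd k w y - delta j k * pd l w y) V :=
    fun y hy => christoffel_conformal (hw.differentiableAt hV hy) l j k
  rw [EqOn.pd hV h i hx, pd_sub, pd_add, pd_const_mul (hd _), pd_const_mul (hd _),
    pd_const_mul (hd _)]
  all_goals first | exact (hd _).const_mul _ | exact ((hd _).const_mul _).add ((hd _).const_mul _)

theorem delta_comm (i j : Fin 4) : delta i j = delta j i := by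
  simp [delta, eq_comm]

theorem sum_delta_mul (i : Fin 4) (F : Fin 4 → ℝ) : ∑ m, delta i m * F m = F i := by
  simp [delta]

theorem sum_delta_mul' (i : Fin 4) (F : Fin 4 → ℝ) : ∑ m, delta m i * F m = F i := by
  simp [delta]

theorem sum_conformal_christoffel_mul (W : Fin 4 → ℝ) (i j k l : Fin 4) :
    ∑ m, (delta l m * W i + delta l i * W m - delta i m * W l)
        * (delta m k * W j + delta m j * W k - delta j k * W m)
      = delta l k * W i * W j + delta l j * W i * W k - delta j k * W i * W l
        + delta l i * (2 * W j * W k - delta j k * ∑ m, W m * W m)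
        - W l * (delta i k * W j + delta i j * W k - delta j k * W i) := by
  have : ∀ m, (delta l m * W i + delta l i * W m - delta i m * W l)
        * (delta m k * W j + delta m j * W k - delta j k * W m)
      = delta l m * (W i * (delta m k * W j + delta m j * W k - delta j k * W m))
        + delta m k * (delta l i * W m * W j) + delta m j * (delta l i * W m * W k)
        - delta l i * delta j k * (W m * W m)
        - delta i m * (W l * (delta m k * W j + delta m j * W k - delta j k * W m)) := by
    intro m; ring
  simp_rw [this, Finset.sum_sub_distrib, Finset.sum_add_distrib, sum_delta_mul, sum_delta_mul',
    ← Finset.mul_sum]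
  ring

theorem curvatureOp_conformal (hw : SmoothOn V w) (hV : IsOpen V) (hx : x ∈ V)
    (l k i j : Fin 4) :
    curvatureOp (conformalMetric w) l k i j x
      = delta l j * pd i (pd k w) x - delta j k * pd i (pd l w) x
        - delta l i * pd j (pd k w) x + delta i k * pd j (pd l w) x
        + (delta l i * pd j w x * pd k w x - delta l j * pd i w x * pd k w x
          - delta i k * pd j w x * pd l w x + delta j k * pd i w x * pd l w x
          + (delta l j * delta i k - delta l i * delta j k) * gradDot w w x) := by
  have hd := hw.differentiableAt hV hx
  have hs := sum_conformal_christoffel_mul fun a => pd a w x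
  simp_rw [curvatureOp, pd_christoffel_conformal hw hV hx, christoffel_conformal hd,
    pd_comm hw hV hx j i, Finset.sum_sub_distrib, hs, gradDot,
    delta_comm j i]
  ring

theorem sum_delta_self : ∑ i, delta i i = 4 := by
  simp [delta]

theorem ricci_conformal (hw : SmoothOn V w) (hV : IsOpen V) (hx : x ∈ V) (j k : Fin 4) :
    ricci (conformalMetric w) j k x
      = -2 * pd j (pd k w) x + 2 * pd j w x * pd k w x
        - delta j k * (lap w x + 2 * gradDot w w x) := by
  simp_rw [ricci, curvatureOp_conformal hw hV hx, mul_assoc, sub_mul, mul_assoc]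
  simp only [Finset.sum_add_distrib, Finset.sum_sub_distrib, sum_delta_mul', ← Finset.mul_sum,
    ← Finset.sum_mul]
  simp only [sum_delta_self, lap, gradDot]
  ring

theorem scalarCurv_conformal (hw : SmoothOn V w) (hV : IsOpen V) (hx : x ∈ V) :
    scalarCurv (conformalMetric w) x
      = -6 * (Real.exp (-2 * w x) * (lap w x + gradDot w w x)) := by
  simp_rw [scalarCurv, ricci_conformal hw hV hx, conformalMetric_inv_apply, mul_assoc,
    ← Finset.mul_sum, sum_delta_mul]
  simp_rw [Finset.sum_sub_distrib, Finset.sum_add_distrib, ← Finset.sum_mul, sum_delta_self,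
    ← Finset.mul_sum]
  simp only [lap, gradDot]
  ring

theorem laplaceBeltrami_conformal (hw : DifferentiableAt ℝ w x) (f : E4 → ℝ) :
    laplaceBeltrami (conformalMetric w) f x
      = Real.exp (-2 * w x) * (lap f x + 2 * gradDot w f x) := by
  simp_rw [laplaceBeltrami, conformalMetric_inv_apply, mul_assoc, ← Finset.mul_sum,
    sum_delta_mul, christoffel_conformal hw, sub_mul, add_mul, Finset.sum_sub_distrib,
    Finset.sum_add_distrib, mul_assoc, sum_delta_mul', ← Finset.mul_sum]
  simp only [lap, gradDot, Finset.sum_const, Finset.card_univ, Fintype.card_fin, delta, if_true]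
  simp only [Fin.sum_univ_four]
  ring

end

/-! ### Bochner-type identities and the Q curvature -/

section

variable {V : Set E4} {w f g h : E4 → ℝ} {x : E4}

theorem SmoothOn.pd_differentiableAt (hf : SmoothOn V f) (hV : IsOpen V) (hx : x ∈ V)
    (i : Fin 4) : DifferentiableAt ℝ (LocalCGB.pd i f) x :=
  (hf.pd hV i).differentiableAt hV hx

theorem gradDot_comm (f g : E4 → ℝ) (x : E4) : gradDot f g x = gradDot g f x := by
  simp_rw [gradDot, mul_comm]

theorem gradDot_add_right (hf : DifferentiableAt ℝ f x) (hg : DifferentiableAt ℝ g x) :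
    gradDot h (fun y => f y + g y) x = gradDot h f x + gradDot h g x := by
  simp_rw [gradDot, pd_add hf hg, mul_add, Finset.sum_add_distrib]

theorem gradDot_const_mul_right (hf : DifferentiableAt ℝ f x) (c : ℝ) :
    gradDot h (fun y => c * f y) x = c * gradDot h f x := by
  simp_rw [gradDot, pd_const_mul hf, Finset.mul_sum]
  exact Finset.sum_congr rfl fun _ _ => by ring

theorem gradDot_mul_right (hf : DifferentiableAt ℝ f x) (hg : DifferentiableAt ℝ g x) :
    gradDot h (fun y => f y * g y) x = f x * gradDot h g x + gradDot h f x * g x := by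
  simp_rw [gradDot, pd_mul hf hg, Finset.mul_sum, Finset.sum_mul, ← Finset.sum_add_distrib]
  exact Finset.sum_congr rfl fun _ _ => by ring

theorem gradDot_exp_right (hf : DifferentiableAt ℝ f x) :
    gradDot h (fun y => Real.exp (f y)) x = Real.exp (f x) * gradDot h f x := by
  simp_rw [gradDot, pd_exp hf, Finset.mul_sum]
  exact Finset.sum_congr rfl fun _ _ => by ring

theorem lap_add (hf : SmoothOn V f) (hg : SmoothOn V g) (hV : IsOpen V) (hx : x ∈ V) :
    lap (fun y => f y + g y) x = lap f x + lap g x := by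
  have h : ∀ i, EqOn (pd i fun y => f y + g y) (fun y => pd i f y + pd i g y) V :=
    fun i y hy => pd_add (hf.differentiableAt hV hy) (hg.differentiableAt hV hy)
  simp_rw [lap, ← Finset.sum_add_distrib]
  refine Finset.sum_congr rfl fun i _ => ?_
  rw [EqOn.pd hV (h i) i hx,
    pd_add (hf.pd_differentiableAt hV hx i) (hg.pd_differentiableAt hV hx i)]

theorem lap_const_mul (hf : SmoothOn V f) (hV : IsOpen V) (hx : x ∈ V) (c : ℝ) :
    lap (fun y => c * f y) x = c * lap f x := by
  have h : ∀ i, EqOn (pd i fun y => c * f y) (fun y => c * pd i f y) V :=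
    fun i y hy => pd_const_mul (hf.differentiableAt hV hy) c
  simp_rw [lap, Finset.mul_sum]
  refine Finset.sum_congr rfl fun i _ => ?_
  rw [EqOn.pd hV (h i) i hx, pd_const_mul (hf.pd_differentiableAt hV hx i)]

theorem lap_mul (hf : SmoothOn V f) (hg : SmoothOn V g) (hV : IsOpen V) (hx : x ∈ V) :
    lap (fun y => f y * g y) x = f x * lap g x + 2 * gradDot f g x + lap f x * g x := by
  have h : ∀ i, EqOn (pd i fun y => f y * g y) (fun y => f y * pd i g y + pd i f y * g y) V :=
    fun i y hy => pd_mul (hf.differentiableAt hV hy) (hg.differentiableAt hV hy)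
  simp_rw [lap, gradDot, Finset.mul_sum, Finset.sum_mul, ← Finset.sum_add_distrib]
  refine Finset.sum_congr rfl fun i _ => ?_
  have hf1 := hf.differentiableAt hV hx
  have hg1 := hg.differentiableAt hV hx
  have hf2 := hf.pd_differentiableAt hV hx i
  have hg2 := hg.pd_differentiableAt hV hx i
  rw [EqOn.pd hV (h i) i hx, pd_add (hf1.fun_mul hg2) (hf2.fun_mul hg1), pd_mul hf1 hg2, pd_mul hf2 hg1]
  ring

theorem lap_exp (hf : SmoothOn V f) (hV : IsOpen V) (hx : x ∈ V) :
    lap (fun y => Real.exp (f y)) x = Real.exp (f x) * (lap f x + gradDot f f x) := by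
  have h : ∀ i, EqOn (pd i fun y => Real.exp (f y)) (fun y => Real.exp (f y) * pd i f y) V :=
    fun i y hy => pd_exp (hf.differentiableAt hV hy)
  simp_rw [lap, gradDot, ← Finset.sum_add_distrib, Finset.mul_sum]
  refine Finset.sum_congr rfl fun i _ => ?_
  have hf1 := hf.differentiableAt hV hx
  rw [EqOn.pd hV (h i) i hx, pd_mul hf1.exp (hf.pd_differentiableAt hV hx i), pd_exp hf1]
  ring

theorem pd_lap (hf : SmoothOn V f) (hV : IsOpen V) (hx : x ∈ V) (k : Fin 4) :
    pd k (lap f) x = lap (pd k f) x := by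
  have h : ∀ i, EqOn (pd k (pd i f)) (pd i (pd k f)) V := fun i y hy => pd_comm hf hV hy k i
  have : lap f = fun y => ∑ i, pd i (pd i f) y := rfl
  rw [this, pd_sum fun i _ => (hf.pd hV i).pd_differentiableAt hV hx i, lap]
  refine Finset.sum_congr rfl fun i _ => ?_
  rw [pd_comm (hf.pd hV i) hV hx k i, EqOn.pd hV (h i) i hx]

theorem pd_gradDot (hf : SmoothOn V f) (hg : SmoothOn V g) (hV : IsOpen V) (hx : x ∈ V)
    (k : Fin 4) :
    pd k (gradDot f g) x = ∑ i, (pd i f x * pd k (pd i g) x + pd k (pd i f) x * pd i g x) := by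
  have hf2 := hf.pd_differentiableAt hV hx
  have hg2 := hg.pd_differentiableAt hV hx
  have : gradDot f g = fun y => ∑ i, pd i f y * pd i g y := rfl
  rw [this, pd_sum fun i _ => (hf2 i).fun_mul (hg2 i)]
  exact Finset.sum_congr rfl fun i _ => pd_mul (hf2 i) (hg2 i)

/-- Bochner's formula in flat space. The squared Hessian it produces is what cancels the one in
|Rc|² when Q is computed. -/
theorem lap_gradDot_self (hf : SmoothOn V f) (hV : IsOpen V) (hx : x ∈ V) :
    lap (gradDot f f) x
      = 2 * gradDot f (lap f) x + 2 * ∑ i, ∑ j, pd i (pd j f) x * pd i (pd j f) x := by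
  have hs : ∀ i ∈ Finset.univ, SmoothOn V fun y => pd i f y * pd i f y :=
    fun i _ => (hf.pd hV i).mul (hf.pd hV i)
  have key : lap (gradDot f f) x = ∑ i, lap (fun y => pd i f y * pd i f y) x := by
    have h : ∀ k, EqOn (pd k (gradDot f f)) (fun y => ∑ i, pd k (fun z => pd i f z * pd i f z) y) V :=
      fun k y hy => pd_sum fun i hi => (hs i hi).differentiableAt hV hy
    simp_rw [lap]
    rw [Finset.sum_comm]
    refine Finset.sum_congr rfl fun k _ => ?_
    rw [EqOn.pd hV (h k) k hx, pd_sum fun i hi => (hs i hi).pd_differentiableAt hV hx k]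
  rw [key]
  simp_rw [fun i => lap_mul (hf.pd hV i) (hf.pd hV i) hV hx, gradDot, pd_lap hf hV hx,
    fun i j => pd_comm hf hV hx i j, Finset.mul_sum, ← Finset.sum_add_distrib]
  exact Finset.sum_congr rfl fun i _ => by ring

theorem gradDot_gradDot_self (hf : SmoothOn V f) (hV : IsOpen V) (hx : x ∈ V) :
    gradDot f (gradDot f f) x = 2 * ∑ i, ∑ j, pd i (pd j f) x * pd i f x * pd j f x := by
  simp_rw [gradDot, pd_gradDot hf hf hV hx, Finset.mul_sum]
  exact Finset.sum_congr rfl fun i _ => Finset.sum_congr rfl fun j _ => by ring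

theorem ricciNormSq_conformal (hw : SmoothOn V w) (hV : IsOpen V) (hx : x ∈ V) :
    ricciNormSq (conformalMetric w) x = Real.exp (-2 * w x) ^ 2 *
      (4 * (∑ i, ∑ j, pd i (pd j w) x * pd i (pd j w) x)
        - 8 * (∑ i, ∑ j, pd i (pd j w) x * pd i w x * pd j w x)
        + 8 * lap w x ^ 2 + 20 * lap w x * gradDot w w x + 12 * gradDot w w x ^ 2) := by
  simp_rw [ricciNormSq, conformalMetric_inv_apply]
  have : ∀ i j k l, Real.exp (-2 * w x) * delta i k * (Real.exp (-2 * w x) * delta j l)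
      * ricci (conformalMetric w) i j x * ricci (conformalMetric w) k l x
      = Real.exp (-2 * w x) ^ 2 * (delta i k * (delta j l * (ricci (conformalMetric w) i j x *
        ricci (conformalMetric w) k l x))) := fun i j k l => by ring
  simp_rw [this, ← Finset.mul_sum, sum_delta_mul, ricci_conformal hw hV hx]
  congr 1
  simp only [lap, gradDot, Fin.sum_univ_four, delta]
  simp
  ring

theorem smoothOn_exp_scalar (hw : SmoothOn V w) (c : ℝ) :
    SmoothOn V fun y => Real.exp (c * w y) :=
  (contDiffOn_const.mul hw).exp

/-- The conformal covariance of the Paneitz operator in dimension four, which is Δ² for the flat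
metric, whose Q vanishes. In the direct expansion the terms |∇²w|² and ∇²w(∇w,∇w) of ΔR cancel those
of 3|Rc|², as do all other nonlinear terms. -/
theorem qCurv_conformal (hw : SmoothOn V w) (hV : IsOpen V) (hx : x ∈ V) :
    qCurv (conformalMetric w) x * Real.exp (4 * w x) = 1 / 2 * lap (lap w) x := by
  have hR : EqOn (scalarCurv (conformalMetric w))
      (fun y => -6 * (Real.exp (-2 * w y) * (lap w y + gradDot w w y))) V :=
    fun y hy => scalarCurv_conformal hw hV hy
  have hl := hw.lap hV
  have hg := hw.gradDot hw hV
  have hS : SmoothOn V fun y => lap w y + gradDot w w y := hl.add hg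
  have he := smoothOn_exp_scalar hw (-2)
  have hw1 := hw.differentiableAt hV hx
  have hS1 := hS.differentiableAt hV hx
  have he1 := he.differentiableAt hV hx
  have hc : SmoothOn V fun y => -2 * w y := contDiffOn_const.mul hw
  have hE : Real.exp (4 * w x) * Real.exp (-2 * w x) ^ 2 = 1 := by
    rw [← Real.exp_nat_mul, ← Real.exp_add]
    norm_num
    ring_nf
  have hgR : gradDot w (scalarCurv (conformalMetric w)) x
      = -6 * (Real.exp (-2 * w x) * (gradDot w (lap w) x + gradDot w (gradDot w w) x)
        - 2 * Real.exp (-2 * w x) * gradDot w w x * (lap w x + gradDot w w x)) := by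
    have : gradDot w (scalarCurv (conformalMetric w)) x = gradDot w
        (fun y => -6 * (Real.exp (-2 * w y) * (lap w y + gradDot w w y))) x :=
      Finset.sum_congr rfl fun i _ => by rw [EqOn.pd hV hR i hx]
    rw [this, gradDot_const_mul_right (he1.fun_mul hS1), gradDot_mul_right he1 hS1,
      gradDot_add_right (hl.differentiableAt hV hx) (hg.differentiableAt hV hx),
      gradDot_exp_right (hc.differentiableAt hV hx), gradDot_const_mul_right hw1]
    ring
  have hgE : gradDot (fun y => Real.exp (-2 * w y)) (fun y => lap w y + gradDot w w y) x
      = -2 * Real.exp (-2 * w x) * (gradDot w (lap w) x + gradDot w (gradDot w w) x) := by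
    rw [gradDot_comm, gradDot_exp_right (hc.differentiableAt hV hx), gradDot_const_mul_right hw1,
      gradDot_comm, gradDot_add_right (hl.differentiableAt hV hx) (hg.differentiableAt hV hx)]
    ring
  have hcc : gradDot (fun y => -2 * w y) (fun y => -2 * w y) x = 4 * gradDot w w x := by
    rw [gradDot_const_mul_right hw1, gradDot_comm, gradDot_const_mul_right hw1]
    ring
  have hlR : lap (scalarCurv (conformalMetric w)) x = -6 * (Real.exp (-2 * w x) *
      (lap (lap w) x + lap (gradDot w w) x)
      + 2 * (-2 * Real.exp (-2 * w x) * (gradDot w (lap w) x + gradDot w (gradDot w w) x))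
      + Real.exp (-2 * w x) * (-2 * lap w x + 4 * gradDot w w x)
        * (lap w x + gradDot w w x)) := by
    rw [EqOn.lap hV hR hx, lap_const_mul (he.mul hS) hV hx, lap_mul he hS hV hx, hgE,
      lap_add hl hg hV hx, lap_exp hc hV hx, lap_const_mul hw hV hx, hcc]
  rw [qCurv, laplaceBeltrami_conformal hw1, hlR, hgR, ricciNormSq_conformal hw hV hx,
    scalarCurv_conformal hw hV hx, lap_gradDot_self hw hV hx, gradDot_gradDot_self hw hV hx]
  generalize (∑ i, ∑ j, pd i (pd j w) x * pd i (pd j w) x) = a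
  generalize (∑ i, ∑ j, pd i (pd j w) x * pd i w x * pd j w x) = b
  linear_combination (1 / 2 * lap (lap w) x) * hE

end

/-! ### Radial and tangential calculus -/

/-- Twice the tangential inner product of gradients, on spheres about the origin. -/
def rotDot (f g : E4 → ℝ) (x : E4) : ℝ := ∑ i, ∑ j, rot i j f x * rot i j g x

/-- Twice the Laplacian of the unit sphere, extended by homogeneity. -/
def rotLap (f : E4 → ℝ) (x : E4) : ℝ := ∑ i, ∑ j, rot i j (rot i j f) x

section

variable {V : Set E4} {w f g h : E4 → ℝ} {x : E4} {i j : Fin 4}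

theorem pd_euler (hf : SmoothOn V f) (hV : IsOpen V) (hx : x ∈ V) (k : Fin 4) :
    pd k (euler f) x = pd k f x + ∑ i, x i * pd k (pd i f) x := by
  have hd := hf.pd_differentiableAt hV hx
  have hc : ∀ i, DifferentiableAt ℝ (fun y : E4 => y i) x := fun i => by fun_prop
  have : euler f = fun y => ∑ i, y i * pd i f y := rfl
  rw [this, pd_sum fun i _ => (hc i).fun_mul (hd i)]
  simp_rw [fun i => pd_mul (i := k) (hc i) (hd i), pd_coord, Finset.sum_add_distrib]
  simp [add_comm]

theorem euler_euler (hf : SmoothOn V f) (hV : IsOpen V) (hx : x ∈ V) :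
    euler (euler f) x = euler f x + ∑ i, ∑ j, x i * x j * pd i (pd j f) x := by
  rw [euler]
  simp_rw [pd_euler hf hV hx, mul_add, Finset.sum_add_distrib, Finset.mul_sum, mul_assoc]
  rfl

theorem euler_gradDot_self (hf : SmoothOn V f) (hV : IsOpen V) (hx : x ∈ V) :
    euler (gradDot f f) x = 2 * gradDot f (euler f) x - 2 * gradDot f f x := by
  simp_rw [euler, pd_gradDot hf hf hV hx]
  have h1 : gradDot f (euler f) x = ∑ i, pd i f x * (pd i f x + ∑ j, x j * pd j (pd i f) x) := by
    refine Finset.sum_congr rfl fun i _ => ?_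
    rw [pd_euler hf hV hx]
    simp_rw [fun j => pd_comm hf hV hx i j]
  change _ = 2 * gradDot f (euler f) x - _
  rw [h1]
  simp only [gradDot, Fin.sum_univ_four]
  ring

theorem rot_rot (hf : SmoothOn V f) (hV : IsOpen V) (hx : x ∈ V) :
    rot i j (rot i j f) x = x i * x i * pd j (pd j f) x + x j * x j * pd i (pd i f) x
      - 2 * (x i * x j * pd i (pd j f) x) + 2 * delta i j * (x i * pd j f x)
      - x i * pd i f x - x j * pd j f x := by
  have hd := hf.pd_differentiableAt hV hx
  have hc : ∀ i, DifferentiableAt ℝ (fun y : E4 => y i) x := fun i => by fun_prop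
  have key : ∀ k, pd k (rot i j f) x = x i * pd k (pd j f) x + delta k i * pd j f x
      - (x j * pd k (pd i f) x + delta k j * pd i f x) := by
    intro k
    have : rot i j f = fun y => y i * pd j f y - y j * pd i f y := rfl
    rw [this, pd_sub ((hc i).fun_mul (hd j)) ((hc j).fun_mul (hd i)), pd_mul (hc i) (hd j),
      pd_mul (hc j) (hd i), pd_coord, pd_coord]
    rfl
  rw [rot, key, key, pd_comm hf hV hx j i, delta_comm j i]
  have hii : ∀ i, delta i i = 1 := fun i => by simp [delta]
  rw [hii, hii]
  by_cases hij : i = j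
  · subst hij
    rw [hii]
    ring
  · simp only [delta, if_neg hij]
    ring

/-- The polar form r²Δ = (r∂_r)² + 2r∂_r + Δ_{S³} of the Laplacian on ℝ⁴. The sum over ordered pairs
meets each rotation plane twice, hence the factor 2. -/
theorem rotLap_eq (hf : SmoothOn V f) (hV : IsOpen V) (hx : x ∈ V) :
    rotLap f x = 2 * (‖x‖ ^ 2 * lap f x - euler (euler f) x - 2 * euler f x) := by
  simp_rw [rotLap, rot_rot hf hV hx, euler_euler hf hV hx, normSq_eq]
  simp only [lap, euler, Fin.sum_univ_four, delta]
  simp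
  ring

/-- Lagrange's identity applied to the position vector and the two gradients. -/
theorem rotDot_eq (f g : E4 → ℝ) (x : E4) :
    rotDot f g x = 2 * (‖x‖ ^ 2 * gradDot f g x - euler f x * euler g x) := by
  rw [normSq_eq]
  simp only [rotDot, rot, gradDot, euler, Fin.sum_univ_four]
  ring

theorem rot_mul (hf : DifferentiableAt ℝ f x) (hg : DifferentiableAt ℝ g x) :
    rot i j (fun y => f y * g y) x = f x * rot i j g x + rot i j f x * g x := by
  simp_rw [rot, pd_mul hf hg]
  ring

theorem rot_sub (hf : DifferentiableAt ℝ f x) (hg : DifferentiableAt ℝ g x) :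
    rot i j (fun y => f y - g y) x = rot i j f x - rot i j g x := by
  simp_rw [rot, pd_sub hf hg]
  ring

theorem rot_const_mul (hf : DifferentiableAt ℝ f x) (c : ℝ) :
    rot i j (fun y => c * f y) x = c * rot i j f x := by
  simp_rw [rot, pd_const_mul hf]
  ring

theorem rot_exp (hf : DifferentiableAt ℝ f x) :
    rot i j (fun y => Real.exp (f y)) x = Real.exp (f x) * rot i j f x := by
  simp_rw [rot, pd_exp hf]
  ring

theorem EqOn.rot (hV : IsOpen V) (h : EqOn f g V) (i j : Fin 4) :
    EqOn (rot i j f) (rot i j g) V := fun x hx => by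
  simp_rw [LocalCGB.rot, EqOn.pd hV h _ hx]

theorem smoothOn_norm_inv (h0 : (0 : E4) ∉ V) : SmoothOn V fun y => ‖y‖⁻¹ := fun y hy => by
  have hy0 : y ≠ 0 := fun h => h0 (h ▸ hy)
  exact ((contDiffAt_norm ℝ hy0).inv (norm_ne_zero_iff.2 hy0)).contDiffWithinAt

theorem pd_norm (hx : x ≠ 0) : pd i (fun y : E4 => ‖y‖) x = x i * ‖x‖⁻¹ := by
  have hd : DifferentiableAt ℝ (fun y : E4 => ‖y‖) x :=
    (contDiffAt_norm (n := 1) ℝ hx).differentiableAt (by simp)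
  have h := pd_normSq (x := x) (i := i)
  have h2 : (fun y : E4 => ‖y‖ ^ 2) = fun y => ‖y‖ * ‖y‖ := funext fun _ => sq _
  rw [h2, pd_mul hd hd] at h
  have hn : ‖x‖ ≠ 0 := norm_ne_zero_iff.2 hx
  field_simp
  linarith

theorem pd_norm_inv (hx : x ≠ 0) : pd i (fun y : E4 => ‖y‖⁻¹) x = -(x i * ‖x‖⁻¹ ^ 3) := by
  have hd : DifferentiableAt ℝ (fun y : E4 => ‖y‖) x :=
    (contDiffAt_norm (n := 1) ℝ hx).differentiableAt (by simp)
  have hn : ‖x‖ ≠ 0 := norm_ne_zero_iff.2 hx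
  have h := (hasDerivAt_inv hn).comp_hasFDerivAt x hd.hasFDerivAt
  have h2 : fderiv ℝ (fun y : E4 => ‖y‖⁻¹) x = -(‖x‖ ^ 2)⁻¹ • fderiv ℝ (fun y : E4 => ‖y‖) x :=
    h.fderiv
  have h3 := pd_norm (i := i) hx
  rw [pd] at h3 ⊢
  rw [h2, smul_apply, h3]
  simp only [smul_eq_mul]
  field_simp

theorem rot_norm_inv (hx : x ≠ 0) : rot i j (fun y : E4 => ‖y‖⁻¹) x = 0 := by
  simp_rw [rot, pd_norm_inv hx]
  ring

/-! ### The geometry of spheres about the origin -/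

/-- The Euclidean projection onto the tangent space of the sphere through `x`. -/
def sphereProj (x : E4) : Matrix (Fin 4) (Fin 4) ℝ :=
  Matrix.of fun i j => delta i j - ‖x‖⁻¹ ^ 2 * (x i * x j)

theorem norm_inv_sq_mul (hx : x ≠ 0) : ‖x‖⁻¹ ^ 2 * ∑ i, x i * x i = 1 := by
  rw [← normSq_eq]
  have : ‖x‖ ≠ 0 := norm_ne_zero_iff.2 hx
  field_simp

theorem sphereProj_mul_coord (hx : x ≠ 0) (i : Fin 4) : ∑ j, sphereProj x j i * x j = 0 := by
  have h := norm_inv_sq_mul hx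
  have : ∀ j, sphereProj x j i * x j = delta j i * x j - ‖x‖⁻¹ ^ 2 * (x j * x j) * x i :=
    fun j => by simp only [sphereProj, Matrix.of_apply]; ring
  simp_rw [this, Finset.sum_sub_distrib, sum_delta_mul', ← Finset.sum_mul, ← Finset.mul_sum, h]
  ring

theorem sphereProj_comm (x : E4) (i j : Fin 4) : sphereProj x i j = sphereProj x j i := by
  simp only [sphereProj, Matrix.of_apply, delta_comm i j, mul_comm (x i)]

theorem sphereProj_mul_self (hx : x ≠ 0) : sphereProj x * sphereProj x = sphereProj x := by
  ext i j
  have h0 := sphereProj_mul_coord hx i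
  have : ∀ k, sphereProj x i k * sphereProj x k j
      = delta k j * sphereProj x k i - ‖x‖⁻¹ ^ 2 * x j * (sphereProj x k i * x k) := fun k => by
    rw [sphereProj_comm x i k]
    nth_rewrite 2 [sphereProj]
    simp only [Matrix.of_apply]
    ring
  simp_rw [Matrix.mul_apply, this, Finset.sum_sub_distrib, ← Finset.mul_sum, h0, sum_delta_mul']
  rw [sphereProj_comm]
  ring

theorem trace_sphereProj (hx : x ≠ 0) : (sphereProj x).trace = 3 := by
  have h := norm_inv_sq_mul hx
  simp only [Matrix.trace, Matrix.diag, sphereProj, Matrix.of_apply, Finset.sum_sub_distrib,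
    ← Finset.mul_sum, h, sum_delta_self]
  norm_num

theorem innerNormal_sphere (w : E4 → ℝ) (hx : x ≠ 0) (i : Fin 4) :
    innerNormal (conformalMetric w) (fun y => ‖y‖ ^ 2) i x
      = -(Real.exp (-w x) * (‖x‖⁻¹ * x i)) := by
  have hn : 0 < ‖x‖ := norm_pos_iff.2 hx
  have h1 : ∑ k, ∑ l, (conformalMetric w x)⁻¹ k l * (2 * x k) * (2 * x l)
      = (2 * ‖x‖ * Real.exp (-w x)) ^ 2 := by
    have : ∀ k l, (conformalMetric w x)⁻¹ k l * (2 * x k) * (2 * x l)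
        = 4 * Real.exp (-2 * w x) * (delta k l * (x k * x l)) := fun k l => by
      rw [conformalMetric_inv_apply]; ring
    simp_rw [this, ← Finset.mul_sum, sum_delta_mul, ← normSq_eq]
    rw [mul_pow, mul_pow, ← Real.exp_nat_mul]
    push_cast
    ring_nf
  have h2 : ∑ j, (conformalMetric w x)⁻¹ i j * (2 * x j) = Real.exp (-w x) ^ 2 * (2 * x i) := by
    simp_rw [conformalMetric_inv_apply, mul_assoc, ← Finset.mul_sum, sum_delta_mul]
    rw [← Real.exp_nat_mul]
    push_cast
    ring_nf
  simp_rw [innerNormal, pd_normSq, h1, h2]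
  rw [Real.sqrt_sq (by positivity)]
  have := Real.exp_pos (-w x)
  field_simp

theorem exp_two_mul_sq (a : ℝ) : Real.exp (2 * a) * Real.exp (-a) ^ 2 = 1 := by
  rw [← Real.exp_nat_mul, ← Real.exp_add]
  norm_num

theorem tangProj_sphere (w : E4 → ℝ) (hx : x ≠ 0) (i j : Fin 4) :
    tangProj (conformalMetric w) (fun y => ‖y‖ ^ 2) i j x = sphereProj x i j := by
  have he := exp_two_mul_sq (w x)
  simp_rw [tangProj, innerNormal_sphere w hx, conformalMetric_apply, mul_assoc,
    ← Finset.mul_sum, sum_delta_mul, sphereProj, Matrix.of_apply]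
  change delta i j - _ = _
  linear_combination -(‖x‖⁻¹ ^ 2 * x i * x j) * he

theorem covDeriv_innerNormal (hw : SmoothOn V w) (hV : IsOpen V) (h0 : (0 : E4) ∉ V) (hx : x ∈ V)
    (i k : Fin 4) :
    covDeriv (conformalMetric w) (innerNormal (conformalMetric w) fun y => ‖y‖ ^ 2) i k x
      = -(Real.exp (-w x) * ‖x‖⁻¹ * (delta i k * (1 + euler w x)
        - x i * (‖x‖⁻¹ ^ 2 * x k + pd k w x))) := by
  have hx0 : x ≠ 0 := fun h => h0 (h ▸ hx)
  have hw1 := hw.differentiableAt hV hx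
  have hs := (smoothOn_norm_inv h0).differentiableAt hV hx
  have hc : DifferentiableAt ℝ (fun y : E4 => y k) x := by fun_prop
  have hN : EqOn (innerNormal (conformalMetric w) (fun y => ‖y‖ ^ 2) k)
      (fun y => -1 * (Real.exp (-1 * w y) * (‖y‖⁻¹ * y k))) V := fun y hy => by
    rw [innerNormal_sphere w fun h => h0 (h ▸ hy)]
    ring_nf
  have hE : DifferentiableAt ℝ (fun y => Real.exp (-1 * w y)) x := (hw1.const_mul _).exp
  have hsum : ∑ l, christoffel (conformalMetric w) k i l x *
      -(Real.exp (-w x) * (‖x‖⁻¹ * x l))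
      = -(Real.exp (-w x) * ‖x‖⁻¹) * (x k * pd i w x + delta k i * euler w x - x i * pd k w x) := by
    have : ∀ l, christoffel (conformalMetric w) k i l x * -(Real.exp (-w x) * (‖x‖⁻¹ * x l))
        = -(Real.exp (-w x) * ‖x‖⁻¹) * (delta k l * (x l * pd i w x)
          + delta k i * (x l * pd l w x) - delta i l * (x l * pd k w x)) := fun l => by
      rw [christoffel_conformal hw1]; ring
    simp_rw [this, ← Finset.mul_sum, Finset.sum_sub_distrib, Finset.sum_add_distrib,
      sum_delta_mul, ← Finset.mul_sum]
    rfl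
  simp_rw [covDeriv, innerNormal_sphere w hx0, hsum]
  rw [EqOn.pd hV hN i hx, pd_const_mul (hE.fun_mul (hs.fun_mul hc)), pd_mul hE (hs.fun_mul hc),
    pd_mul hs hc, pd_exp (hw1.const_mul _), pd_const_mul hw1, pd_norm_inv hx0, pd_coord]
  change -1 * (_ * (_ * delta i k + _) + _) + _ = _
  rw [delta_comm k i, neg_one_mul (w x)]
  ring

/-- Umbilicity survives a conformal change. In the covariant derivative of the normal, every term
but the Kronecker one carries a factor `x i`, which the tangential projection kills; what remains is
a multiple of the projection. -/
theorem secondFF_sphere (hw : SmoothOn V w) (hV : IsOpen V) (h0 : (0 : E4) ∉ V) (hx : x ∈ V)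
    (a b : Fin 4) :
    secondFF (conformalMetric w) (fun y => ‖y‖ ^ 2) a b x
      = Real.exp (2 * w x) * (Real.exp (-w x) * ‖x‖⁻¹ * (1 + euler w x)) * sphereProj x a b := by
  have hx0 : x ≠ 0 := fun h => h0 (h ▸ hx)
  have hP := congrFun (congrFun (sphereProj_mul_self hx0) a) b
  rw [Matrix.mul_apply] at hP
  simp_rw [secondFF, tangProj_sphere w hx0, conformalMetric_apply,
    covDeriv_innerNormal hw hV h0 hx]
  have h1 : ∀ i j k, sphereProj x i a * sphereProj x j b * (Real.exp (2 * w x) * delta j k)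
      * -(Real.exp (-w x) * ‖x‖⁻¹ * (delta i k * (1 + euler w x)
        - x i * (‖x‖⁻¹ ^ 2 * x k + pd k w x)))
      = delta j k * (-(Real.exp (2 * w x) * Real.exp (-w x) * ‖x‖⁻¹) *
        (sphereProj x i a * sphereProj x j b * (delta i k * (1 + euler w x)
        - x i * (‖x‖⁻¹ ^ 2 * x k + pd k w x)))) := fun i j k => by ring
  simp_rw [h1, sum_delta_mul, ← Finset.mul_sum]
  have h2 : ∀ i j, sphereProj x i a * sphereProj x j b * (delta i j * (1 + euler w x)
        - x i * (‖x‖⁻¹ ^ 2 * x j + pd j w x))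
      = delta i j * ((1 + euler w x) * (sphereProj x a i * sphereProj x j b))
        - sphereProj x i a * x i * (sphereProj x j b * (‖x‖⁻¹ ^ 2 * x j + pd j w x)) :=
    fun i j => by rw [sphereProj_comm x a i]; ring
  simp_rw [h2, Finset.sum_sub_distrib, sum_delta_mul, ← Finset.mul_sum, ← Finset.sum_mul,
    sphereProj_mul_coord hx0, hP]
  ring

theorem shapeOp_sphere (hw : SmoothOn V w) (hV : IsOpen V) (h0 : (0 : E4) ∉ V) (hx : x ∈ V) :
    shapeOp (conformalMetric w) (fun y => ‖y‖ ^ 2) x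
      = (Real.exp (-w x) * ‖x‖⁻¹ * (1 + euler w x)) • sphereProj x := by
  have he : Real.exp (-2 * w x) * Real.exp (2 * w x) = 1 := by
    rw [← Real.exp_add]; simp
  rw [shapeOp, conformalMetric_inv]
  ext a b
  simp only [Matrix.smul_mul, one_mul, Matrix.smul_apply, Matrix.of_apply, smul_eq_mul,
    secondFF_sphere hw hV h0 hx]
  linear_combination (Real.exp (-w x) * ‖x‖⁻¹ * (1 + euler w x) * sphereProj x a b) * he

theorem meanCurv_sphere (hw : SmoothOn V w) (hV : IsOpen V) (h0 : (0 : E4) ∉ V) (hx : x ∈ V) :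
    meanCurv (conformalMetric w) (fun y => ‖y‖ ^ 2) x
      = ‖x‖⁻¹ * (3 * (Real.exp (-1 * w x) * (1 + euler w x))) := by
  have hx0 : x ≠ 0 := fun h => h0 (h ▸ hx)
  rw [meanCurv, shapeOp_sphere hw hV h0 hx, Matrix.trace_smul, trace_sphereProj hx0, smul_eq_mul,
    neg_one_mul]
  ring

theorem trace_shapeOp_pow_three (hw : SmoothOn V w) (hV : IsOpen V) (h0 : (0 : E4) ∉ V)
    (hx : x ∈ V) :
    (shapeOp (conformalMetric w) (fun y => ‖y‖ ^ 2) x ^ 3).trace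
      = 3 * (Real.exp (-w x) * ‖x‖⁻¹ * (1 + euler w x)) ^ 3 := by
  have hx0 : x ≠ 0 := fun h => h0 (h ▸ hx)
  have : sphereProj x ^ 3 = sphereProj x := by
    rw [pow_succ, pow_two, sphereProj_mul_self hx0, sphereProj_mul_self hx0]
  rw [shapeOp_sphere hw hV h0 hx, smul_pow, this, Matrix.trace_smul, trace_sphereProj hx0,
    smul_eq_mul, mul_comm]

end

/-! ### Normal curvature and the intrinsic Laplacian of the sphere -/

section

variable {V : Set E4} {w f g F : E4 → ℝ} {x : E4} {i j : Fin 4}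

theorem curvatureOp_conformal_antisymm (hw : SmoothOn V w) (hV : IsOpen V) (hx : x ∈ V)
    (l k i j : Fin 4) :
    curvatureOp (conformalMetric w) l k i j x = -curvatureOp (conformalMetric w) l k j i x := by
  rw [curvatureOp_conformal hw hV hx, curvatureOp_conformal hw hV hx]
  ring

/-- Since the sphere is umbilic, A is a multiple of the tangential metric, and the contraction is
that multiple of Rc(N, N). The normal part subtracted by the projection contributes R(N, N, ·, ·),
which vanishes by antisymmetry. -/
theorem normalCurvContraction_sphere (hw : SmoothOn V w) (hV : IsOpen V) (h0 : (0 : E4) ∉ V)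
    (hx : x ∈ V) (hx1 : ‖x‖ = 1) :
    normalCurvContraction (conformalMetric w) (fun y => ‖y‖ ^ 2) x
      = Real.exp (-w x) ^ 3 * (1 + euler w x) * (-2 * (euler (euler w) x - euler w x)
        + 2 * euler w x ^ 2 - (lap w x + 2 * gradDot w w x)) := by
  have hx0 : x ≠ 0 := fun h => h0 (h ▸ hx)
  have hn : ∑ i, x i * x i = 1 := by rw [← normSq_eq, hx1]; norm_num
  set R := conformalMetric w with hR
  have hE : Real.exp (-2 * w x) = Real.exp (-w x) ^ 2 := by
    rw [← Real.exp_nat_mul]; push_cast; ring_nf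
  have he := exp_two_mul_sq (w x)
  set e := Real.exp (-w x) with he'
  have hterm : ∀ a b p q, riemann R a p b q x * innerNormal R (fun y => ‖y‖ ^ 2) p x *
      innerNormal R (fun y => ‖y‖ ^ 2) q x * (shapeOp R (fun y => ‖y‖ ^ 2) x * (R x)⁻¹) a b
      = e ^ 3 * (1 + euler w x) * (x p * x q * (delta a b * curvatureOp R b q a p x)
        - x q * x b * (x a * x p * curvatureOp R b q a p x)) := by
    intro a b p q
    have h1 : riemann R a p b q x = Real.exp (2 * w x) * curvatureOp R b q a p x := by
      simp_rw [riemann, hR, conformalMetric_apply, mul_assoc, ← Finset.mul_sum, sum_delta_mul]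
    have h2 : (shapeOp R (fun y => ‖y‖ ^ 2) x * (R x)⁻¹) a b
        = e ^ 2 * (e * (1 + euler w x)) * (delta a b - x a * x b) := by
      rw [hR, shapeOp_sphere hw hV h0 hx, conformalMetric_inv, hE, hx1]
      simp [sphereProj, hx1]
      ring
    rw [h1, h2, hR, innerNormal_sphere w hx0, innerNormal_sphere w hx0, hx1, inv_one, ← he']
    linear_combination (e ^ 3 * (1 + euler w x) * x p * x q * (delta a b - x a * x b)
      * curvatureOp (conformalMetric w) b q a p x) * he
  have hanti : ∀ b q, ∑ a, ∑ p, x a * x p * curvatureOp R b q a p x = 0 := by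
    intro b q
    have h : ∑ a, ∑ p, x a * x p * curvatureOp R b q a p x
        = -∑ a, ∑ p, x a * x p * curvatureOp R b q a p x := by
      conv_lhs => rw [Finset.sum_comm]
      simp_rw [← Finset.sum_neg_distrib]
      refine Finset.sum_congr rfl fun a _ => Finset.sum_congr rfl fun p _ => ?_
      rw [hR, curvatureOp_conformal_antisymm hw hV hx]
      ring
    linarith
  have hfirst : ∑ a, ∑ b, ∑ p, ∑ q, x p * x q * (delta a b * curvatureOp R b q a p x)
      = ∑ p, ∑ q, x p * x q * ricci R p q x := by
    simp_rw [ricci, Finset.mul_sum]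
    have h1 : ∀ a, ∑ b, ∑ p, ∑ q, x p * x q * (delta a b * curvatureOp R b q a p x)
        = ∑ p, ∑ q, x p * x q * curvatureOp R a q a p x := by
      intro a
      rw [Finset.sum_comm]
      refine Finset.sum_congr rfl fun p _ => ?_
      rw [Finset.sum_comm]
      refine Finset.sum_congr rfl fun q _ => ?_
      rw [← Finset.mul_sum, sum_delta_mul]
    simp_rw [h1]
    rw [Finset.sum_comm]
    refine Finset.sum_congr rfl fun p _ => ?_
    rw [Finset.sum_comm]
  have hsecond : ∑ a, ∑ b, ∑ p, ∑ q, x q * x b * (x a * x p * curvatureOp R b q a p x) = 0 := by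
    rw [Finset.sum_comm]
    refine Finset.sum_eq_zero fun b _ => ?_
    have : ∀ a, ∑ p, ∑ q, x q * x b * (x a * x p * curvatureOp R b q a p x)
        = ∑ q, x q * x b * ∑ p, x a * x p * curvatureOp R b q a p x := by
      intro a
      rw [Finset.sum_comm]
      simp_rw [← Finset.mul_sum]
    simp_rw [this]
    rw [Finset.sum_comm]
    simp_rw [← Finset.mul_sum, hanti]
    simp
  simp_rw [normalCurvContraction, hterm, ← Finset.mul_sum, Finset.sum_sub_distrib, hfirst,
    hsecond, hR, ricci_conformal hw hV hx]
  have hric : ∀ p q, x p * x q * (-2 * pd p (pd q w) x + 2 * pd p w x * pd q w x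
        - delta p q * (lap w x + 2 * gradDot w w x))
      = -2 * (x p * x q * pd p (pd q w) x) + 2 * ((x p * pd p w x) * (x q * pd q w x))
        - delta p q * ((x p * x q) * (lap w x + 2 * gradDot w w x)) := fun p q => by ring
  simp_rw [hric, Finset.sum_sub_distrib, Finset.sum_add_distrib, sum_delta_mul, ← Finset.mul_sum,
    ← Finset.sum_mul, hn, euler_euler hw hV hx]
  simp only [euler]
  ring

/-- The conformal law Δ̃F = e^{-2w}(Δ_S F + (n - 2)⟨∇w, ∇F⟩) on a surface of dimension n = 3. The
halves undo the double counting in `rotLap` and `rotDot`. -/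
theorem boundaryLaplace_sphere (hw : SmoothOn V w) (hF : SmoothOn V F) (hV : IsOpen V)
    (h0 : (0 : E4) ∉ V) (hx : x ∈ V) (hx1 : ‖x‖ = 1) :
    boundaryLaplace (conformalMetric w) (fun y => ‖y‖ ^ 2) F x
      = Real.exp (-2 * w x) * (1 / 2 * rotLap F x + 1 / 2 * rotDot w F x) := by
  have hx0 : x ≠ 0 := fun h => h0 (h ▸ hx)
  have hn : ∑ i, x i * x i = 1 := by rw [← normSq_eq, hx1]; norm_num
  have hw1 := hw.differentiableAt hV hx
  have hs := (smoothOn_norm_inv h0).differentiableAt hV hx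
  have hc : ∀ k, DifferentiableAt ℝ (fun y : E4 => y k) x := fun k => by fun_prop
  have hE : DifferentiableAt ℝ (fun y => Real.exp (-2 * w y)) x := (hw1.const_mul _).exp
  have hF2 := hF.pd_differentiableAt hV hx
  have heF := (hF.euler hV).differentiableAt hV hx
  have htg : ∀ k, EqOn (tangGrad (conformalMetric w) (fun y => ‖y‖ ^ 2) F k)
      (fun y => Real.exp (-2 * w y) * (pd k F y - ‖y‖⁻¹ * (‖y‖⁻¹ * (y k * euler F y)))) V := by
    intro k y hy
    have hy0 : y ≠ 0 := fun h => h0 (h ▸ hy)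
    simp_rw [tangGrad, tangProj_sphere w hy0, conformalMetric_inv_apply]
    have : ∀ i j, sphereProj y k i * (Real.exp (-2 * w y) * delta i j) * pd j F y
        = Real.exp (-2 * w y) * (delta i j * (sphereProj y k i * pd j F y)) :=
      fun i j => by ring
    simp_rw [this, ← Finset.mul_sum, sum_delta_mul]
    congr 1
    have : ∀ i, sphereProj y k i * pd i F y
        = delta k i * pd i F y - ‖y‖⁻¹ * (‖y‖⁻¹ * y k) * (y i * pd i F y) := fun i => by
      simp only [sphereProj, Matrix.of_apply]; ring
    simp_rw [this, Finset.sum_sub_distrib, sum_delta_mul, ← Finset.mul_sum, euler]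
    ring
  have hcov : ∀ i k, covDeriv (conformalMetric w)
      (tangGrad (conformalMetric w) (fun y => ‖y‖ ^ 2) F) i k x
      = Real.exp (-2 * w x) * (pd i (pd k F) x - delta i k * euler F x - x k * pd i (euler F) x
        + 2 * x i * x k * euler F x - pd i w x * (pd k F x - x k * euler F x)
        + delta i k * (gradDot w F x - euler w x * euler F x)
        - pd k w x * (pd i F x - x i * euler F x)) := by
    intro i k
    have hsum : ∑ l, christoffel (conformalMetric w) k i l x *
        (Real.exp (-2 * w x) * (pd l F x - x l * euler F x))
        = Real.exp (-2 * w x) * (pd i w x * (pd k F x - x k * euler F x)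
        + delta i k * (gradDot w F x - euler w x * euler F x)
        - pd k w x * (pd i F x - x i * euler F x)) := by
      have : ∀ l, christoffel (conformalMetric w) k i l x *
          (Real.exp (-2 * w x) * (pd l F x - x l * euler F x))
          = Real.exp (-2 * w x) * (delta k l * (pd i w x * (pd l F x - x l * euler F x))
            + (delta i k * (pd l w x * pd l F x) - delta i k * euler F x * (x l * pd l w x))
            - delta i l * (pd k w x * (pd l F x - x l * euler F x))) := fun l => by
        rw [christoffel_conformal hw1, delta_comm k i]; ring
      simp_rw [this, ← Finset.mul_sum, Finset.sum_sub_distrib, Finset.sum_add_distrib,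
        sum_delta_mul, Finset.sum_sub_distrib, ← Finset.mul_sum]
      simp only [gradDot, euler]
      ring
    have h1 := htg
    simp_rw [covDeriv, htg _ hx, hx1, inv_one, one_mul, hsum]
    rw [EqOn.pd hV (htg k) i hx, pd_mul hE ((hF2 k).fun_sub
      (hs.fun_mul (hs.fun_mul ((hc k).fun_mul heF)))), pd_sub (hF2 k)
      (hs.fun_mul (hs.fun_mul ((hc k).fun_mul heF))), pd_mul hs (hs.fun_mul ((hc k).fun_mul heF)),
      pd_mul hs ((hc k).fun_mul heF), pd_mul (hc k) heF, pd_exp (hw1.const_mul _),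
      pd_const_mul hw1, pd_norm_inv hx0, pd_coord, hx1]
    change _ * (_ - (1⁻¹ * (1⁻¹ * (_ + delta i k * _) + _) + _)) + _ + _ = _
    ring
  have hpdE : ∑ i, x i * pd i (euler F) x = euler (euler F) x := rfl
  have hee := euler_euler hF hV hx
  simp_rw [boundaryLaplace, tangProj_sphere w hx0, hcov]
  have hexp : ∀ i k, sphereProj x i k * (Real.exp (-2 * w x) * (pd i (pd k F) x
        - delta i k * euler F x - x k * pd i (euler F) x
        + 2 * x i * x k * euler F x - pd i w x * (pd k F x - x k * euler F x)
        + delta i k * (gradDot w F x - euler w x * euler F x)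
        - pd k w x * (pd i F x - x i * euler F x)))
      = Real.exp (-2 * w x) * (delta i k * (pd i (pd k F) x
        - delta i k * euler F x - x k * pd i (euler F) x
        + 2 * x i * x k * euler F x - pd i w x * (pd k F x - x k * euler F x)
        + delta i k * (gradDot w F x - euler w x * euler F x)
        - pd k w x * (pd i F x - x i * euler F x))
        - (x i * x k * pd i (pd k F) x + delta i k * (x i * x k * (gradDot w F x
          - euler w x * euler F x - euler F x)) - (x i * pd i (euler F) x) * (x k * x k)
          + 2 * euler F x * (x i * x i) * (x k * x k) - (x i * pd i w x) * (x k * pd k F x)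
          + euler F x * (x i * pd i w x) * (x k * x k) - (x k * pd k w x) * (x i * pd i F x)
          + euler F x * (x k * pd k w x) * (x i * x i))) := fun i k => by
    simp only [sphereProj, Matrix.of_apply, hx1]
    ring
  have hii : ∀ i, delta i i = 1 := fun i => by simp [delta]
  simp_rw [hexp, ← Finset.mul_sum, Finset.sum_sub_distrib, sum_delta_mul, hii]
  congr 1
  have hdiag : ∀ i, pd i (pd i F) x - 1 * euler F x - x i * pd i (euler F) x
      + 2 * x i * x i * euler F x - pd i w x * (pd i F x - x i * euler F x)
      + 1 * (gradDot w F x - euler w x * euler F x) - pd i w x * (pd i F x - x i * euler F x)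
      = pd i (pd i F) x - x i * pd i (euler F) x + (2 * euler F x) * (x i * x i)
        - 2 * (pd i w x * pd i F x) + (2 * euler F x) * (x i * pd i w x)
        + (gradDot w F x - euler w x * euler F x - euler F x) := fun i => by ring
  simp_rw [hdiag]
  simp only [Finset.sum_sub_distrib, Finset.sum_add_distrib, sum_delta_mul, ← Finset.mul_sum,
    ← Finset.sum_mul, hn, Finset.sum_const, Finset.card_univ, Fintype.card_fin, hpdE]
  rw [rotLap_eq hF hV hx, rotDot_eq, hx1, hee]
  simp only [gradDot, lap, euler, nsmul_eq_mul]
  push_cast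
  ring

end

/-! ### The boundary curvature T on the unit sphere -/

section

variable {V : Set E4} {w f g F : E4 → ℝ} {x : E4} {i j : Fin 4}

theorem smoothOn_meanCurv (hw : SmoothOn V w) (hV : IsOpen V) (h0 : (0 : E4) ∉ V) :
    SmoothOn V (meanCurv (conformalMetric w) fun y => ‖y‖ ^ 2) := by
  have : SmoothOn V fun y => ‖y‖⁻¹ * (3 * (Real.exp (-1 * w y) * (1 + euler w y))) :=
    (smoothOn_norm_inv h0).mul (contDiffOn_const.mul
      ((smoothOn_exp_scalar hw (-1)).mul (contDiffOn_const.add (hw.euler hV))))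
  exact this.congr fun y hy => meanCurv_sphere hw hV h0 hy

theorem rot_meanCurv (hw : SmoothOn V w) (hV : IsOpen V) (h0 : (0 : E4) ∉ V) (hx : x ∈ V) :
    rot i j (meanCurv (conformalMetric w) fun y => ‖y‖ ^ 2) x
      = ‖x‖⁻¹ * (3 * (Real.exp (-1 * w x) *
        (rot i j (euler w) x - (1 + euler w x) * rot i j w x))) := by
  have hx0 : x ≠ 0 := fun h => h0 (h ▸ hx)
  have hw1 := hw.differentiableAt hV hx
  have hv1 := (hw.euler hV).differentiableAt hV hx
  have hE : DifferentiableAt ℝ (fun y => Real.exp (-1 * w y)) x := (hw1.const_mul _).exp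
  have hv2 : DifferentiableAt ℝ (fun y => 1 + euler w y) x := hv1.const_add 1
  have hr : rot i j (fun y => 1 + euler w y) x = rot i j (euler w) x := by
    simp_rw [rot, pd_add (differentiableAt_const _) hv1, pd_const, zero_add]
  rw [EqOn.rot hV (fun y hy => meanCurv_sphere hw hV h0 hy) i j hx,
    rot_mul ((smoothOn_norm_inv h0).differentiableAt hV hx) ((hE.fun_mul hv2).const_mul 3),
    rot_norm_inv hx0, rot_const_mul (hE.fun_mul hv2), rot_mul hE hv2, rot_exp (hw1.const_mul _),
    rot_const_mul hw1, hr]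
  ring

theorem rot_rot_meanCurv (hw : SmoothOn V w) (hV : IsOpen V) (h0 : (0 : E4) ∉ V) (hx : x ∈ V)
    (hx1 : ‖x‖ = 1) :
    rot i j (rot i j (meanCurv (conformalMetric w) fun y => ‖y‖ ^ 2)) x
      = 3 * Real.exp (-w x) * (rot i j (rot i j (euler w)) x
        - 2 * (rot i j w x * rot i j (euler w) x) - (1 + euler w x) * rot i j (rot i j w) x
        + (1 + euler w x) * (rot i j w x * rot i j w x)) := by
  have hx0 : x ≠ 0 := fun h => h0 (h ▸ hx)
  have hw1 := hw.differentiableAt hV hx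
  have hv1 := (hw.euler hV).differentiableAt hV hx
  have hr1 := (hw.rot hV i j).differentiableAt hV hx
  have hrv1 := ((hw.euler hV).rot hV i j).differentiableAt hV hx
  have hE : DifferentiableAt ℝ (fun y => Real.exp (-1 * w y)) x := (hw1.const_mul _).exp
  have hv2 : DifferentiableAt ℝ (fun y => 1 + euler w y) x := hv1.const_add 1
  have hr : rot i j (fun y => 1 + euler w y) x = rot i j (euler w) x := by
    simp_rw [rot, pd_add (differentiableAt_const _) hv1, pd_const, zero_add]
  have hb := hrv1.fun_sub (hv2.fun_mul hr1)
  rw [EqOn.rot hV (fun y hy => rot_meanCurv hw hV h0 hy) i j hx,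
    rot_mul ((smoothOn_norm_inv h0).differentiableAt hV hx) ((hE.fun_mul hb).const_mul 3),
    rot_norm_inv hx0, rot_const_mul (hE.fun_mul hb), rot_mul hE hb, rot_exp (hw1.const_mul _),
    rot_const_mul hw1, rot_sub hrv1 (hv2.fun_mul hr1), rot_mul hv2 hr1, hr, hx1, neg_one_mul]
  ring

theorem rot_divergence_form (hw : SmoothOn V w) (hV : IsOpen V) (hx : x ∈ V) :
    rot i j (fun y => rot i j (euler w) y - 3 * rot i j w y - 2 * (euler w y * rot i j w y)) x
      = rot i j (rot i j (euler w)) x - 3 * rot i j (rot i j w) x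
        - 2 * (euler w x * rot i j (rot i j w) x) - 2 * (rot i j w x * rot i j (euler w) x) := by
  have hv1 := (hw.euler hV).differentiableAt hV hx
  have hr1 := (hw.rot hV i j).differentiableAt hV hx
  have hrv1 := ((hw.euler hV).rot hV i j).differentiableAt hV hx
  rw [rot_sub (hrv1.fun_sub (hr1.const_mul 3)) ((hv1.fun_mul hr1).const_mul 2),
    rot_sub hrv1 (hr1.const_mul 3), rot_const_mul hr1, rot_const_mul (hv1.fun_mul hr1),
    rot_mul hv1 hr1]
  ring

theorem euler_scalarCurv_conformal (hw : SmoothOn V w) (hV : IsOpen V) (hx : x ∈ V) :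
    euler (scalarCurv (conformalMetric w)) x = -6 * (Real.exp (-2 * w x) *
      (euler (lap w) x + 2 * gradDot w (euler w) x - 2 * gradDot w w x
        - 2 * euler w x * (lap w x + gradDot w w x))) := by
  have hl := hw.lap hV
  have hg := hw.gradDot hw hV
  have hw1 := hw.differentiableAt hV hx
  have hl1 := hl.differentiableAt hV hx
  have hg1 := hg.differentiableAt hV hx
  have hE : DifferentiableAt ℝ (fun y => Real.exp (-2 * w y)) x := (hw1.const_mul _).exp
  rw [EqOn.euler hV (fun y hy => scalarCurv_conformal hw hV hy) hx]
  have hS := hl1.fun_add hg1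
  have h : ∀ i, x i * pd i (fun y => -6 * (Real.exp (-2 * w y) * (lap w y + gradDot w w y))) x
      = -6 * Real.exp (-2 * w x) * (x i * pd i (lap w) x)
        + -6 * Real.exp (-2 * w x) * (x i * pd i (gradDot w w) x)
        + 12 * Real.exp (-2 * w x) * (lap w x + gradDot w w x) * (x i * pd i w x) := fun i => by
    rw [pd_const_mul (hE.fun_mul hS), pd_mul hE hS, pd_exp (hw1.const_mul _), pd_const_mul hw1,
      pd_add hl1 hg1]
    ring
  have hgr := euler_gradDot_self hw hV hx
  rw [euler] at hgr
  rw [euler, Finset.sum_congr rfl fun i _ => h i]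
  simp only [Finset.sum_add_distrib, ← Finset.mul_sum, hgr]
  simp only [euler]
  ring

/-- Apart from 2 - ½∂_rΔw, everything nonlinear in T e^{3w} organises itself into rotational
derivatives. Rotations preserve surface measure, so these integrate to zero and only the flux of Δw
and a constant remain. -/
theorem tCurv_conformal (hw : SmoothOn V w) (hV : IsOpen V) (h0 : (0 : E4) ∉ V) (hx : x ∈ V)
    (hx1 : ‖x‖ = 1) :
    tCurv (conformalMetric w) (fun y => ‖y‖ ^ 2) x * Real.exp (3 * w x)
      = 2 - 1 / 2 * euler (lap w) x + 1 / 2 * ∑ i, ∑ j, rot i j (fun y =>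
        rot i j (euler w) y - 3 * rot i j w y - 2 * (euler w y * rot i j w y)) x := by
  have hx0 : x ≠ 0 := fun h => h0 (h ▸ hx)
  have hE2 : Real.exp (-2 * w x) = Real.exp (-w x) ^ 2 := by
    rw [← Real.exp_nat_mul]; push_cast; ring_nf
  have hE3 : Real.exp (-w x) ^ 3 * Real.exp (3 * w x) = 1 := by
    rw [← Real.exp_nat_mul, ← Real.exp_add]; norm_num
  have hN : ∑ i, innerNormal (conformalMetric w) (fun y => ‖y‖ ^ 2) i x *
      pd i (scalarCurv (conformalMetric w)) x
      = -Real.exp (-w x) * euler (scalarCurv (conformalMetric w)) x := by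
    rw [euler, Finset.mul_sum]
    refine Finset.sum_congr rfl fun i _ => ?_
    rw [innerNormal_sphere w hx0, hx1]
    ring
  have hrd : rotDot w (meanCurv (conformalMetric w) fun y => ‖y‖ ^ 2) x
      = 3 * Real.exp (-w x) * (rotDot w (euler w) x - (1 + euler w x) * rotDot w w x) := by
    simp_rw [rotDot, rot_meanCurv hw hV h0 hx, hx1, neg_one_mul, mul_sub, Finset.mul_sum,
      ← Finset.sum_sub_distrib]
    exact Finset.sum_congr rfl fun i _ => Finset.sum_congr rfl fun j _ => by ring
  have hrl : rotLap (meanCurv (conformalMetric w) fun y => ‖y‖ ^ 2) x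
      = 3 * Real.exp (-w x) * (rotLap (euler w) x - 2 * rotDot w (euler w) x
        - (1 + euler w x) * rotLap w x + (1 + euler w x) * rotDot w w x) := by
    simp_rw [rotLap, rotDot, rot_rot_meanCurv hw hV h0 hx hx1, Finset.mul_sum,
      ← Finset.sum_sub_distrib, ← Finset.sum_add_distrib, Finset.mul_sum]
  have hdiv : ∑ i, ∑ j, rot i j (fun y =>
        rot i j (euler w) y - 3 * rot i j w y - 2 * (euler w y * rot i j w y)) x
      = rotLap (euler w) x - 3 * rotLap w x - 2 * (euler w x * rotLap w x)
        - 2 * rotDot w (euler w) x := by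
    simp_rw [rot_divergence_form hw hV hx, rotLap, rotDot, Finset.mul_sum,
      ← Finset.sum_sub_distrib]
  have hbl := boundaryLaplace_sphere hw (smoothOn_meanCurv hw hV h0) hV h0 hx hx1
  rw [hdiv, tCurv, hN, hbl, hrd, hrl, normalCurvContraction_sphere hw hV h0 hx hx1,
    trace_shapeOp_pow_three hw hV h0 hx, euler_scalarCurv_conformal hw hV hx,
    scalarCurv_conformal hw hV hx, meanCurv_sphere hw hV h0 hx, rotLap_eq hw hV hx, rotDot_eq,
    rotDot_eq, hx1, neg_one_mul, hE2]
  generalize Real.exp (-w x) = e at *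
  -- Each term of T has weight e^{-3w}; once this factor is cancelled, a polynomial identity is
  -- left.
  have key : ∀ A B : ℝ, A = e ^ 3 * B → A * Real.exp (3 * w x) = B := fun A B h => by
    rw [h]; linear_combination B * hE3
  apply key
  ring

end

/-! ### Integration over spheres -/

/-- The unit sphere of `ℝ⁴`. -/
abbrev Sph : Type := Metric.sphere (0 : E4) 1

/-- The surface measure of the unit sphere. -/
abbrev sigma : Measure Sph := (volume : Measure E4).toSphere

/-- The (unnormalized) spherical average `∫ f(rθ) dσ(θ)`. -/
def sphMean (f : E4 → ℝ) (r : ℝ) : ℝ := ∫ θ : Sph, f (r • (θ : E4)) ∂sigma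

theorem sigma_real_univ : sigma.real univ = 2 * Real.pi ^ 2 := by
  rw [Measure.toSphere_real_apply_univ, measureReal_def, EuclideanSpace.volume_ball]
  have h : Real.Gamma ((4 : ℝ) / 2 + 1) = 2 := by
    rw [show (4 : ℝ) / 2 + 1 = (2 : ℕ) + 1 by norm_num, Real.Gamma_nat_eq_factorial]
    norm_num
  have h2 : √Real.pi ^ 4 = Real.pi ^ 2 := by
    rw [show 4 = 2 * 2 by norm_num, pow_mul, Real.sq_sqrt Real.pi_pos.le]
  simp [h, h2, ENNReal.toReal_ofReal (by positivity : 0 ≤ Real.pi ^ 2 / 2)]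
  ring

/-- A linear isometry acting on the unit sphere. -/
def sphereEquiv (R : E4 ≃ₗᵢ[ℝ] E4) : Sph ≃ₜ Sph where
  toFun θ := ⟨R θ, by simp⟩
  invFun θ := ⟨R.symm θ, by simp⟩
  left_inv θ := by simp
  right_inv θ := by simp
  continuous_toFun := by fun_prop
  continuous_invFun := by fun_prop

-- The surface measure of a set is defined by the volume of the cone over it; a linear isometry maps
-- cones to cones and preserves volume.
open scoped Pointwise in
theorem measurePreserving_sphereEquiv (R : E4 ≃ₗᵢ[ℝ] E4) :
    MeasurePreserving (sphereEquiv R) sigma sigma := by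
  refine ⟨(sphereEquiv R).measurable, Measure.ext fun s hs => ?_⟩
  rw [Measure.map_apply (sphereEquiv R).measurable hs,
    Measure.toSphere_apply' _ ((sphereEquiv R).measurable hs), Measure.toSphere_apply' _ hs]
  congr 1
  rw [← R.measurePreserving.measure_preimage_emb R.toHomeomorph.measurableEmbedding
    (Ioo (0 : ℝ) 1 • (Subtype.val '' s))]
  congr 1
  ext x
  simp only [Set.mem_smul, mem_preimage, mem_image]
  constructor
  · rintro ⟨c, hc, _, ⟨θ, hθ, rfl⟩, rfl⟩
    exact ⟨c, hc, R θ, ⟨sphereEquiv R θ, hθ, rfl⟩, (map_smul R c _).symm⟩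
  · rintro ⟨c, hc, _, ⟨θ, hθ, rfl⟩, h⟩
    refine ⟨c, hc, R.symm θ, ⟨(sphereEquiv R).symm θ, by simpa using hθ, rfl⟩, ?_⟩
    apply R.injective
    simpa using h

theorem integral_sphere_comp (R : E4 ≃ₗᵢ[ℝ] E4) (g : E4 → ℝ) :
    ∫ θ : Sph, g (R θ) ∂sigma = ∫ θ : Sph, g θ ∂sigma :=
  (measurePreserving_sphereEquiv R).integral_comp (sphereEquiv R).measurableEmbedding
    fun θ : Sph => g θ

theorem lintegral_sphere_comp (R : E4 ≃ₗᵢ[ℝ] E4) (g : E4 → ENNReal) :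
    ∫⁻ θ : Sph, g (R θ) ∂sigma = ∫⁻ θ : Sph, g θ ∂sigma :=
  (measurePreserving_sphereEquiv R).lintegral_comp_emb (sphereEquiv R).measurableEmbedding
    fun θ : Sph => g θ

theorem finrank_E4 : Module.finrank ℝ E4 = 4 := by simp

theorem measurePreserving_polar :
    MeasurePreserving (homeomorphUnitSphereProd E4) ((volume : Measure E4).comap (↑))
      (sigma.prod (Measure.volumeIoiPow 3)) := by
  have h := (volume : Measure E4).measurePreserving_homeomorphUnitSphereProd
  rwa [finrank_E4] at h

theorem polar_apply (x : ({0}ᶜ : Set E4)) :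
    ((homeomorphUnitSphereProd E4 x).2 : ℝ) • ((homeomorphUnitSphereProd E4 x).1 : E4) = x :=
  congrArg Subtype.val ((homeomorphUnitSphereProd E4).symm_apply_apply x)

theorem volumeIoiPow_integral (n : ℕ) (g : ℝ → ℝ) :
    ∫ r : Ioi (0 : ℝ), g r ∂(Measure.volumeIoiPow n) = ∫ r in Ioi (0 : ℝ), r ^ n * g r := by
  simp only [Measure.volumeIoiPow, ENNReal.ofReal]
  rw [integral_withDensity_eq_integral_smul (by fun_prop),
    integral_subtype_comap measurableSet_Ioi fun a ↦ Real.toNNReal (a ^ n) • g a]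
  refine setIntegral_congr_fun measurableSet_Ioi fun x hx ↦ ?_
  simp only [NNReal.smul_def, Real.coe_toNNReal _ (pow_nonneg (le_of_lt hx) n), smul_eq_mul]

theorem volumeIoiPow_integrable (n : ℕ) (g : ℝ → ℝ) :
    Integrable (fun r : Ioi (0 : ℝ) => g r) (Measure.volumeIoiPow n) ↔
      IntegrableOn (fun r => r ^ n * g r) (Ioi 0) := by
  rw [integrableOn_iff_comap_subtypeVal measurableSet_Ioi, Measure.volumeIoiPow,
    integrable_withDensity_iff_integrable_smul' (by fun_prop) (by simp)]
  refine integrable_congr (.of_forall ?_)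
  rintro ⟨x, hx : 0 < x⟩
  simp (disch := positivity) [ENNReal.toReal_ofReal]

theorem integrable_polar_prod {f : E4 → ℝ} (hf : Integrable f) :
    Integrable (fun p : Sph × Ioi (0 : ℝ) => f ((p.2 : ℝ) • (p.1 : E4)))
      (sigma.prod (Measure.volumeIoiPow 3)) := by
  rw [← measurePreserving_polar.integrable_comp_emb (Homeomorph.measurableEmbedding _)]
  have : (fun p : Sph × Ioi (0 : ℝ) => f ((p.2 : ℝ) • (p.1 : E4))) ∘ homeomorphUnitSphereProd E4
      = f ∘ ((↑) : ({0}ᶜ : Set E4) → E4) := by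
    ext x
    simp only [Function.comp]
    rw [polar_apply]
  rw [this, ← integrableOn_iff_comap_subtypeVal (by measurability)]
  exact hf.integrableOn

theorem integral_polar {f : E4 → ℝ} (hf : Integrable f) :
    ∫ x, f x = ∫ r in Ioi (0 : ℝ), r ^ 3 * sphMean f r := by
  rw [← volumeIoiPow_integral]
  calc ∫ x, f x = ∫ x : ({(0)}ᶜ : Set E4), f x ∂((volume : Measure E4).comap (↑)) := by
        rw [integral_subtype_comap (measurableSet_singleton _).compl fun x ↦ f x,
          restrict_compl_singleton]
    _ = ∫ p : Sph × Ioi (0 : ℝ), f ((p.2 : ℝ) • (p.1 : E4))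
          ∂(sigma.prod (Measure.volumeIoiPow 3)) := by
        rw [← measurePreserving_polar.integral_comp (Homeomorph.measurableEmbedding _)]
        refine integral_congr_ae (.of_forall fun x => ?_)
        simp only [polar_apply]
    _ = _ := integral_prod_symm _ (integrable_polar_prod hf)

theorem integrableOn_polar {f : E4 → ℝ} (hf : Integrable f) :
    IntegrableOn (fun r => r ^ 3 * sphMean f r) (Ioi 0) := by
  rw [← volumeIoiPow_integrable]
  exact (integrable_polar_prod hf).integral_prod_right

section

variable {V : Set E4} {f g : E4 → ℝ} {r : ℝ}

/-- The sphere and a small closed parameter interval are compact, so continuity of the derivative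
already supplies a constant dominating function. -/
theorem hasDerivAt_integral_sphere {G G' : ℝ → Sph → ℝ} {s₀ : ℝ} {I : Set ℝ} (hI : I ∈ 𝓝 s₀)
    (hG : ∀ s ∈ I, ∀ θ, HasDerivAt (fun s => G s θ) (G' s θ) s)
    (hGc : ∀ s ∈ I, Continuous (G s))
    (hc : ContinuousOn (Function.uncurry G') (I ×ˢ univ)) :
    HasDerivAt (fun s => ∫ θ, G s θ ∂sigma) (∫ θ, G' s₀ θ ∂sigma) s₀ := by
  obtain ⟨ε, hε, hεI⟩ := Metric.nhds_basis_closedBall.mem_iff.1 hI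
  have hK : IsCompact (Metric.closedBall s₀ ε ×ˢ (univ : Set Sph)) :=
    (isCompact_closedBall _ _).prod isCompact_univ
  obtain ⟨C, hC⟩ := hK.exists_bound_of_continuousOn
    (hc.mono (prod_mono hεI Subset.rfl))
  have hs₀ : s₀ ∈ I := mem_of_mem_nhds hI
  have hG' : Continuous (G' s₀) := by
    rw [← continuousOn_univ]
    exact hc.comp (f := fun θ => (s₀, θ)) (by fun_prop) fun θ _ => ⟨hs₀, mem_univ θ⟩
  refine (hasDerivAt_integral_of_dominated_loc_of_deriv_le (bound := fun _ => C)
    (Metric.closedBall_mem_nhds s₀ hε) ?_ ?_ hG'.aestronglyMeasurable ?_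
    (integrable_const _) ?_).2
  · filter_upwards [hI] with s hs using (hGc s hs).aestronglyMeasurable
  · exact (hGc s₀ hs₀).integrable_of_hasCompactSupport (HasCompactSupport.of_compactSpace _)
  · exact .of_forall fun θ s hs => hC (s, θ) ⟨hs, mem_univ θ⟩
  · exact .of_forall fun θ s hs => hG s (hεI hs) θ

/-- The rotation by angle `s` in the `(i, j)` coordinate plane. -/
@[irreducible] def planeRot (i j : Fin 4) (hij : i ≠ j) (s : ℝ) : E4 ≃ₗᵢ[ℝ] E4 :=
  LinearIsometry.toLinearIsometryEquiv
    { toFun := fun x => x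
        + ((Real.cos s - 1) * x i - Real.sin s * x j) • EuclideanSpace.single i (1 : ℝ)
        + (Real.sin s * x i + (Real.cos s - 1) * x j) • EuclideanSpace.single j (1 : ℝ)
      map_add' := fun x y => by
        simp only [PiLp.add_apply]
        module
      map_smul' := fun c x => by
        simp only [PiLp.smul_apply, smul_eq_mul, RingHom.id_apply]
        module
      norm_map' := fun x => by
        rw [← sq_eq_sq₀ (norm_nonneg _) (norm_nonneg _)]
        simp only [LinearMap.coe_mk, AddHom.coe_mk]
        rw [norm_add_sq_real, norm_add_sq_real]
        simp [inner_add_left, inner_smul_left, inner_smul_right, norm_smul,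
          EuclideanSpace.inner_single_right, hij.symm]
        linear_combination (x i ^ 2 + x j ^ 2) * Real.sin_sq_add_cos_sq s } rfl

theorem planeRot_apply {i j : Fin 4} (hij : i ≠ j) (s : ℝ) (x : E4) :
    planeRot i j hij s x = x
        + ((Real.cos s - 1) * x i - Real.sin s * x j) • EuclideanSpace.single i (1 : ℝ)
        + (Real.sin s * x i + (Real.cos s - 1) * x j) • EuclideanSpace.single j (1 : ℝ) := by
  rw [planeRot]
  rfl

theorem planeRot_apply_left {i j : Fin 4} (hij : i ≠ j) (s : ℝ) (x : E4) :
    planeRot i j hij s x i = Real.cos s * x i - Real.sin s * x j := by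
  simp [planeRot_apply, hij]
  ring

theorem planeRot_apply_right {i j : Fin 4} (hij : i ≠ j) (s : ℝ) (x : E4) :
    planeRot i j hij s x j = Real.sin s * x i + Real.cos s * x j := by
  simp [planeRot_apply, hij.symm]
  ring

theorem hasDerivAt_planeRot {i j : Fin 4} (hij : i ≠ j) (s : ℝ) (x : E4) :
    HasDerivAt (fun s => planeRot i j hij s x)
      (-(planeRot i j hij s x j) • EuclideanSpace.single i (1 : ℝ)
        + (planeRot i j hij s x i) • EuclideanSpace.single j (1 : ℝ)) s := by
  rw [planeRot_apply_left, planeRot_apply_right]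
  simp only [planeRot_apply]
  have h1 : HasDerivAt (fun s => (Real.cos s - 1) * x i - Real.sin s * x j)
      (-Real.sin s * x i - Real.cos s * x j) s :=
    (((Real.hasDerivAt_cos s).sub_const 1).mul_const _).sub ((Real.hasDerivAt_sin s).mul_const _)
  have h2 : HasDerivAt (fun s => Real.sin s * x i + (Real.cos s - 1) * x j)
      (Real.cos s * x i + -Real.sin s * x j) s :=
    ((Real.hasDerivAt_sin s).mul_const _).add (((Real.hasDerivAt_cos s).sub_const 1).mul_const _)
  have h := ((hasDerivAt_const s x).add (h1.smul_const (EuclideanSpace.single i (1 : ℝ)))).add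
    (h2.smul_const (EuclideanSpace.single j (1 : ℝ)))
  refine h.congr_deriv ?_
  module

theorem hasDerivAt_comp_curve {f : E4 → ℝ} {c : ℝ → E4} {v : E4} {s : ℝ}
    (hf : DifferentiableAt ℝ f (c s)) (hc : HasDerivAt c v s) :
    HasDerivAt (fun s => f (c s)) (∑ i, v i * pd i f (c s)) s := by
  rw [← fderiv_eq_sum]
  exact hf.hasFDerivAt.comp_hasDerivAt s hc

/-- The average of f composed with a rotation of angle s does not depend on s, while its derivative
at s = 0 is the average of `rot i j f`. -/
theorem sphMean_rot (hf : SmoothOn V f) (hV : IsOpen V) (hr : ∀ θ : Sph, r • (θ : E4) ∈ V)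
    (i j : Fin 4) : sphMean (rot i j f) r = 0 := by
  by_cases hij : i = j
  · subst hij
    simp [sphMean, rot]
  have hmem : ∀ s (θ : Sph), r • (planeRot i j hij s θ) ∈ V := fun s θ => hr (sphereEquiv _ θ)
  have hcont : Continuous fun p : ℝ × Sph => r • (planeRot i j hij p.1 (p.2 : E4)) := by
    simp only [planeRot_apply]
    fun_prop
  have h := hasDerivAt_integral_sphere (s₀ := 0) (I := univ) univ_mem
    (G := fun s θ => f (r • (planeRot i j hij s θ)))
    (G' := fun s θ => rot i j f (r • (planeRot i j hij s θ))) ?_ ?_ ?_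
  · have h0 : ∀ s, ∫ θ : Sph, f (r • (planeRot i j hij s θ)) ∂sigma = sphMean f r := fun s =>
      integral_sphere_comp (planeRot i j hij s) fun x => f (r • x)
    simp_rw [h0] at h
    have h1 := integral_sphere_comp (planeRot i j hij 0) fun x => rot i j f (r • x)
    rw [h1] at h
    exact h.unique (hasDerivAt_const _ _)
  · intro s _ θ
    have hd : HasDerivAt (fun s => r • planeRot i j hij s θ)
        (r • (-(planeRot i j hij s θ j) • EuclideanSpace.single i (1 : ℝ)
        + (planeRot i j hij s θ i) • EuclideanSpace.single j (1 : ℝ))) s :=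
      (hasDerivAt_planeRot hij s (θ : E4)).const_smul r
    refine (hasDerivAt_comp_curve (hf.differentiableAt hV (hmem s θ)) hd).congr_deriv ?_
    generalize planeRot i j hij s θ = y
    simp [rot, add_mul, Finset.sum_add_distrib]
    ring
  · intro s _
    exact hf.continuousOn.comp_continuous 
      (((planeRot i j hij s).continuous.comp continuous_subtype_val).const_smul r)
      (hmem s)
  · exact (hf.rot hV i j).continuousOn.comp (s := univ ×ˢ univ)
      (f := fun p : ℝ × Sph => r • (planeRot i j hij p.1 (p.2 : E4)))
      hcont.continuousOn fun p _ => hmem p.1 p.2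

theorem eventually_smul_sphere_mem (hV : IsOpen V) (hr : ∀ θ : Sph, r • (θ : E4) ∈ V) :
    ∀ᶠ s in 𝓝 r, ∀ θ : Sph, s • (θ : E4) ∈ V := by
  have h := (isCompact_univ (X := Sph)).eventually_forall_of_forall_eventually (x₀ := r)
    (P := fun s θ => s • (θ : E4) ∈ V) fun θ _ => by
      have hc : Continuous fun p : ℝ × Sph => p.1 • (p.2 : E4) := by fun_prop
      exact hc.continuousAt.eventually (hV.mem_nhds (hr θ))
  simpa using h

theorem hasDerivAt_sphMean_aux (hf : SmoothOn V f) (hV : IsOpen V)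
    (hr : ∀ θ : Sph, r • (θ : E4) ∈ V) :
    HasDerivAt (sphMean f) (∫ θ : Sph, ∑ i, (θ : E4) i * pd i f (r • (θ : E4)) ∂sigma) r := by
  refine hasDerivAt_integral_sphere (I := {s | ∀ θ : Sph, s • (θ : E4) ∈ V})
    (G := fun s θ => f (s • (θ : E4)))
    (G' := fun s θ => ∑ i, (θ : E4) i * pd i f (s • (θ : E4)))
    (eventually_smul_sphere_mem hV hr) ?_ ?_ ?_
  · intro s hs θ
    refine hasDerivAt_comp_curve (hf.differentiableAt hV (hs θ)) ?_
    simpa using (hasDerivAt_id s).smul_const (θ : E4)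
  · intro s hs
    exact hf.continuousOn.comp_continuous (by fun_prop) hs
  · refine continuousOn_finsetSum _ fun i _ => ContinuousOn.mul (by fun_prop) ?_
    exact (hf.pd hV i).continuousOn.comp (f := fun p : ℝ × Sph => p.1 • (p.2 : E4))
      (by fun_prop) fun p hp => hp.1 p.2

theorem hasDerivAt_sphMean (hf : SmoothOn V f) (hV : IsOpen V)
    (hr : ∀ θ : Sph, r • (θ : E4) ∈ V) (hr0 : r ≠ 0) :
    HasDerivAt (sphMean f) (r⁻¹ * sphMean (euler f) r) r := by
  convert hasDerivAt_sphMean_aux hf hV hr using 1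
  rw [sphMean, ← integral_const_mul]
  congr 1
  ext θ
  simp only [euler, PiLp.smul_apply, smul_eq_mul, Finset.mul_sum]
  refine Finset.sum_congr rfl fun i _ => ?_
  field_simp

theorem continuousAt_sphMean (hf : SmoothOn V f) (hV : IsOpen V)
    (hr : ∀ θ : Sph, r • (θ : E4) ∈ V) : ContinuousAt (sphMean f) r :=
  (hasDerivAt_sphMean_aux hf hV hr).continuousAt

theorem integrable_sphere (hf : ContinuousOn f V) (hr : ∀ θ : Sph, r • (θ : E4) ∈ V) :
    Integrable (fun θ : Sph => f (r • (θ : E4))) sigma :=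
  (hf.comp_continuous (by fun_prop) hr).integrable_of_hasCompactSupport
    (HasCompactSupport.of_compactSpace _)

/-- Average the polar form of the Laplacian; its spherical part consists of rotational derivatives
and drops out. -/
theorem sphMean_lap (hf : SmoothOn V f) (hV : IsOpen V) (hr : ∀ θ : Sph, r • (θ : E4) ∈ V) :
    r ^ 2 * sphMean (lap f) r = sphMean (euler (euler f)) r + 2 * sphMean (euler f) r := by
  have hI : ∀ {g : E4 → ℝ}, SmoothOn V g → Integrable (fun θ : Sph => g (r • (θ : E4))) sigma :=
    fun hg => integrable_sphere hg.continuousOn hr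
  have h0 : sphMean (rotLap f) r = 0 := by
    rw [sphMean]
    simp_rw [rotLap]
    rw [integral_finsetSum _ fun i _ => integrable_finsetSum _ fun j _ =>
      hI ((hf.rot hV i j).rot hV i j)]
    refine Finset.sum_eq_zero fun i _ => ?_
    rw [integral_finsetSum _ fun j _ => hI ((hf.rot hV i j).rot hV i j)]
    exact Finset.sum_eq_zero fun j _ => sphMean_rot (hf.rot hV i j) hV hr i j
  have h1 : ∀ θ : Sph, r ^ 2 * lap f (r • (θ : E4)) = euler (euler f) (r • (θ : E4))
      + 2 * euler f (r • (θ : E4)) + 1 / 2 * rotLap f (r • (θ : E4)) := fun θ => by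
    rw [rotLap_eq hf hV (hr θ), norm_smul, norm_eq_of_mem_sphere θ, mul_one, Real.norm_eq_abs,
      sq_abs]
    ring
  have hrl : Integrable (fun θ : Sph => rotLap f (r • (θ : E4))) sigma :=
    hI (ContDiffOn.sum fun i _ => ContDiffOn.sum fun j _ => (hf.rot hV i j).rot hV i j)
  have he := hI (hf.euler hV)
  have hee := hI ((hf.euler hV).euler hV)
  rw [sphMean, ← integral_const_mul]
  simp_rw [h1]
  have hadd : Integrable (fun θ : Sph => euler (euler f) (r • (θ : E4))
      + 2 * euler f (r • (θ : E4))) sigma := hee.add (he.const_mul 2)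
  rw [integral_add hadd (hrl.const_mul _), integral_add hee (he.const_mul 2),
    integral_const_mul, integral_const_mul]
  change _ + _ + 1 / 2 * sphMean (rotLap f) r = _
  rw [h0]
  simp [sphMean]

/-- The divergence theorem in infinitesimal radial form: r² times the mean of the Euler derivative
is the flux through the sphere of radius r. Integrating in r replaces Stokes' theorem on balls and
annuli. -/
theorem hasDerivAt_flux (hf : SmoothOn V f) (hV : IsOpen V) (hr : ∀ θ : Sph, r • (θ : E4) ∈ V)
    (hr0 : r ≠ 0) :
    HasDerivAt (fun r => r ^ 2 * sphMean (euler f) r) (r ^ 3 * sphMean (lap f) r) r := by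
  refine ((hasDerivAt_pow 2 r).mul (hasDerivAt_sphMean (hf.euler hV) hV hr hr0)).congr_deriv ?_
  have h := sphMean_lap hf hV hr
  have hr1 : r * r⁻¹ = 1 := mul_inv_cancel₀ hr0
  simp only [Nat.cast_ofNat, Nat.add_one_sub_one, pow_one]
  linear_combination r * sphMean (euler (euler f)) r * hr1 - r * h

end

/-! ### The fundamental solution of the bilaplacian -/

section

variable {V : Set E4} {f g φ : E4 → ℝ} {r R : ℝ}

theorem lap_zero_of_eqOn (hV : IsOpen V) (h : ∀ x ∈ V, f x = 0) : ∀ x ∈ V, lap f x = 0 := by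
  intro x hx
  have h0 : ∀ i, pd i (fun _ : E4 => (0 : ℝ)) = fun _ => 0 := fun i => funext fun y => pd_const 0
  rw [EqOn.lap hV (g := fun _ => 0) h hx]
  simp [lap, h0]

theorem euler_zero_of_eqOn (hV : IsOpen V) (h : ∀ x ∈ V, f x = 0) : ∀ x ∈ V, euler f x = 0 := by
  intro x hx
  rw [EqOn.euler hV (g := fun _ => 0) h hx]
  simp [euler, pd_const]

theorem isOpen_norm_gt (R : ℝ) : IsOpen {x : E4 | R < ‖x‖} :=
  isOpen_lt continuous_const continuous_norm

theorem norm_smul_sphere (hr : 0 ≤ r) (θ : Sph) : ‖r • (θ : E4)‖ = r := by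
  rw [norm_smul, norm_eq_of_mem_sphere θ, mul_one, Real.norm_of_nonneg hr]

theorem sphMean_eq_zero (hR : ∀ x, R < ‖x‖ → f x = 0) (hr : 0 ≤ r) (hRr : R < r) :
    sphMean f r = 0 := by
  have : ∀ θ : Sph, f (r • (θ : E4)) = 0 := fun θ => hR _ (by rwa [norm_smul_sphere hr])
  simp [sphMean, this]

theorem sphMean_zero (f : E4 → ℝ) : sphMean f 0 = 2 * Real.pi ^ 2 * f 0 := by
  simp only [sphMean, zero_smul, integral_const, sigma_real_univ, smul_eq_mul]

theorem hasCompactSupport_of_eq_zero (hR : ∀ x, R < ‖x‖ → f x = 0) : HasCompactSupport f :=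
  HasCompactSupport.of_support_subset_isCompact (isCompact_closedBall (0 : E4) R) fun x hx => by
    rw [mem_closedBall_zero_iff]
    by_contra h
    exact hx (hR x (not_le.1 h))

theorem locallyIntegrable_log_norm : LocallyIntegrable fun y : E4 => Real.log ‖y‖ := by
  have hball : ∀ R : ℝ, IntegrableOn (fun y : E4 => Real.log ‖y‖) (Metric.ball 0 R) := by
    intro R
    rw [integrableOn_fun_norm_addHaar (volume : Measure E4) (f := Real.log), finrank_E4]
    have hc : Continuous fun y : ℝ => y ^ 2 * (y * Real.log y) :=
      (continuous_pow 2).mul Real.continuous_mul_log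
    refine ((hc.continuousOn.integrableOn_Icc (a := 0) (b := R)).mono_set
      Ioo_subset_Icc_self).congr_fun (fun y _ => ?_) measurableSet_Ioo
    simp only [smul_eq_mul]
    ring
  rw [locallyIntegrable_iff]
  intro K hK
  obtain ⟨R, hR⟩ := hK.isBounded.subset_ball 0
  exact (hball R).mono_set hR

theorem integrable_log_norm_mul (hf : Continuous f) (hc : HasCompactSupport f) (x : E4) :
    Integrable fun y => Real.log ‖y - x‖ * f y := by
  have h := locallyIntegrable_log_norm.integrable_smul_right_of_hasCompactSupport
    (g := fun y => f (y + x)) (hf.comp (by fun_prop))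
    (hc.comp_homeomorph (Homeomorph.addRight x))
  have h2 := h.comp_sub_right x
  simpa [mul_comm] using h2

/-- In polar coordinates the integrand is an exact radial derivative, so the integral is read off
from the behaviour of a primitive at 0 and at infinity. -/
theorem integral_log_norm_mul_lap_lap_zero (hφ : SmoothOn univ φ)
    (hR : ∀ x, R < ‖x‖ → φ x = 0) :
    ∫ y, Real.log ‖y‖ * lap (lap φ) y = -(8 * Real.pi ^ 2 * φ 0) := by
  have hV := isOpen_univ (X := E4)
  have hm : ∀ {r : ℝ} (θ : Sph), r • (θ : E4) ∈ univ := fun θ => mem_univ _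
  have hl := hφ.lap hV
  have hll := hl.lap hV
  have hRl : ∀ x, R < ‖x‖ → lap φ x = 0 := lap_zero_of_eqOn (isOpen_norm_gt R) hR
  have hRll : ∀ x, R < ‖x‖ → lap (lap φ) x = 0 := lap_zero_of_eqOn (isOpen_norm_gt R) hRl
  have hRe : ∀ x, R < ‖x‖ → euler φ x = 0 := euler_zero_of_eqOn (isOpen_norm_gt R) hR
  have hRle : ∀ x, R < ‖x‖ → euler (lap φ) x = 0 := euler_zero_of_eqOn (isOpen_norm_gt R) hRl
  have hint : Integrable fun y => Real.log ‖y‖ * lap (lap φ) y := by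
    simpa using integrable_log_norm_mul (continuousOn_univ.1 hll.continuousOn)
      (hasCompactSupport_of_eq_zero hRll) 0
  have hsm : ∀ r ∈ Ioi (0 : ℝ), r ^ 3 * sphMean (fun y => Real.log ‖y‖ * lap (lap φ) y) r
      = r ^ 3 * (Real.log r * sphMean (lap (lap φ)) r) := by
    intro r hr
    simp_rw [sphMean, norm_smul_sphere (le_of_lt hr), integral_const_mul]
  have hcont : ∀ {f : E4 → ℝ}, SmoothOn univ f → Continuous (sphMean f) := fun hf =>
    continuous_iff_continuousAt.2 fun r => continuousAt_sphMean hf hV hm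
  -- The primitive obtained by repeated radial integration by parts. Grouping r · (r log r) makes
  -- continuity at 0 visible; there every term vanishes except 4 · 2π² φ(0), the source of the
  -- constant 8π².
  let H : ℝ → ℝ := fun r => r * (r * Real.log r) * sphMean (euler (lap φ)) r
    - r ^ 2 * sphMean (lap φ) r + 2 * sphMean (euler φ) r + 4 * sphMean φ r
  have hHc : Continuous H := by
    have h1 := hcont (hl.euler hV)
    have h2 := hcont hl
    have h3 := hcont (hφ.euler hV)
    have h4 := hcont hφ
    have h5 := Real.continuous_mul_log
    fun_prop
  have hHd : ∀ r ∈ Ioi (0 : ℝ),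
      HasDerivAt H (r ^ 3 * (Real.log r * sphMean (lap (lap φ)) r)) r := by
    intro r hr
    have hr0 : r ≠ 0 := ne_of_gt hr
    have h1 := (Real.hasDerivAt_log hr0).mul (hasDerivAt_flux hl hV hm hr0)
    have h2 := (hasDerivAt_pow 2 r).mul (hasDerivAt_sphMean hl hV hm hr0)
    have h3 := (hasDerivAt_sphMean (hφ.euler hV) hV hm hr0).const_mul 2
    have h4 := (hasDerivAt_sphMean hφ hV hm hr0).const_mul 4
    have h := ((h1.sub h2).add h3).add h4
    have he : H = (Real.log * fun r => r ^ 2 * sphMean (euler (lap φ)) r)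
        - (fun r => r ^ 2) * sphMean (lap φ) + (fun r => 2 * sphMean (euler φ) r)
        + fun r => 4 * sphMean φ r := by
      ext r
      simp only [H, Pi.add_apply, Pi.sub_apply, Pi.mul_apply]
      ring
    rw [he]
    refine h.congr_deriv ?_
    have hs := sphMean_lap hφ hV (r := r) hm
    have hr1 : r * r⁻¹ = 1 := mul_inv_cancel₀ hr0
    simp only [Nat.cast_ofNat, Nat.add_one_sub_one, pow_one]
    linear_combination -2 * r⁻¹ * hs + 2 * r * sphMean (lap φ) r * hr1
  have hH0 : Tendsto H atTop (𝓝 0) := by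
    refine tendsto_const_nhds.congr' ?_
    filter_upwards [eventually_gt_atTop R, eventually_ge_atTop 0] with r hr hr0
    simp only [H, sphMean_eq_zero hRle hr0 hr, sphMean_eq_zero hRl hr0 hr,
      sphMean_eq_zero hRe hr0 hr, sphMean_eq_zero hR hr0 hr]
    ring
  have hfin := integral_Ioi_of_hasDerivAt_of_tendsto hHc.continuousWithinAt hHd
    ((integrableOn_polar hint).congr_fun hsm measurableSet_Ioi) hH0
  rw [integral_polar hint, setIntegral_congr_fun measurableSet_Ioi hsm, hfin]
  have he0 : euler φ 0 = 0 := by simp [euler]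
  simp only [H, sphMean_zero, he0]
  ring

theorem pd_comp_add_right (f : E4 → ℝ) (i : Fin 4) (a : E4) :
    pd i (fun y => f (y + a)) = fun y => pd i f (y + a) := by
  ext y
  simp [pd, fderiv_comp_add_right]

theorem lap_comp_add_right (f : E4 → ℝ) (a : E4) :
    lap (fun y => f (y + a)) = fun y => lap f (y + a) := by
  ext y
  simp [lap, pd_comp_add_right]

/-- Representation of a test function by the fundamental solution `-log |x| / (8π²)` of the
bilaplacian. -/
theorem integral_log_norm_mul_lap_lap (hφ : SmoothOn univ φ) (hR : ∀ x, R < ‖x‖ → φ x = 0)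
    (x : E4) :
    ∫ y, Real.log ‖y - x‖ * lap (lap φ) y = -(8 * Real.pi ^ 2 * φ x) := by
  have hs : SmoothOn univ fun y => φ (y + x) :=
    hφ.comp (contDiff_id.add contDiff_const).contDiffOn fun y _ => mem_univ _
  have h := integral_log_norm_mul_lap_lap_zero (R := R + ‖x‖) hs fun y hy => hR _ (by
    have := norm_sub_le (y + x) x
    rw [add_sub_cancel_right] at this
    linarith)
  rw [lap_comp_add_right, lap_comp_add_right, zero_add] at h
  rw [← h, ← integral_add_right_eq_self (μ := (volume : Measure E4))
    (fun y => Real.log ‖y - x‖ * lap (lap φ) y) x]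
  simp

theorem integral_pd_mul (hf : SmoothOn univ f) (hg : SmoothOn univ g)
    (hfg : HasCompactSupport g) (i : Fin 4) :
    ∫ y, pd i f y * g y = -∫ y, f y * pd i g y := by
  have hV := isOpen_univ (X := E4)
  have hgc : HasCompactSupport (pd i g) := hfg.fderiv_apply (𝕜 := ℝ) _
  have c1 := continuousOn_univ.1 hf.continuousOn
  have c2 := continuousOn_univ.1 hg.continuousOn
  have c3 := continuousOn_univ.1 (hf.pd hV i).continuousOn
  have c4 := continuousOn_univ.1 (hg.pd hV i).continuousOn
  have h := integral_mul_fderiv_eq_neg_fderiv_mul_of_integrable (μ := (volume : Measure E4))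
    (v := EuclideanSpace.single i (1 : ℝ)) (f := f) (g := g)
    ((c3.mul c2).integrable_of_hasCompactSupport hfg.mul_left)
    ((c1.mul c4).integrable_of_hasCompactSupport hgc.mul_left)
    ((c1.mul c2).integrable_of_hasCompactSupport hfg.mul_left)
    (fun y _ => hf.differentiableAt hV (mem_univ y))
    (fun y _ => hg.differentiableAt hV (mem_univ y))
  simp only [pd]
  linarith

theorem integral_lap_mul (hf : SmoothOn univ f) (hg : SmoothOn univ g)
    (hgc : HasCompactSupport g) : ∫ y, lap f y * g y = ∫ y, f y * lap g y := by
  have hV := isOpen_univ (X := E4)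
  have hpc : ∀ i, HasCompactSupport (pd i g) := fun i => hgc.fderiv_apply (𝕜 := ℝ) _
  have hppc : ∀ i, HasCompactSupport (pd i (pd i g)) := fun i => (hpc i).fderiv_apply (𝕜 := ℝ) _
  have c : ∀ {f : E4 → ℝ}, SmoothOn univ f → Continuous f := fun h =>
    continuousOn_univ.1 h.continuousOn
  simp_rw [lap, Finset.sum_mul, Finset.mul_sum]
  have h1 : ∀ i, Integrable fun y => pd i (pd i f) y * g y := fun i =>
    ((c ((hf.pd hV i).pd hV i)).mul (c hg)).integrable_of_hasCompactSupport hgc.mul_left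
  have h2 : ∀ i, Integrable fun y => f y * pd i (pd i g) y := fun i =>
    ((c hf).mul (c ((hg.pd hV i).pd hV i))).integrable_of_hasCompactSupport (hppc i).mul_left
  rw [integral_finsetSum _ fun i _ => h1 i, integral_finsetSum _ fun i _ => h2 i]
  refine Finset.sum_congr rfl fun i _ => ?_
  rw [integral_pd_mul (hf.pd hV i) hg hgc, integral_pd_mul hf (hg.pd hV i) (hpc i), neg_neg]

theorem integral_lap_lap_mul (hf : SmoothOn univ f) (hg : SmoothOn univ g)
    (hgc : HasCompactSupport g) : ∫ y, lap (lap f) y * g y = ∫ y, f y * lap (lap g) y := by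
  have hV := isOpen_univ (X := E4)
  obtain ⟨R, hR⟩ := hgc.isBounded.subset_closedBall 0
  have hg0 : ∀ x, R < ‖x‖ → g x = 0 := fun x hx => by
    by_contra h
    have := hR (subset_tsupport g h)
    rw [mem_closedBall_zero_iff] at this
    linarith
  rw [integral_lap_mul (hf.lap hV) hg hgc, integral_lap_mul hf (hg.lap hV)
    (hasCompactSupport_of_eq_zero (lap_zero_of_eqOn (isOpen_norm_gt R) hg0))]

end

/-! ### A lower bound from the minimum principle -/

section

variable {V : Set E4} {f w : E4 → ℝ} {x : E4}

/-- With a negative second derivative the minimum would also be a local maximum along the coordinate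
line, so the function would be constant there and its second derivative zero. -/
theorem pd_pd_nonneg_of_isLocalMin (hf : SmoothOn V f) (hV : IsOpen V) (hx : x ∈ V)
    (hmin : IsLocalMin f x) (i : Fin 4) : 0 ≤ pd i (pd i f) x := by
  by_contra! hneg
  set e : E4 := EuclideanSpace.single i (1 : ℝ)
  let c : ℝ → E4 := fun t => x + t • e
  have hc0 : c 0 = x := by simp [c]
  have hcd : ∀ t, HasDerivAt c e t := fun t =>
    (((hasDerivAt_id t).smul_const e).const_add x).congr_deriv (one_smul ℝ e)
  have hcc : ContinuousAt c 0 := (hcd 0).continuousAt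
  have hev : ∀ᶠ t in 𝓝 (0 : ℝ), c t ∈ V := hcc.eventually (hV.mem_nhds (hc0.symm ▸ hx))
  have hd : ∀ {g : E4 → ℝ} (t : ℝ), SmoothOn V g → c t ∈ V →
      HasDerivAt (fun t => g (c t)) (pd i g (c t)) t := fun t hg ht =>
    (hg.differentiableAt hV ht).hasFDerivAt.comp_hasDerivAt t (hcd t)
  have hd1 : deriv (fun t => f (c t)) =ᶠ[𝓝 0] fun t => pd i f (c t) := by
    filter_upwards [hev] with t ht using (hd t hf ht).deriv
  have hd2 : deriv (deriv fun t => f (c t)) 0 = pd i (pd i f) x := by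
    rw [hd1.deriv_eq, (hd 0 (hf.pd hV i) (hc0.symm ▸ hx)).deriv, hc0]
  have hmin' : IsLocalMin (fun t => f (c t)) 0 := by
    have : ∀ᶠ y in 𝓝 (c 0), f x ≤ f y := hc0.symm ▸ hmin
    filter_upwards [hcc.eventually this] with t ht
    rwa [hc0]
  have hmax : IsLocalMax (fun t => f (c t)) 0 :=
    isLocalMax_of_deriv_deriv_neg (hd2 ▸ hneg) hmin'.deriv_eq_zero
      ((hd 0 hf (hc0.symm ▸ hx)).continuousAt)
  have hconst : (fun t => f (c t)) =ᶠ[𝓝 0] fun _ => f (c 0) := by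
    filter_upwards [hmin', hmax] with t h1 h2 using le_antisymm h2 h1
  have h0 : deriv (deriv fun t => f (c t)) 0 = 0 := by
    rw [hconst.deriv.deriv_eq]
    simp
  linarith

/-- |x|⁻² is rotation invariant and homogeneous of degree -2, and d = -2 solves d² + 2d = 0, the
radial equation of harmonicity on ℝ⁴. -/
theorem lap_norm_inv_sq (hx : x ≠ 0) : lap (fun y : E4 => ‖y‖⁻¹ * ‖y‖⁻¹) x = 0 := by
  set V : Set E4 := {0}ᶜ
  have hV : IsOpen V := isOpen_compl_singleton
  have h0 : (0 : E4) ∉ V := by simp [V]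
  have hs : SmoothOn V fun y => ‖y‖⁻¹ * ‖y‖⁻¹ := (smoothOn_norm_inv h0).mul (smoothOn_norm_inv h0)
  have hn : ‖x‖ ≠ 0 := norm_ne_zero_iff.2 hx
  have hd : ∀ y ∈ V, DifferentiableAt ℝ (fun y : E4 => ‖y‖⁻¹) y := fun y hy =>
    (smoothOn_norm_inv h0).differentiableAt hV hy
  have hr : ∀ i j, EqOn (rot i j fun y : E4 => ‖y‖⁻¹ * ‖y‖⁻¹) (fun _ => 0) V := fun i j y hy => by
    rw [rot_mul (hd y hy) (hd y hy), rot_norm_inv hy]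
    ring
  have hrl : rotLap (fun y : E4 => ‖y‖⁻¹ * ‖y‖⁻¹) x = 0 := by
    refine Finset.sum_eq_zero fun i _ => Finset.sum_eq_zero fun j _ => ?_
    rw [EqOn.rot hV (hr i j) i j hx]
    simp [rot, pd_const]
  have he : EqOn (euler fun y : E4 => ‖y‖⁻¹ * ‖y‖⁻¹) (fun y => -2 * (‖y‖⁻¹ * ‖y‖⁻¹)) V := by
    intro y hy
    have h1 : ∀ i, y i * pd i (fun y : E4 => ‖y‖⁻¹ * ‖y‖⁻¹) y
        = -2 * (‖y‖⁻¹ * ‖y‖⁻¹) * (‖y‖⁻¹ ^ 2 * (y i * y i)) := fun i => by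
      rw [pd_mul (hd y hy) (hd y hy), pd_norm_inv hy]
      ring
    simp_rw [euler, h1, ← Finset.mul_sum, norm_inv_sq_mul hy, mul_one]
  have hee : euler (euler fun y : E4 => ‖y‖⁻¹ * ‖y‖⁻¹) x = 4 * (‖x‖⁻¹ * ‖x‖⁻¹) := by
    rw [EqOn.euler hV he hx]
    have : ∀ i, x i * pd i (fun y : E4 => -2 * (‖y‖⁻¹ * ‖y‖⁻¹)) x
        = -2 * (x i * pd i (fun y : E4 => ‖y‖⁻¹ * ‖y‖⁻¹) x) := fun i => by
      rw [pd_const_mul (hs.differentiableAt hV hx)]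
      ring
    simp_rw [euler, this, ← Finset.mul_sum]
    change -2 * euler (fun y : E4 => ‖y‖⁻¹ * ‖y‖⁻¹) x = _
    rw [he hx]
    ring
  rw [rotLap_eq hs hV hx, hee, he hx] at hrl
  have : ‖x‖ ^ 2 * lap (fun y : E4 => ‖y‖⁻¹ * ‖y‖⁻¹) x = 0 := by linarith
  simpa [hn] using this

theorem lap_normSq (x : E4) : lap (fun y : E4 => ‖y‖ ^ 2) x = 8 := by
  have h : ∀ i, pd i (fun y : E4 => ‖y‖ ^ 2) = fun y => 2 * y i := fun i => funext fun y => pd_normSq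
  have h2 : ∀ i, pd i (fun y : E4 => 2 * y i) x = 2 := fun i => by
    rw [pd_const_mul (by fun_prop), pd_coord]
    simp
  simp_rw [lap, h, h2]
  norm_num

theorem smoothOn_normSq : SmoothOn V fun y : E4 => ‖y‖ ^ 2 :=
  (contDiff_norm_sq ℝ).contDiffOn

/-- A positive superharmonic function on a punctured ball is bounded below by its minimum over
the boundary sphere. -/
theorem superharmonic_lower_bound {r m : ℝ} (hf : SmoothOn V f) (hV : IsOpen V)
    (hrV : ∀ x : E4, 0 < ‖x‖ → ‖x‖ ≤ r → x ∈ V) (hpos : ∀ x ∈ V, 0 < f x)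
    (hsup : ∀ x : E4, 0 < ‖x‖ → ‖x‖ < r → lap f x ≤ 0) (hm : ∀ x : E4, ‖x‖ = r → m ≤ f x)
    (hx0 : 0 < ‖x‖) (hxr : ‖x‖ ≤ r) : m ≤ f x := by
  have hr : 0 < r := hx0.trans_le hxr
  -- Barrier argument on s ≤ |y| ≤ r. The harmonic term ε|y|⁻² lifts the function above m on the
  -- inner sphere, where only f > 0 is known; the term -ε|y|² makes the Laplacian at most -8ε, which
  -- excludes an interior minimum. The r² pays for that correction.
  have key : ∀ ε > 0, m ≤ f x + ε * (‖x‖⁻¹ * ‖x‖⁻¹ + r ^ 2) := by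
    intro ε hε
    obtain ⟨s, hs0, hsx, hsm⟩ : ∃ s, 0 < s ∧ s < ‖x‖ ∧ m ≤ ε * (s⁻¹ * s⁻¹) := by
      have ht : Tendsto (fun s : ℝ => ε * (s⁻¹ * s⁻¹)) (𝓝[>] 0) atTop :=
        (tendsto_inv_nhdsGT_zero.atTop_mul_atTop₀ tendsto_inv_nhdsGT_zero).const_mul_atTop hε
      have h := (ht.eventually_ge_atTop m).and (Ioo_mem_nhdsGT hx0)
      obtain ⟨s, h1, h2⟩ := h.exists
      exact ⟨s, h2.1, h2.2, h1⟩
    set V' : Set E4 := V ∩ {0}ᶜ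
    have hV' : IsOpen V' := hV.inter isOpen_compl_singleton
    have h0 : (0 : E4) ∉ V' := by simp [V']
    have hi : SmoothOn V' fun y => ‖y‖⁻¹ * ‖y‖⁻¹ :=
      (smoothOn_norm_inv h0).mul (smoothOn_norm_inv h0)
    have hf' : SmoothOn V' f := hf.mono inter_subset_left
    have hadd1 : SmoothOn V' fun y : E4 => ε * (‖y‖⁻¹ * ‖y‖⁻¹) := contDiffOn_const.mul hi
    have hadd2 : SmoothOn V' fun y : E4 => -ε * ‖y‖ ^ 2 := contDiffOn_const.mul smoothOn_normSq
    have hadd : SmoothOn V' fun y : E4 => ε * (‖y‖⁻¹ * ‖y‖⁻¹) + -ε * ‖y‖ ^ 2 := hadd1.add hadd2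
    set F : E4 → ℝ := fun y => f y + (ε * (‖y‖⁻¹ * ‖y‖⁻¹) + -ε * ‖y‖ ^ 2)
    have hF : SmoothOn V' F := hf'.add hadd
    set A : Set E4 := Metric.closedBall 0 r ∩ {y | s ≤ ‖y‖}
    have hA : IsCompact A :=
      (isCompact_closedBall _ _).inter_right (isClosed_le continuous_const continuous_norm)
    have hAV : A ⊆ V' := fun y hy => by
      have h1 : s ≤ ‖y‖ := hy.2
      have h2 : 0 < ‖y‖ := hs0.trans_le h1
      exact ⟨hrV y h2 (mem_closedBall_zero_iff.1 hy.1), norm_pos_iff.1 h2⟩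
    have hxA : x ∈ A := ⟨mem_closedBall_zero_iff.2 hxr, hsx.le⟩
    obtain ⟨z, hzA, hz⟩ := hA.exists_isMinOn ⟨x, hxA⟩ (hF.continuousOn.mono hAV)
    have hzs : s ≤ ‖z‖ := hzA.2
    have hzr : ‖z‖ ≤ r := mem_closedBall_zero_iff.1 hzA.1
    have hz0 : 0 < ‖z‖ := hs0.trans_le hzs
    have hFz : m - ε * r ^ 2 ≤ F z := by
      have hzi : 0 ≤ ε * (‖z‖⁻¹ * ‖z‖⁻¹) := by positivity
      have hzq : ε * ‖z‖ ^ 2 ≤ ε * r ^ 2 := by gcongr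
      have hfz := hpos z (hAV hzA).1
      rcases hzr.eq_or_lt with h | hlt
      · have := hm z h
        simp only [F]
        linarith
      rcases hzs.eq_or_lt with h | hgt
      · rw [h] at hsm
        simp only [F]
        linarith
      exfalso
      have hloc : IsLocalMin F z := by
        refine hz.isLocalMin ?_
        filter_upwards [Metric.isOpen_ball.mem_nhds (mem_ball_zero_iff.2 hlt),
          (isOpen_norm_gt s).mem_nhds hgt] with y h1 h2
        exact ⟨Metric.ball_subset_closedBall h1, le_of_lt h2⟩
      have hl : 0 ≤ lap F z :=
        Finset.sum_nonneg fun i _ => pd_pd_nonneg_of_isLocalMin hF hV' (hAV hzA) hloc i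
      have hzV := hAV hzA
      rw [lap_add hf' hadd hV' hzV, lap_add hadd1 hadd2 hV' hzV, lap_const_mul hi hV' hzV,
        lap_const_mul smoothOn_normSq hV' hzV, lap_norm_inv_sq (norm_pos_iff.1 hz0),
        lap_normSq] at hl
      have := hsup z hz0 hlt
      linarith
    have hFx : F z ≤ F x := hz hxA
    have hxq : 0 ≤ ε * ‖x‖ ^ 2 := by positivity
    simp only [F] at hFx hFz
    linarith
  set c := ‖x‖⁻¹ * ‖x‖⁻¹ + r ^ 2
  have hc : 0 < c := by positivity
  refine le_of_forall_pos_le_add fun δ hδ => ?_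
  have := key (δ / c) (by positivity)
  rwa [div_mul_cancel₀ _ hc.ne'] at this

/-- Since Δe^w = e^w(Δw + |∇w|²), the sign condition says exactly that e^w is superharmonic. The
radius is halved so that the comparison sphere lies inside the region where w is smooth. -/
theorem exists_lower_bound {r₁ : ℝ} (hr₁ : 0 < r₁) (hw : SmoothOn V w) (hV : IsOpen V)
    (hrV : ∀ x : E4, 0 < ‖x‖ → ‖x‖ < r₁ → x ∈ V)
    (hS : ∀ x : E4, 0 < ‖x‖ → ‖x‖ < r₁ → lap w x + gradDot w w x ≤ 0) :
    ∃ c : ℝ, ∀ x : E4, 0 < ‖x‖ → ‖x‖ ≤ r₁ / 2 → c ≤ w x := by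
  have hr2 : 0 < r₁ / 2 := by positivity
  have hsub : Metric.sphere (0 : E4) (r₁ / 2) ⊆ V := fun x hx => by
    have hx' : ‖x‖ = r₁ / 2 := mem_sphere_zero_iff_norm.1 hx
    exact hrV x (by linarith) (by linarith)
  obtain ⟨z, hz, hzmin⟩ := (isCompact_sphere (0 : E4) (r₁ / 2)).exists_isMinOn
    (NormedSpace.sphere_nonempty.2 hr2.le) (hw.continuousOn.mono hsub)
  have hf : SmoothOn V fun y => Real.exp (w y) := hw.exp
  refine ⟨w z, fun x hx0 hxr => ?_⟩
  rw [← Real.exp_le_exp]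
  refine superharmonic_lower_bound (f := fun y => Real.exp (w y)) (r := r₁ / 2) hf hV
    (fun y h1 h2 => hrV y h1 (by linarith)) (fun y _ => Real.exp_pos _) (fun y h1 h2 => ?_)
    (fun y hy => Real.exp_le_exp.2 (hzmin (mem_sphere_zero_iff_norm.2 hy))) hx0 hxr
  rw [lap_exp hw hV (hrV y h1 (by linarith))]
  exact mul_nonpos_of_nonneg_of_nonpos (Real.exp_pos _).le (hS y h1 (by linarith))

end

/-! ### Cutoff functions -/

section

variable {V : Set E4} {f g W κ : E4 → ℝ} {x y : E4} {ε : ℝ}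

theorem norm_iteratedFDeriv_pd_le (hf : SmoothOn univ f) (n : ℕ) (i : Fin 4) (y : E4) :
    ‖iteratedFDeriv ℝ n (pd i f) y‖ ≤ ‖iteratedFDeriv ℝ (n + 1) f y‖ := by
  have hc : ContDiff ℝ n (fderiv ℝ f) :=
    (contDiffOn_univ.1 hf).fderiv_right (by exact_mod_cast le_top)
  have h := norm_iteratedFDeriv_clm_apply_const (c := EuclideanSpace.single i (1 : ℝ))
    (x := y) (n := n) hc.contDiffAt le_rfl
  rw [norm_iteratedFDeriv_fderiv, PiLp.norm_single, norm_one, one_mul] at h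
  exact h

theorem abs_lap_lap_le (hf : SmoothOn univ f) (y : E4) :
    |lap (lap f) y| ≤ 16 * ‖iteratedFDeriv ℝ 4 f y‖ := by
  have hV := isOpen_univ (X := E4)
  have h : ∀ k, EqOn (pd k (lap f)) (lap (pd k f)) univ := fun k y hy => pd_lap hf hV hy k
  have hk : ∀ k, pd k (pd k (lap f)) y = lap (pd k (pd k f)) y := fun k => by
    rw [EqOn.pd hV (h k) k (mem_univ y), pd_lap (hf.pd hV k) hV (mem_univ y)]
  have hb : ∀ k i, |pd i (pd i (pd k (pd k f))) y| ≤ ‖iteratedFDeriv ℝ 4 f y‖ := by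
    intro k i
    have h1 := hf.pd hV k
    have h2 := h1.pd hV k
    have h3 := h2.pd hV i
    rw [← Real.norm_eq_abs, ← norm_iteratedFDeriv_zero (𝕜 := ℝ)]
    exact (norm_iteratedFDeriv_pd_le h3 0 i y).trans ((norm_iteratedFDeriv_pd_le h2 1 i y).trans
      ((norm_iteratedFDeriv_pd_le h1 2 k y).trans (norm_iteratedFDeriv_pd_le hf 3 k y)))
  rw [lap]
  simp_rw [hk, lap]
  calc _ ≤ ∑ k : Fin 4, ∑ i : Fin 4, ‖iteratedFDeriv ℝ 4 f y‖ :=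
        (Finset.abs_sum_le_sum_abs _ _).trans (Finset.sum_le_sum fun k _ =>
          (Finset.abs_sum_le_sum_abs _ _).trans (Finset.sum_le_sum fun i _ => hb k i))
    _ = _ := by simp; ring

/-- A fixed smooth bump, equal to one on the unit ball and supported in the ball of radius two. -/
def bump : ContDiffBump (0 : E4) := ⟨1, 2, one_pos, one_lt_two⟩

/-- A smooth cutoff, equal to one for `‖y‖ ≤ ε` and vanishing for `2 ε ≤ ‖y‖`. -/
def cut (ε : ℝ) (y : E4) : ℝ := bump (ε⁻¹ • y)

theorem smoothOn_cut (ε : ℝ) : SmoothOn V (cut ε) :=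
  (bump.contDiff.comp (contDiff_const_smul ε⁻¹)).contDiffOn

theorem norm_inv_smul (hε : 0 < ε) (y : E4) : ‖ε⁻¹ • y‖ = ‖y‖ / ε := by
  rw [norm_smul, norm_inv, Real.norm_of_nonneg hε.le, inv_mul_eq_div]

theorem cut_eq_one (hε : 0 < ε) (hy : ‖y‖ ≤ ε) : cut ε y = 1 :=
  bump.one_of_mem_closedBall (by
    rw [mem_closedBall_zero_iff, norm_inv_smul hε]
    exact (div_le_one hε).2 hy)

theorem cut_eq_zero (hε : 0 < ε) (hy : 2 * ε ≤ ‖y‖) : cut ε y = 0 :=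
  bump.zero_of_le_dist (by
    rw [dist_zero_right, norm_inv_smul hε]
    exact (le_div_iff₀ hε).2 hy)

theorem cut_nonneg (ε : ℝ) (y : E4) : 0 ≤ cut ε y := bump.nonneg

theorem cut_le_one (ε : ℝ) (y : E4) : cut ε y ≤ 1 := bump.le_one

theorem exists_norm_iteratedFDeriv_bound (hf : SmoothOn univ f) (hc : HasCompactSupport f)
    (n : ℕ) : ∃ C, ∀ y, ‖iteratedFDeriv ℝ n f y‖ ≤ C := by
  have hcont : Continuous (iteratedFDeriv ℝ n f) :=
    (contDiffOn_univ.1 hf).continuous_iteratedFDeriv (by exact_mod_cast le_top)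
  exact hcont.bounded_above_of_compact_support (hc.iteratedFDeriv n)

theorem exists_bound_all (hf : SmoothOn univ f) (hc : HasCompactSupport f) :
    ∃ C, 0 ≤ C ∧ ∀ n ≤ 4, ∀ y, ‖iteratedFDeriv ℝ n f y‖ ≤ C := by
  choose C hC using exists_norm_iteratedFDeriv_bound hf hc
  have h0 : ∀ n, 0 ≤ C n := fun n => (norm_nonneg _).trans (hC n 0)
  refine ⟨∑ n ∈ Finset.range 5, C n, Finset.sum_nonneg fun n _ => h0 n, fun n hn y => ?_⟩
  exact (hC n y).trans (Finset.single_le_sum (fun m _ => h0 m) (Finset.mem_range.2 (by omega)))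

theorem norm_iteratedFDeriv_cut (ε : ℝ) (hε : 0 < ε) (n : ℕ) (y : E4) :
    ‖iteratedFDeriv ℝ n (cut ε) y‖ = (ε⁻¹) ^ n * ‖iteratedFDeriv ℝ n bump (ε⁻¹ • y)‖ := by
  have h := iteratedFDeriv_comp_const_smul (𝕜 := ℝ) (i := n) (f := (bump : E4 → ℝ)) ε⁻¹
    bump.contDiff
  change ‖iteratedFDeriv ℝ n (fun x => bump (ε⁻¹ • x)) y‖ = _
  rw [h, norm_smul, norm_pow, Real.norm_of_nonneg (inv_nonneg.2 hε.le)]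

/-- Multiplying a test function vanishing at the origin by the cutoff at scale `ε` costs only
`ε⁻³` under the bilaplacian. -/
theorem exists_lap_lap_mul_cut_bound (hκ : SmoothOn univ κ) (hc : HasCompactSupport κ)
    (h0 : κ 0 = 0) : ∃ C, 0 ≤ C ∧ ∀ ε, 0 < ε → ε ≤ 1 → ∀ y, ‖y‖ ≤ 2 * ε →
      |lap (lap fun y => κ y * cut ε y) y| ≤ C * (ε ^ 3)⁻¹ := by
  obtain ⟨A, hA0, hA⟩ := exists_bound_all hκ hc
  obtain ⟨B, hB0, hB⟩ := exists_bound_all (f := bump) bump.contDiff.contDiffOn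
    bump.hasCompactSupport
  -- 16 counts the terms of Δ². In the Leibniz rule the coefficients 4 + 6 + 4 + 1 are joined by 2
  -- from the term with all four derivatives on the cutoff, giving 17.
  refine ⟨16 * (17 * (A * B)), by positivity, fun ε hε hε1 y hy => ?_⟩
  have hs : SmoothOn univ fun y => κ y * cut ε y := hκ.mul (smoothOn_cut ε)
  -- Because κ(0) = 0, κ is of order ε on the ball of radius 2ε. This recovers one power of ε in the
  -- only Leibniz term of order ε⁻⁴.
  have hκy : ‖κ y‖ ≤ A * (2 * ε) := by
    have h := (convex_univ (𝕜 := ℝ) (E := E4)).norm_image_sub_le_of_norm_fderiv_le (f := κ)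
      (C := A) (fun z _ => hκ.differentiableAt isOpen_univ (mem_univ z)) (fun z _ => by
        have := hA 1 (by norm_num) z
        rwa [← norm_iteratedFDeriv_fderiv, norm_iteratedFDeriv_zero] at this)
      (mem_univ 0) (mem_univ y)
    rw [h0, sub_zero, sub_zero] at h
    exact h.trans (by gcongr)
  have hcut : ∀ n ≤ 4, ‖iteratedFDeriv ℝ n (cut ε) y‖ ≤ (ε⁻¹) ^ n * B := fun n hn => by
    rw [norm_iteratedFDeriv_cut ε hε]
    gcongr
    exact hB n hn _
  have hi1 : 1 ≤ ε⁻¹ := (one_le_inv₀ hε).2 hε1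
  have hcut3 : ∀ n ≤ 3, ‖iteratedFDeriv ℝ n (cut ε) y‖ ≤ (ε⁻¹) ^ 3 * B := fun n hn =>
    (hcut n (by omega)).trans (by gcongr)
  have hL := norm_iteratedFDeriv_mul_le (contDiffOn_univ.1 hκ)
    (contDiffOn_univ.1 (smoothOn_cut (V := univ) ε)) y (n := 4)
    (WithTop.coe_le_coe.2 (le_top : (4 : ℕ∞) ≤ ⊤))
  set a : ℕ → ℝ := fun i => ‖iteratedFDeriv ℝ i κ y‖ with ha
  set b : ℕ → ℝ := fun i => ‖iteratedFDeriv ℝ i (cut ε) y‖ with hb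
  replace hL : ‖iteratedFDeriv ℝ 4 (fun y => κ y * cut ε y) y‖
      ≤ ∑ i ∈ Finset.range (4 + 1), (Nat.choose 4 i : ℝ) * a i * b (4 - i) := hL
  have hb0 : ∀ n, 0 ≤ b n := fun n => norm_nonneg _
  have h4 : a 0 * b 4 ≤ 2 * (A * ((ε⁻¹) ^ 3 * B)) := by
    have h00 : a 0 = ‖κ y‖ := norm_iteratedFDeriv_zero
    rw [h00]
    calc _ ≤ A * (2 * ε) * ((ε⁻¹) ^ 4 * B) :=
          mul_le_mul hκy (hcut 4 le_rfl) (hb0 4) (by positivity)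
      _ = _ := by field_simp
  have hi : ∀ i ≤ 4, ∀ n ≤ 3, a i * b n ≤ A * ((ε⁻¹) ^ 3 * B) := fun i hi n hn =>
    mul_le_mul (hA i hi y) (hcut3 n hn) (hb0 n) hA0
  have h1 := hi 1 (by norm_num) 3 (by norm_num)
  have h2 := hi 2 (by norm_num) 2 (by norm_num)
  have h3 := hi 3 (by norm_num) 1 (by norm_num)
  have h5 := hi 4 (by norm_num) 0 (by norm_num)
  clear_value a b
  norm_num [Finset.sum_range_succ, Nat.choose] at hL
  refine (abs_lap_lap_le hs y).trans ?_
  rw [← inv_pow]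
  linarith

/-- The region `ε ≤ ‖y‖ ≤ 2 ε`. -/
def shell (ε : ℝ) : Set E4 := {y | ε ≤ ‖y‖ ∧ ‖y‖ ≤ 2 * ε}

theorem measurableSet_shell (ε : ℝ) : MeasurableSet (shell ε) :=
  ((isClosed_le continuous_const continuous_norm).inter
    (isClosed_le continuous_norm continuous_const)).measurableSet

theorem smoothOn_one_sub_cut_mul (hW : SmoothOn {0}ᶜ W) (hε : 0 < ε) :
    SmoothOn univ fun y => (1 - cut ε y) * W y := by
  intro y _
  by_cases hy : ‖y‖ < ε
  · have : (fun y => (1 - cut ε y) * W y) =ᶠ[𝓝 y] fun _ => 0 := by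
      filter_upwards [(isOpen_lt continuous_norm continuous_const).mem_nhds hy] with z hz
      rw [cut_eq_one hε (le_of_lt hz)]
      ring
    exact (contDiffAt_const.congr_of_eventuallyEq this).contDiffWithinAt
  · have hy0 : y ∈ ({0}ᶜ : Set E4) := fun h => hy (by
      rw [mem_singleton_iff.1 h, norm_zero]
      exact hε)
    exact ((contDiffAt_const.sub ((smoothOn_cut ε).contDiffAt isOpen_univ (mem_univ y))).mul
      (hW.contDiffAt isOpen_compl_singleton hy0)).contDiffWithinAt

theorem one_sub_cut_mul_eventuallyEq (hε : 0 < ε) (hy : 2 * ε < ‖y‖) :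
    (fun y => (1 - cut ε y) * W y) =ᶠ[𝓝 y] W := by
  filter_upwards [(isOpen_norm_gt (2 * ε)).mem_nhds hy] with z hz
  rw [cut_eq_zero hε (le_of_lt hz)]
  ring

end

/-! ### Representation by the fundamental solution across an isolated singularity -/

section

variable {W κ : E4 → ℝ} {x y : E4} {ε R : ℝ}

/-- The logarithmic kernel `log ‖x‖ - log ‖y - x‖`. -/
def logKernel (x y : E4) : ℝ := Real.log ‖x‖ - Real.log ‖y - x‖

/-- At scale ‖x‖/4 the cutoff vanishes for ‖y‖ ≥ ‖x‖/2, hence near the logarithmic pole y = x. -/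
theorem smoothOn_cut_mul_logKernel (hx : x ≠ 0) :
    SmoothOn univ fun y => cut (‖x‖ / 4) y * logKernel x y := by
  have hx0 : 0 < ‖x‖ := norm_pos_iff.2 hx
  intro y _
  by_cases hy : y = x
  · have : (fun y => cut (‖x‖ / 4) y * logKernel x y) =ᶠ[𝓝 y] fun _ => 0 := by
      filter_upwards [(isOpen_norm_gt (‖x‖ / 2)).mem_nhds (by rw [hy]; simp [hx0])] with z hz
      have hz' : ‖x‖ / 2 < ‖z‖ := hz
      rw [cut_eq_zero (by positivity) (by linarith)]
      ring
    exact (contDiffAt_const.congr_of_eventuallyEq this).contDiffWithinAt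
  · have hne : y - x ≠ 0 := sub_ne_zero.2 hy
    have h1 : ContDiffAt ℝ ((⊤ : ℕ∞) : WithTop ℕ∞) (fun y => Real.log ‖y - x‖) y :=
      (((contDiffAt_norm ℝ hne).comp y (contDiffAt_id.sub contDiffAt_const))).log
        (norm_ne_zero_iff.2 hne)
    exact (((smoothOn_cut _).contDiffAt isOpen_univ (mem_univ y)).mul
      (contDiffAt_const.sub h1)).contDiffWithinAt

theorem hasCompactSupport_cut_mul (hε : 0 < ε) (f : E4 → ℝ) :
    HasCompactSupport fun y => cut ε y * f y :=
  hasCompactSupport_of_eq_zero (R := 2 * ε) fun y hy => by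
    rw [cut_eq_zero hε (le_of_lt hy), zero_mul]

theorem continuous_of_smoothOn {f : E4 → ℝ} (h : SmoothOn univ f) : Continuous f :=
  continuousOn_univ.1 h.continuousOn

theorem lap_lap_one_sub_cut_mul (hε : 0 < ε) (hy : 2 * ε < ‖y‖) :
    lap (lap fun y => (1 - cut ε y) * W y) y = lap (lap W) y :=
  (lap_eventuallyEq (lap_eventuallyEq (one_sub_cut_mul_eventuallyEq hε hy))).eq_of_nhds

/-- Moving the bilaplacian from a cut-off singular function to a test function vanishing at the
origin, up to an error supported in a shell. -/
theorem abs_integral_lap_lap_sub_le (hW : SmoothOn {0}ᶜ W) (hR : ∀ x, R < ‖x‖ → W x = 0)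
    (hκ : SmoothOn univ κ) (hc : HasCompactSupport κ) (h0 : κ 0 = 0) :
    ∃ C, 0 ≤ C ∧ ∀ ε, 0 < ε → ε ≤ 1 →
      |(∫ y, κ y * lap (lap fun y => (1 - cut ε y) * W y) y)
        - ∫ y, κ y * (1 - cut ε y) * lap (lap W) y|
      ≤ C * ((ε ^ 3)⁻¹ * ∫ y in shell ε, |W y|) := by
  obtain ⟨A, hA0, hA⟩ := exists_bound_all hκ hc
  obtain ⟨B, hB0, hB⟩ := exists_lap_lap_mul_cut_bound hκ hc h0
  have hV := isOpen_univ (X := E4)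
  refine ⟨16 * A + (16 * A + B), by positivity, fun ε hε hε1 => ?_⟩
  have hε2 : 0 < ε / 2 := by positivity
  set φ := fun y => (1 - cut ε y) * W y with hφ
  -- A smooth substitute for W: the half scale makes it agree with W wherever κ(1 - cut ε) is
  -- nonzero, so that integration by parts is available on the whole space.
  set ψ := fun y => (1 - cut (ε / 2) y) * W y with hψ
  set κ' := fun y => κ y * (1 - cut ε y) with hκ'
  have sφ : SmoothOn univ φ := smoothOn_one_sub_cut_mul hW hε
  have sψ : SmoothOn univ ψ := smoothOn_one_sub_cut_mul hW hε2
  have scut : SmoothOn univ fun y => κ y * cut ε y := hκ.mul (smoothOn_cut ε)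
  have sκ' : SmoothOn univ κ' := hκ.mul (contDiffOn_const.sub (smoothOn_cut ε))
  have cφ : HasCompactSupport φ := hasCompactSupport_of_eq_zero (R := R) fun y hy => by
    simp [hφ, hR y hy]
  have cψ : HasCompactSupport ψ := hasCompactSupport_of_eq_zero (R := R) fun y hy => by
    simp [hψ, hR y hy]
  have e1 : ∫ y, κ y * lap (lap φ) y = ∫ y, lap (lap κ) y * φ y :=
    (integral_lap_lap_mul hκ sφ cφ).symm
  have e2 : ∫ y, κ' y * lap (lap W) y = ∫ y, lap (lap κ') y * ψ y := by
    rw [integral_lap_lap_mul sκ' sψ cψ]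
    refine integral_congr_ae (.of_forall fun y => ?_)
    by_cases hy : ‖y‖ ≤ ε
    · simp [hκ', cut_eq_one hε hy]
    · simp only [hψ]
      rw [lap_lap_one_sub_cut_mul hε2 (by linarith)]
  have i1 : Integrable fun y => lap (lap κ) y * φ y :=
    ((continuous_of_smoothOn ((hκ.lap hV).lap hV)).mul
      (continuous_of_smoothOn sφ)).integrable_of_hasCompactSupport cφ.mul_left
  have i2 : Integrable fun y => lap (lap κ') y * ψ y :=
    ((continuous_of_smoothOn ((sκ'.lap hV).lap hV)).mul
      (continuous_of_smoothOn sψ)).integrable_of_hasCompactSupport cψ.mul_left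
  -- Inside the shell both products vanish, and outside it both equal Δ²κ · W, so only the shell
  -- contributes to the difference.
  have hzero : ∀ y, y ∉ shell ε → lap (lap κ) y * φ y - lap (lap κ') y * ψ y = 0 := by
    intro y hy
    by_cases hlt : ‖y‖ < ε
    · have h1 : φ y = 0 := by simp [hφ, cut_eq_one hε hlt.le]
      have hop : IsOpen {y : E4 | ‖y‖ < ε} := isOpen_lt continuous_norm continuous_const
      have h2 : lap (lap κ') y = 0 := lap_zero_of_eqOn hop (lap_zero_of_eqOn hop
        fun z (hz : ‖z‖ < ε) => by simp [hκ', cut_eq_one hε hz.le]) y hlt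
      rw [h1, h2]
      ring
    · have hgt : 2 * ε < ‖y‖ := by
        by_contra h
        exact hy ⟨not_lt.1 hlt, not_lt.1 h⟩
      have h1 : φ y = W y := by simp [hφ, cut_eq_zero hε hgt.le]
      have h2 : ψ y = W y := by simp [hψ, cut_eq_zero hε2 (by linarith : 2 * (ε / 2) ≤ ‖y‖)]
      have h3 : κ' =ᶠ[𝓝 y] κ := by
        filter_upwards [(isOpen_norm_gt (2 * ε)).mem_nhds hgt] with z hz
        simp [hκ', cut_eq_zero hε (le_of_lt hz)]
      rw [h1, h2, (lap_eventuallyEq (lap_eventuallyEq h3)).eq_of_nhds]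
      ring
  have hbound : ∀ y ∈ shell ε, ‖lap (lap κ) y * φ y - lap (lap κ') y * ψ y‖
      ≤ (16 * A + (16 * A + B)) * (ε ^ 3)⁻¹ * |W y| := by
    intro y hy
    have hi3 : 1 ≤ (ε ^ 3)⁻¹ := (one_le_inv₀ (by positivity)).2 (pow_le_one₀ hε.le hε1)
    have hk : |lap (lap κ) y| ≤ 16 * A :=
      (abs_lap_lap_le hκ y).trans (by gcongr; exact hA 4 le_rfl y)
    have hk' : |lap (lap κ') y| ≤ 16 * A + B * (ε ^ 3)⁻¹ := by
      have : lap (lap κ') y = lap (lap κ) y - lap (lap fun y => κ y * cut ε y) y := by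
        have hl : ∀ y, lap κ y = lap κ' y + lap (fun y => κ y * cut ε y) y := fun y => by
          rw [← lap_add sκ' scut hV (mem_univ y)]
          congr 1
          ext z
          simp only [hκ']
          ring
        have hl2 : lap (lap κ) y = lap (lap κ') y + lap (lap fun y => κ y * cut ε y) y := by
          rw [← lap_add (sκ'.lap hV) (scut.lap hV) hV (mem_univ y)]
          congr 1
          ext z
          exact hl z
        linarith
      rw [this]
      exact (abs_sub _ _).trans (add_le_add hk (hB ε hε hε1 y hy.2))
    have hcut1 : ∀ ε y, |1 - cut ε y| ≤ 1 := fun ε y => by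
      rw [abs_of_nonneg (by linarith [cut_le_one ε y])]
      linarith [cut_nonneg ε y]
    have hφ1 : |φ y| ≤ |W y| := by
      simp only [hφ, abs_mul]
      exact mul_le_of_le_one_left (abs_nonneg _) (hcut1 ε y)
    have hψ1 : |ψ y| ≤ |W y| := by
      simp only [hψ, abs_mul]
      exact mul_le_of_le_one_left (abs_nonneg _) (hcut1 _ y)
    calc _ ≤ |lap (lap κ) y| * |φ y| + |lap (lap κ') y| * |ψ y| := by
          rw [← abs_mul, ← abs_mul]
          exact abs_sub _ _
      _ ≤ 16 * A * |W y| + (16 * A + B * (ε ^ 3)⁻¹) * |W y| := by gcongr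
      _ ≤ _ := by
          have h16 := mul_le_mul_of_nonneg_right
            (le_mul_of_one_le_right (by positivity : 0 ≤ 16 * A) hi3) (abs_nonneg (W y))
          linarith
  have hWc : ContinuousOn W (shell ε) := hW.continuousOn.mono fun y hy => by
    have : 0 < ‖y‖ := hε.trans_le hy.1
    exact norm_pos_iff.1 this
  have hcpt : IsCompact (shell ε) := by
    refine (isCompact_closedBall (0 : E4) (2 * ε)).of_isClosed_subset
      ((isClosed_le continuous_const continuous_norm).inter
        (isClosed_le continuous_norm continuous_const)) fun y hy => ?_
    exact mem_closedBall_zero_iff.2 hy.2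
  rw [e1, e2, ← integral_sub i1 i2, ← setIntegral_eq_integral_of_forall_compl_eq_zero hzero,
    ← Real.norm_eq_abs]
  refine (norm_integral_le_of_norm_le ((hWc.abs.integrableOn_compact hcpt).const_mul _)
    (ae_restrict_of_forall_mem (measurableSet_shell ε) hbound)).trans ?_
  rw [integral_const_mul]
  exact le_of_eq (by ring)

/-- Cut W off at scale ε, use the fundamental solution, and let ε → 0. A point mass of Δ²W at the
origin is invisible because the kernel vanishes at y = 0, and the shell hypothesis excludes worse
contributions. The kernel is split by a fixed cutoff into a smooth part near 0 and a part containing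
the pole at x. -/
theorem integral_logKernel_mul_lap_lap (hW : SmoothOn {0}ᶜ W) (hR : ∀ x, R < ‖x‖ → W x = 0)
    (hF : Integrable (lap (lap W)))
    (hsh : Tendsto (fun ε => (ε ^ 3)⁻¹ * ∫ y in shell ε, |W y|) (𝓝[>] 0) (𝓝 0)) (hx : x ≠ 0) :
    Integrable (fun y => logKernel x y * lap (lap W) y) ∧
      ∫ y, logKernel x y * lap (lap W) y = 8 * Real.pi ^ 2 * W x := by
  have hx0 : 0 < ‖x‖ := norm_pos_iff.2 hx
  have hV := isOpen_univ (X := E4)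
  set δ := ‖x‖ / 4 with hδ
  have hδ0 : 0 < δ := by positivity
  set κ := fun y => cut δ y * logKernel x y with hκ
  have sκ : SmoothOn univ κ := smoothOn_cut_mul_logKernel hx
  have cκ : HasCompactSupport κ := hasCompactSupport_cut_mul hδ0 _
  have κ0 : κ 0 = 0 := by simp [hκ, logKernel]
  obtain ⟨C, hC0, hC⟩ := abs_integral_lap_lap_sub_le hW hR sκ cκ κ0
  obtain ⟨A, hA⟩ := cκ.exists_bound_of_continuous (continuous_of_smoothOn sκ)
  have sφ : ∀ {ε}, 0 < ε → SmoothOn univ fun y => (1 - cut ε y) * W y := fun hε =>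
    smoothOn_one_sub_cut_mul hW hε
  have hRφ : ∀ ε y, R < ‖y‖ → (1 - cut ε y) * W y = 0 := fun ε y hy => by rw [hR y hy, mul_zero]
  have cφ : ∀ ε, HasCompactSupport fun y => (1 - cut ε y) * W y := fun ε =>
    hasCompactSupport_of_eq_zero (hRφ ε)
  have hRll : ∀ ε y, R < ‖y‖ → lap (lap fun y => (1 - cut ε y) * W y) y = 0 := fun ε =>
    lap_zero_of_eqOn (isOpen_norm_gt R) (lap_zero_of_eqOn (isOpen_norm_gt R) (hRφ ε))
  have hint : ∀ ε, 0 < ε → Integrable fun y => logKernel x y *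
      lap (lap fun y => (1 - cut ε y) * W y) y := by
    intro ε hε
    have c1 := continuous_of_smoothOn (((sφ hε).lap hV).lap hV)
    have c2 := hasCompactSupport_of_eq_zero (hRll ε)
    have h := ((c1.integrable_of_hasCompactSupport c2).const_mul (Real.log ‖x‖)).sub
      (integrable_log_norm_mul c1 c2 x)
    refine h.congr (.of_forall fun y => ?_)
    simp only [logKernel, Pi.sub_apply]
    ring
  have hκint : ∀ ε, 0 < ε → Integrable fun y => κ y *
      lap (lap fun y => (1 - cut ε y) * W y) y := fun ε hε =>
    ((continuous_of_smoothOn sκ).mul (continuous_of_smoothOn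
      (((sφ hε).lap hV).lap hV))).integrable_of_hasCompactSupport cκ.mul_right
  -- The far part of the kernel is zero for ‖y‖ ≤ δ, and beyond that radius the cutoff at scale ε no
  -- longer acts; this contribution is therefore independent of ε.
  have hfar : ∀ ε, 0 < ε → 2 * ε < δ → ∀ y, (logKernel x y - κ y) *
      lap (lap fun y => (1 - cut ε y) * W y) y = (logKernel x y - κ y) * lap (lap W) y := by
    intro ε hε hεδ y
    by_cases hy : ‖y‖ ≤ δ
    · simp [hκ, cut_eq_one hδ0 hy]
    · rw [lap_lap_one_sub_cut_mul hε (by linarith)]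
  have hfarint : Integrable fun y => (logKernel x y - κ y) * lap (lap W) y := by
    have hε : 0 < δ / 4 := by positivity
    refine ((hint _ hε).sub (hκint _ hε)).congr (.of_forall fun y => ?_)
    simp only [Pi.sub_apply]
    rw [← hfar _ hε (by linarith), sub_mul]
  have hnearint : Integrable fun y => κ y * lap (lap W) y :=
    hF.bdd_mul (continuous_of_smoothOn sκ).aestronglyMeasurable (.of_forall hA)
  have hval : ∀ ε, 0 < ε → 2 * ε < δ → 8 * Real.pi ^ 2 * W x
      = (∫ y, κ y * lap (lap fun y => (1 - cut ε y) * W y) y)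
        + ∫ y, (logKernel x y - κ y) * lap (lap W) y := by
    intro ε hε hεδ
    have h1 := integral_log_norm_mul_lap_lap (sφ hε) (hRφ ε) x
    -- Testing against the constant 1 shows that the bilaplacian has zero mean, so inserting log‖x‖
    -- into the kernel changes nothing.
    have h2 : ∫ y, lap (lap fun y => (1 - cut ε y) * W y) y = 0 := by
      have := integral_lap_lap_mul (f := fun _ => 1) contDiffOn_const (sφ hε) (cφ ε)
      have hz : ∀ y : E4, lap (lap fun _ => (1 : ℝ)) y = 0 := fun y => by
        have hp : ∀ i c, pd i (fun _ : E4 => (c : ℝ)) = fun _ => 0 := fun i c =>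
          funext fun y => pd_const c
        have hl : lap (fun _ : E4 => (1 : ℝ)) = fun _ => 0 := funext fun y => by simp [lap, hp]
        rw [hl]
        simp [lap, hp]
      simpa [hz] using this.symm
    have c1 := continuous_of_smoothOn (((sφ hε).lap hV).lap hV)
    have c2 := hasCompactSupport_of_eq_zero (hRll ε)
    have h3 : ∫ y, logKernel x y * lap (lap fun y => (1 - cut ε y) * W y) y
        = 8 * Real.pi ^ 2 * W x := by
      have hsp : ∀ y, logKernel x y * lap (lap fun y => (1 - cut ε y) * W y) y
          = Real.log ‖x‖ * lap (lap fun y => (1 - cut ε y) * W y) y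
            - Real.log ‖y - x‖ * lap (lap fun y => (1 - cut ε y) * W y) y := fun y =>
        sub_mul _ _ _
      simp_rw [hsp]
      rw [integral_sub ((c1.integrable_of_hasCompactSupport c2).const_mul _)
        (integrable_log_norm_mul c1 c2 x), h1, integral_const_mul, h2,
        cut_eq_zero hε (by linarith : 2 * ε ≤ ‖x‖)]
      ring
    rw [← h3, ← integral_congr_ae (.of_forall (hfar ε hε hεδ)),
      ← integral_add (hκint ε hε) (by
        refine ((hint _ hε).sub (hκint _ hε)).congr (.of_forall fun y => ?_)
        simp only [Pi.sub_apply]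
        ring)]
    congr 1
    ext y
    ring
  have hlim1 : Tendsto (fun ε => ∫ y, κ y * (1 - cut ε y) * lap (lap W) y) (𝓝[>] 0)
      (𝓝 (∫ y, κ y * lap (lap W) y)) := by
    refine tendsto_integral_filter_of_dominated_convergence
      (fun y => ‖κ y * lap (lap W) y‖) ?_ ?_ hnearint.norm ?_
    · refine .of_forall fun ε => ?_
      have : Continuous fun y => 1 - cut ε y :=
        continuous_const.sub (continuous_of_smoothOn (smoothOn_cut ε))
      exact (((continuous_of_smoothOn sκ).mul this).aestronglyMeasurable).mul
        hF.aestronglyMeasurable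
    · refine .of_forall fun ε => .of_forall fun y => ?_
      rw [mul_right_comm, norm_mul]
      refine mul_le_of_le_one_right (norm_nonneg _) ?_
      rw [Real.norm_of_nonneg (by linarith [cut_le_one ε y])]
      linarith [cut_nonneg ε y]
    · refine .of_forall fun y => ?_
      refine tendsto_const_nhds.congr' ?_
      by_cases hy : y = 0
      · exact .of_forall fun ε => by simp [hy, κ0]
      · have hy0 : 0 < ‖y‖ := norm_pos_iff.2 hy
        filter_upwards [Ioo_mem_nhdsGT (by positivity : 0 < ‖y‖ / 2)] with ε hε
        rw [cut_eq_zero hε.1 (by linarith [hε.2])]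
        ring
  have hlim2 : Tendsto (fun ε => (∫ y, κ y * lap (lap fun y => (1 - cut ε y) * W y) y)
        - ∫ y, κ y * (1 - cut ε y) * lap (lap W) y) (𝓝[>] 0) (𝓝 0) := by
    refine squeeze_zero_norm' ?_ (by simpa using hsh.const_mul C)
    filter_upwards [Ioc_mem_nhdsGT one_pos] with ε hε using hC ε hε.1 hε.2
  have hlim3 := (hlim2.add hlim1).add_const (∫ y, (logKernel x y - κ y) * lap (lap W) y)
  have hconst : Tendsto (fun _ : ℝ => 8 * Real.pi ^ 2 * W x) (𝓝[>] 0)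
      (𝓝 (0 + (∫ y, κ y * lap (lap W) y) + ∫ y, (logKernel x y - κ y) * lap (lap W) y)) := by
    refine hlim3.congr' ?_
    filter_upwards [Ioo_mem_nhdsGT (by positivity : 0 < δ / 2)] with ε hε
    rw [hval ε hε.1 (by linarith [hε.2])]
    ring
  have hsum : (fun y => logKernel x y * lap (lap W) y)
      = fun y => κ y * lap (lap W) y + (logKernel x y - κ y) * lap (lap W) y := by
    ext y
    ring
  refine ⟨hsum ▸ hnearint.add hfarint, ?_⟩
  rw [tendsto_nhds_unique tendsto_const_nhds hconst, hsum, integral_add hnearint hfarint, zero_add]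

end

/-! ### Integrals of |W| over shrinking shells -/

section shells

variable {W : E4 → ℝ} {c s ε : ℝ}

/-- The lower bound gives |W| ≤ W + 2|c|, and t + 1 ≤ e^t with t = 4W + 4 log ε gives W ≤ (ε⁴/4)
e^{4W} - log ε. The shell has volume at most that of the ball of radius 2ε. -/
theorem setIntegral_shell_abs_le (hε : 0 < ε) (hε1 : ε < 1) (hs : 2 * ε < s)
    (hc : ∀ x, 0 < ‖x‖ → ‖x‖ ≤ s → c ≤ W x)
    (hI : IntegrableOn (fun x => Real.exp (4 * W x)) (Metric.ball (0 : E4) s)) :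
    ∫ y in shell ε, |W y| ≤
      ε ^ 4 / 4 * (∫ x in Metric.ball (0 : E4) s, Real.exp (4 * W x)) +
        (2 * |c| - Real.log ε) * ((2 * ε) ^ 4 * volume.real (Metric.ball (0 : E4) 1)) := by
  have hsub : shell ε ⊆ Metric.ball (0 : E4) s := fun y hy => by
    rw [mem_ball_zero_iff]; exact hy.2.trans_lt hs
  have hsub2 : shell ε ⊆ Metric.closedBall (0 : E4) (2 * ε) := fun y hy => by
    rw [mem_closedBall_zero_iff]; exact hy.2
  have hfin : volume (shell ε) ≠ ⊤ :=
    ((measure_mono hsub2).trans_lt measure_closedBall_lt_top).ne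
  have hI1 : IntegrableOn (fun x => ε ^ 4 / 4 * Real.exp (4 * W x)) (shell ε) :=
    (hI.mono_set hsub).const_mul _
  have hI2 : IntegrableOn (fun _ : E4 => 2 * |c| - Real.log ε) (shell ε) :=
    integrableOn_const hfin
  have hlog : Real.log ε < 0 := Real.log_neg hε hε1
  have hpt : ∀ y ∈ shell ε, |W y| ≤ ε ^ 4 / 4 * Real.exp (4 * W y) + (2 * |c| - Real.log ε) := by
    intro y hy
    have h1 := hc y (hε.trans_le hy.1) (hy.2.trans hs.le)
    have h2 := Real.add_one_le_exp (4 * W y + 4 * Real.log ε)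
    have h3 : Real.exp (4 * W y + 4 * Real.log ε) = ε ^ 4 * Real.exp (4 * W y) := by
      rw [Real.exp_add, show 4 * Real.log ε = ((4 : ℕ) : ℝ) * Real.log ε by norm_num,
        Real.exp_nat_mul, Real.exp_log hε, mul_comm]
    have h4 : |W y| ≤ W y + 2 * |c| := by
      rw [abs_le]; constructor <;> linarith [neg_abs_le c, abs_nonneg c]
    linarith
  calc ∫ y in shell ε, |W y|
      ≤ ∫ y in shell ε, (ε ^ 4 / 4 * Real.exp (4 * W y) + (2 * |c| - Real.log ε)) := by
        refine integral_mono_of_nonneg (.of_forall fun _ => abs_nonneg _) (hI1.add hI2) ?_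
        exact (ae_restrict_iff' (measurableSet_shell ε)).2 (.of_forall hpt)
    _ = ε ^ 4 / 4 * (∫ y in shell ε, Real.exp (4 * W y)) +
          (2 * |c| - Real.log ε) * volume.real (shell ε) := by
        rw [integral_add hI1 hI2, integral_const_mul, setIntegral_const, smul_eq_mul, mul_comm
          (volume.real _)]
    _ ≤ _ := by
        refine add_le_add (mul_le_mul_of_nonneg_left ?_ (by positivity))
          (mul_le_mul_of_nonneg_left ?_ (by linarith [abs_nonneg c]))
        · exact setIntegral_mono_set hI (.of_forall fun _ => (Real.exp_pos _).le)
            (.of_forall hsub)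
        · have := Measure.addHaar_real_closedBall (volume : Measure E4) 0 (r := 2 * ε)
            (by positivity)
          rw [finrank_E4] at this
          rw [← this]
          exact measureReal_mono hsub2 measure_closedBall_lt_top.ne

/-- The shell integral is bounded by a multiple of ε⁴ log(1/ε), which beats the ε⁻³ lost to the
cutoff. -/
theorem tendsto_integral_shell_abs (hs : 0 < s)
    (hc : ∀ x, 0 < ‖x‖ → ‖x‖ ≤ s → c ≤ W x)
    (hI : IntegrableOn (fun x => Real.exp (4 * W x)) (Metric.ball (0 : E4) s)) :
    Tendsto (fun ε => (ε ^ 3)⁻¹ * ∫ y in shell ε, |W y|) (𝓝[>] 0) (𝓝 0) := by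
  set I := ∫ x in Metric.ball (0 : E4) s, Real.exp (4 * W x) with hIdef
  set D := volume.real (Metric.ball (0 : E4) 1)
  have hcont : Continuous fun ε : ℝ =>
      ε / 4 * I + 16 * D * (2 * |c| * ε - ε * Real.log ε) :=
    ((continuous_id.div_const 4).mul_const I).add
      (continuous_const.mul ((continuous_const.mul continuous_id).sub Real.continuous_mul_log))
  have hlim := (hcont.tendsto 0).mono_left (nhdsWithin_le_nhds (s := Ioi 0))
  simp only [zero_div, zero_mul, mul_zero, sub_zero, add_zero] at hlim
  refine squeeze_zero' ?_ ?_ hlim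
  · filter_upwards [self_mem_nhdsWithin] with ε hε
    have : (0 : ℝ) < ε := hε
    exact mul_nonneg (by positivity) (integral_nonneg fun _ => abs_nonneg _)
  · filter_upwards [Ioo_mem_nhdsGT (show (0 : ℝ) < min 1 (s / 2) by positivity)] with ε hε
    have h0 := hε.1
    have h := setIntegral_shell_abs_le h0 (hε.2.trans_le (min_le_left _ _))
      (by linarith [hε.2.trans_le (min_le_right 1 (s / 2))]) hc hI
    calc (ε ^ 3)⁻¹ * ∫ y in shell ε, |W y|
        ≤ (ε ^ 3)⁻¹ * (ε ^ 4 / 4 * I + (2 * |c| - Real.log ε) * ((2 * ε) ^ 4 * D)) :=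
          mul_le_mul_of_nonneg_left h (by positivity)
      _ = _ := by field_simp; ring

end shells

/-! ### Exponential integrability of the logarithmic kernel over spheres -/

theorem sigma_coord_eq_zero (i : Fin 4) : sigma {θ : Sph | (θ : E4) i = 0} = 0 := by
  have hm : MeasurableSet {θ : Sph | (θ : E4) i = 0} :=
    (isClosed_eq (by fun_prop) continuous_const).measurableSet
  rw [Measure.toSphere_apply' _ hm]
  set s := LinearMap.ker (EuclideanSpace.proj (𝕜 := ℝ) i : E4 →L[ℝ] ℝ).toLinearMap with hs
  have hne : s ≠ ⊤ := by
    intro h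
    have : EuclideanSpace.single i (1 : ℝ) ∈ s := h ▸ Submodule.mem_top
    simp [hs] at this
  have h0 := Measure.addHaar_submodule (volume : Measure E4) s hne
  rw [measure_mono_null ?_ h0, mul_zero]
  intro z hz
  obtain ⟨r, -, y, ⟨θ, hθ, rfl⟩, rfl⟩ := Set.mem_smul.1 hz
  have : (θ : E4) i = 0 := hθ
  simp [hs, this]

theorem integrable_cube_rpow (i : Fin 4) :
    Integrable fun x : E4 => ∏ j, (Icc (-1 : ℝ) 1).indicator
      (fun t => if j = i then |t| ^ (-(1 / 2) : ℝ) else 1) (x j) := by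
  have h1 : ∀ j : Fin 4, Integrable ((Icc (-1 : ℝ) 1).indicator
      (fun t => if j = i then |t| ^ (-(1 / 2) : ℝ) else 1)) := by
    intro j
    rw [integrable_indicator_iff measurableSet_Icc]
    split_ifs
    · have h := (intervalIntegral.intervalIntegrable_rpow' (a := 0) (b := 1)
        (r := (-(1 / 2) : ℝ)) (by norm_num))
      have h3 : IntervalIntegrable (fun t : ℝ => |t| ^ (-(1 / 2) : ℝ)) volume 0 1 :=
        h.congr fun t ht => by
          rw [uIoc_of_le zero_le_one] at ht
          simp only [abs_of_pos ht.1]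
      have h2 : IntervalIntegrable (fun t : ℝ => |t| ^ (-(1 / 2) : ℝ)) volume (-1) 0 := by
        have := (IntervalIntegrable.iff_comp_neg (by simp)).1 h3
        simp only [abs_neg, neg_zero] at this
        exact this.symm
      have := (h2.trans h3)
      rwa [intervalIntegrable_iff_integrableOn_Icc_of_le (by norm_num)] at this
    · exact integrableOn_const (by simp)
  have h2 := Integrable.fintype_prod (μ := fun _ : Fin 4 => (volume : Measure ℝ)) h1
  exact (PiLp.volume_preserving_ofLp (Fin 4)).integrable_comp_emb
    (MeasurableEquiv.toLp 2 (Fin 4 → ℝ)).symm.measurableEmbedding |>.2 h2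

/-- Polar coordinates make the integrable function of `integrable_cube_rpow` integrable on almost
every sphere. One with radius below 1 lies in the cube, where the indicators are 1, and homogeneity
rescales it to the unit sphere. -/
theorem integrable_sphere_coord_rpow (i : Fin 4) :
    Integrable (fun θ : Sph => |(θ : E4) i| ^ (-(1 / 2) : ℝ)) sigma := by
  have h := (integrable_polar_prod (integrable_cube_rpow i)).prod_left_ae
  obtain ⟨r, hr1, hr⟩ : ∃ r : Ioi (0 : ℝ), (r : ℝ) < 1 ∧
      Integrable (fun θ : Sph => ∏ j, (Icc (-1 : ℝ) 1).indicator
        (fun t => if j = i then |t| ^ (-(1 / 2) : ℝ) else 1) (((r : ℝ) • (θ : E4)) j)) sigma := by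
    by_contra! hcon
    have h0 := measure_mono_null (t := _) (s := Iio (⟨1, mem_Ioi.2 one_pos⟩ : Ioi (0 : ℝ)))
      (fun r hr => hcon r hr) (ae_iff.1 h)
    rw [Measure.volumeIoiPow_apply_Iio] at h0
    norm_num at h0
  have hr0 : (0 : ℝ) < r := r.2
  refine (hr.const_mul ((r : ℝ) ^ (1 / 2 : ℝ))).congr (.of_forall fun θ => ?_)
  have hmem : ∀ j, ((r : ℝ) • (θ : E4)) j ∈ Icc (-1 : ℝ) 1 := fun j => by
    rw [mem_Icc, ← abs_le, ← Real.norm_eq_abs]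
    refine (PiLp.norm_apply_le _ j).trans ?_
    rw [norm_smul_sphere hr0.le]
    exact hr1.le
  simp only [indicator_of_mem (hmem _)]
  simp only [Finset.prod_ite_eq', Finset.mem_univ, if_true, PiLp.smul_apply, smul_eq_mul, abs_mul,
    abs_of_pos hr0]
  rw [Real.mul_rpow hr0.le (abs_nonneg _), ← mul_assoc, ← Real.rpow_add hr0]
  norm_num

/-- The integral over the sphere of the inverse square root of the distance to `e`. -/
def capIntegral (e : E4) : ENNReal :=
  ∫⁻ θ : Sph, ENNReal.ofReal ‖(θ : E4) - e‖ ^ (-(1 / 2) : ℝ) ∂sigma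

/-- The reflection exchanging e and e' preserves surface measure. -/
theorem capIntegral_eq {e e' : E4} (h : ‖e‖ = ‖e'‖) : capIntegral e = capIntegral e' := by
  set R := Submodule.reflection (ℝ ∙ (e - e'))ᗮ
  have hR : R e = e' := Submodule.reflection_sub h
  have := lintegral_sphere_comp R fun y => ENNReal.ofReal ‖y - e'‖ ^ (-(1 / 2) : ℝ)
  rw [capIntegral, capIntegral, ← this]
  simp only [← hR, ← map_sub, LinearIsometryEquiv.norm_map]

/-- A coordinate in which e vanishes bounds the distance to e from below, reducing the claim to the
integrability of |θ₁|^{-1/2}. -/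
theorem capIntegral_single_lt_top : capIntegral (EuclideanSpace.single 0 1) < ⊤ := by
  refine lt_of_le_of_lt ?_ (integrable_sphere_coord_rpow 1).lintegral_lt_top
  refine lintegral_mono_ae ?_
  filter_upwards [compl_mem_ae_iff.2 (sigma_coord_eq_zero 1)] with θ hθ
  have hθ' : (θ : E4) 1 ≠ 0 := hθ
  have h1 : |(θ : E4) 1| ≤ ‖(θ : E4) - EuclideanSpace.single 0 1‖ := by
    have := PiLp.norm_apply_le ((θ : E4) - EuclideanSpace.single 0 1) 1
    simpa using this
  rw [← ENNReal.ofReal_rpow_of_pos (abs_pos.2 hθ')]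
  rw [ENNReal.rpow_neg, ENNReal.rpow_neg, ENNReal.inv_le_inv]
  exact ENNReal.rpow_le_rpow (ENNReal.ofReal_le_ofReal h1) (by norm_num)

/-- The smaller of the two ratios of `r` and `s`. -/
def ratio (r s : ℝ) : ℝ := min (r / s) (s / r)

theorem ratio_pos {r s : ℝ} (hr : 0 < r) (hs : 0 < s) : 0 < ratio r s :=
  lt_min (div_pos hr hs) (div_pos hs hr)

theorem ratio_le_one {r s : ℝ} (hr : 0 < r) (hs : 0 < s) : ratio r s ≤ 1 := by
  rcases le_total r s with h | h
  · exact (min_le_left _ _).trans ((div_le_one hs).2 h)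
  · exact (min_le_right _ _).trans ((div_le_one hr).2 h)

/-- The kernel `log (max (|x|, |y|) / |x - y|)`. -/
def devKernel (x y : E4) : ℝ := logKernel x y - min 0 (Real.log ‖x‖ - Real.log ‖y‖)

theorem devKernel_eq {x y : E4} (hx : x ≠ 0) (hy : y ≠ 0) :
    devKernel x y = Real.log (max ‖x‖ ‖y‖) - Real.log ‖y - x‖ := by
  have hx := norm_pos_iff.2 hx
  have hy := norm_pos_iff.2 hy
  rw [devKernel, logKernel]
  rcases le_total ‖x‖ ‖y‖ with h | h
  · rw [max_eq_right h, min_eq_right (by linarith [Real.log_le_log hx h])]; ring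
  · rw [max_eq_left h, min_eq_left (by linarith [Real.log_le_log hy h])]; ring

/-- With m the larger norm and l the ratio, |x - y| lies between m(1 - l) and m(1 + l); for l ≤ ½
one has 1/(1 - l) ≤ 1 + 2l ≤ e^{2l}. -/
theorem abs_devKernel_le_of_ratio_le {x y : E4} (hx : x ≠ 0) (hy : y ≠ 0)
    (h : ratio ‖x‖ ‖y‖ ≤ 1 / 2) : |devKernel x y| ≤ 2 * ratio ‖x‖ ‖y‖ := by
  have hx' := norm_pos_iff.2 hx
  have hy' := norm_pos_iff.2 hy
  set m := max ‖x‖ ‖y‖ with hm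
  set l := ratio ‖x‖ ‖y‖ with hl
  have hl0 : 0 < l := ratio_pos hx' hy'
  have hm0 : 0 < m := lt_max_of_lt_left hx'
  have hb : m * (1 - l) ≤ ‖y - x‖ ∧ ‖y - x‖ ≤ m * (1 + l) := by
    have h1 := norm_sub_le y x
    have h2 := abs_norm_sub_norm_le y x
    rw [abs_le] at h2
    rcases le_total ‖x‖ ‖y‖ with hxy | hxy
    · have : m * l = ‖x‖ := by
        rw [hm, hl, max_eq_right hxy, ratio, min_eq_left]
        · field_simp
        · exact ((div_le_one hy').2 hxy).trans ((one_le_div hx').2 hxy)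
      have hmy : m = ‖y‖ := max_eq_right hxy
      constructor <;> nlinarith
    · have : m * l = ‖y‖ := by
        rw [hm, hl, max_eq_left hxy, ratio, min_eq_right]
        · field_simp
        · exact ((div_le_one hx').2 hxy).trans ((one_le_div hy').2 hxy)
      have hmx : m = ‖x‖ := max_eq_left hxy
      constructor <;> nlinarith
  have hd : 0 < ‖y - x‖ := lt_of_lt_of_le (mul_pos hm0 (by linarith)) hb.1
  rw [devKernel_eq hx hy, ← Real.log_div hm0.ne' hd.ne', abs_le]
  have hq : 0 < m / ‖y - x‖ := div_pos hm0 hd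
  constructor
  · rw [Real.le_log_iff_exp_le hq, Real.exp_neg, le_div_iff₀ hd, inv_mul_le_iff₀ (Real.exp_pos _)]
    nlinarith [Real.add_one_le_exp (2 * l)]
  · rw [Real.log_le_iff_le_exp hq, div_le_iff₀ hd]
    have h3 : 1 + 2 * l ≤ Real.exp (2 * l) := by linarith [Real.add_one_le_exp (2 * l)]
    calc m ≤ (1 + 2 * l) * (m * (1 - l)) := by nlinarith [mul_pos hm0 hl0]
      _ ≤ Real.exp (2 * l) * ‖y - x‖ :=
        mul_le_mul h3 hb.1 (mul_nonneg hm0.le (by linarith)) (Real.exp_pos _).le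

/-- For comparable radii, r|θ - e| ≤ 2|x - y| and max(r, s) ≤ 2r bound max(r, s)/|x - y| by 4/|θ -
e|. Its inverse is at most 2, which is again below 4/|θ - e| as |θ - e| ≤ 2. -/
theorem abs_devKernel_le_of_lt_ratio {r s : ℝ} (hr : 0 < r) (hs : 0 < s) {θ e : E4}
    (hθ : ‖θ‖ = 1) (he : ‖e‖ = 1) (hne : θ ≠ e) (h : 1 / 2 < ratio r s) :
    |devKernel (r • θ) (s • e)| ≤ Real.log (4 / ‖θ - e‖) := by
  have hx : ‖r • θ‖ = r := by rw [norm_smul, hθ, mul_one, Real.norm_of_nonneg hr.le]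
  have hy : ‖s • e‖ = s := by rw [norm_smul, he, mul_one, Real.norm_of_nonneg hs.le]
  have hx0 : r • θ ≠ 0 := norm_pos_iff.1 (by rwa [hx])
  have hy0 : s • e ≠ 0 := norm_pos_iff.1 (by rwa [hy])
  have ht : 0 < ‖θ - e‖ := norm_pos_iff.2 (sub_ne_zero.2 hne)
  have ht2 : ‖θ - e‖ ≤ 2 := (norm_sub_le _ _).trans (by rw [hθ, he]; norm_num)
  have hm : max r s ≤ 2 * r := by
    have h1 : 1 / 2 < r / s := h.trans_le (min_le_left _ _)
    rw [lt_div_iff₀ hs] at h1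
    exact max_le (by linarith) (by linarith)
  have hm0 : 0 < max r s := lt_max_of_lt_left hr
  have hd1 : r * ‖θ - e‖ ≤ 2 * ‖s • e - r • θ‖ := by
    have h1 : r • (θ - e) = (s - r) • e - (s • e - r • θ) := by module
    have h2 : ‖r • (θ - e)‖ ≤ ‖(s - r) • e‖ + ‖s • e - r • θ‖ := h1 ▸ norm_sub_le _ _
    rw [norm_smul, norm_smul, he, Real.norm_of_nonneg hr.le, mul_one, Real.norm_eq_abs] at h2
    have h3 := abs_norm_sub_norm_le (s • e) (r • θ)
    rw [hx, hy] at h3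
    linarith
  have hd2 : ‖s • e - r • θ‖ ≤ 2 * max r s := by
    have := norm_sub_le (s • e) (r • θ)
    rw [hx, hy] at this
    linarith [le_max_left r s, le_max_right r s]
  have hd : 0 < ‖s • e - r • θ‖ := by nlinarith [mul_pos hr ht]
  rw [devKernel_eq hx0 hy0, hx, hy, ← Real.log_div hm0.ne' hd.ne', abs_le']
  have hq : 0 < max r s / ‖s • e - r • θ‖ := div_pos hm0 hd
  rw [← Real.log_inv]
  constructor
  · refine Real.log_le_log hq ?_
    rw [div_le_div_iff₀ hd ht]
    nlinarith
  · refine Real.log_le_log (inv_pos.2 hq) ?_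
    rw [inv_div, div_le_div_iff₀ hm0 ht]
    nlinarith

/-- Dividing by 4 times the ratio keeps the exponent at most ½ when the radii are far apart, and at
most ½ log(4/|θ - e|) when they are comparable. The exponential is then at most 2, respectively 2|θ
- e|^{-1/2}, whose integral does not depend on e. -/
theorem exists_lintegral_exp_devKernel_le : ∃ M : ENNReal, M ≠ ⊤ ∧ ∀ r : ℝ, 0 < r → ∀ y : E4, y ≠ 0 →
    ∫⁻ θ : Sph, ENNReal.ofReal (Real.exp (|devKernel (r • (θ : E4)) y| / (4 * ratio r ‖y‖))) ∂sigma
      ≤ M := by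
  refine ⟨2 * sigma univ + 2 * capIntegral (EuclideanSpace.single 0 1), ?_, fun r hr y hy => ?_⟩
  · exact ENNReal.add_ne_top.2 ⟨ENNReal.mul_ne_top (by simp) (measure_ne_top _ _),
      ENNReal.mul_ne_top (by simp) capIntegral_single_lt_top.ne⟩
  have hs : 0 < ‖y‖ := norm_pos_iff.2 hy
  have hl := ratio_pos hr hs
  rcases le_or_gt (ratio r ‖y‖) (1 / 2) with h | h
  · refine le_trans ?_ le_self_add
    rw [← lintegral_const]
    refine lintegral_mono fun θ => ?_
    have hx : ‖r • (θ : E4)‖ = r := norm_smul_sphere hr.le θ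
    have hk := abs_devKernel_le_of_ratio_le (x := r • (θ : E4)) (y := y)
      (norm_pos_iff.1 (by rwa [hx])) hy (by rwa [hx])
    rw [hx] at hk
    have h2 : |devKernel (r • (θ : E4)) y| / (4 * ratio r ‖y‖) ≤ 1 / 2 := by
      rw [div_le_iff₀ (by positivity)]; linarith
    have h3 : Real.exp (1 / 2) ≤ 2 := by
      have := Real.exp_one_lt_d9
      have h4 : Real.exp (1 / 2) * Real.exp (1 / 2) = Real.exp 1 := by
        rw [← Real.exp_add]; norm_num
      nlinarith [Real.exp_pos (1 / 2)]
    calc _ ≤ ENNReal.ofReal 2 := ENNReal.ofReal_le_ofReal ((Real.exp_le_exp.2 h2).trans h3)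
      _ = 2 := by simp
  · refine le_trans ?_ le_add_self
    set e : E4 := ‖y‖⁻¹ • y with he
    have he1 : ‖e‖ = 1 := by
      rw [he, norm_smul, norm_inv, norm_norm, inv_mul_cancel₀ hs.ne']
    have hye : y = ‖y‖ • e := by rw [he, smul_smul, mul_inv_cancel₀ hs.ne', one_smul]
    rw [capIntegral_eq (e' := e) (by simp [he1]), capIntegral,
      ← lintegral_const_mul' _ _ (by simp)]
    refine lintegral_mono fun θ => ?_
    -- At θ = e the bounding integrand is infinite, being a negative power of zero in `ENNReal`.
    by_cases hθ : (θ : E4) = e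
    · simp [hθ]
    have ht : 0 < ‖(θ : E4) - e‖ := norm_pos_iff.2 (sub_ne_zero.2 hθ)
    have hk := abs_devKernel_le_of_lt_ratio hr hs (norm_eq_of_mem_sphere θ) he1 hθ h
    rw [← hye] at hk
    have h2 : |devKernel (r • (θ : E4)) y| / (4 * ratio r ‖y‖) ≤
        Real.log (4 / ‖(θ : E4) - e‖) * (1 / 2) := by
      rw [div_le_iff₀ (by positivity)]
      nlinarith [(abs_nonneg _).trans hk]
    rw [ENNReal.ofReal_rpow_of_pos ht]
    refine (ENNReal.ofReal_le_ofReal ((Real.exp_le_exp.2 h2).trans_eq ?_)).trans_eq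
      (b := ENNReal.ofReal (2 * ‖(θ : E4) - e‖ ^ (-(1 / 2) : ℝ))) ?_
    · rw [← Real.rpow_def_of_pos (by positivity), Real.div_rpow (by norm_num) ht.le,
        Real.rpow_neg ht.le, show (4 : ℝ) = 2 ^ (2 : ℝ) by norm_num,
        ← Real.rpow_mul (by norm_num)]
      norm_num [div_eq_mul_inv]
    · rw [ENNReal.ofReal_mul (by norm_num)]
      simp

/-- Jensen's inequality for a weight of mass at most one, with the summand 1 absorbing the missing
mass. Integrating the tangent line of exp at c leaves the defect e^c(1 - c)(1 - m), which is at most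
1 because e^c(1 - c) ≤ 1. -/
theorem ofReal_exp_integral_le {X : Type*} [MeasurableSpace X] {μ : Measure X} {f h : X → ℝ}
    (hh : ∀ᵐ x ∂μ, 0 ≤ h x) (hhi : Integrable h μ)
    (hfh : Integrable (fun x => h x * f x) μ) (hfm : AEMeasurable f μ) (h1 : ∫ x, h x ∂μ ≤ 1) :
    ENNReal.ofReal (Real.exp (∫ x, h x * f x ∂μ)) ≤
      1 + ∫⁻ x, ENNReal.ofReal (h x) * ENNReal.ofReal (Real.exp (f x)) ∂μ := by
  set m := ∫ x, h x ∂μ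
  set c := ∫ x, h x * f x ∂μ
  have hm0 : 0 ≤ m := integral_nonneg_of_ae hh
  rcases eq_or_ne (∫⁻ x, ENNReal.ofReal (h x) * ENNReal.ofReal (Real.exp (f x)) ∂μ) ⊤ with ht | ht
  · simp [ht]
  have hl : ∫⁻ x, ENNReal.ofReal (h x) * ENNReal.ofReal (Real.exp (f x)) ∂μ =
      ∫⁻ x, ENNReal.ofReal (h x * Real.exp (f x)) ∂μ := by
    refine lintegral_congr_ae ?_
    filter_upwards [hh] with x hx
    rw [ENNReal.ofReal_mul hx]
  rw [hl] at ht ⊢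
  have hi0 : ∀ᵐ x ∂μ, 0 ≤ h x * Real.exp (f x) := by
    filter_upwards [hh] with x hx using mul_nonneg hx (Real.exp_pos _).le
  have hi : Integrable (fun x => h x * Real.exp (f x)) μ := by
    refine ⟨hhi.1.mul (Real.measurable_exp.comp_aemeasurable hfm).aestronglyMeasurable, ?_⟩
    rw [hasFiniteIntegral_iff_ofReal hi0]
    exact ht.lt_top
  rw [← ofReal_integral_eq_lintegral_ofReal hi hi0, ← ENNReal.ofReal_one,
    ← ENNReal.ofReal_add zero_le_one (integral_nonneg_of_ae hi0)]
  refine ENNReal.ofReal_le_ofReal ?_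
  have hA : Integrable (fun x => Real.exp c * (1 - c) * h x) μ := hhi.const_mul _
  have hB : Integrable (fun x => Real.exp c * (h x * f x)) μ := hfh.const_mul _
  have key : Real.exp c * (1 - c) * m + Real.exp c * c ≤ ∫ x, h x * Real.exp (f x) ∂μ := by
    rw [← integral_const_mul, ← integral_const_mul, ← integral_add hA hB]
    refine integral_mono_ae (hA.add hB) hi ?_
    filter_upwards [hh] with x hx
    have h2 := Real.add_one_le_exp (f x - c)
    have h3 : Real.exp (f x) = Real.exp c * Real.exp (f x - c) := by
      rw [← Real.exp_add]; ring_nf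
    have h4 := mul_le_mul_of_nonneg_left h2 (mul_nonneg hx (Real.exp_pos c).le)
    rw [h3]
    linarith
  have h5 : -1 ≤ Real.exp c * (c - 1) := by
    have h6 := Real.add_one_le_exp (-c)
    have h7 : Real.exp c * Real.exp (-c) = 1 := by rw [← Real.exp_add]; simp
    nlinarith [Real.exp_pos c]
  nlinarith

/-! ### Deviation of a logarithmic potential from its radial part -/

section deviation

variable {W F : E4 → ℝ} {R r q : ℝ}

/-- The radial part of the logarithmic potential of `F`. -/
def radialPot (F : E4 → ℝ) (r : ℝ) : ℝ :=
  (8 * Real.pi ^ 2)⁻¹ * ∫ y, min 0 (Real.log r - Real.log ‖y‖) * F y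

/-- The interaction mass of `F` with the sphere of radius `r`. -/
def interaction (F : E4 → ℝ) (r : ℝ) : ℝ :=
  (8 * Real.pi ^ 2)⁻¹ * ∫ y, ratio r ‖y‖ * |F y|

theorem ratio_nonneg {r s : ℝ} (hr : 0 ≤ r) (hs : 0 ≤ s) : 0 ≤ ratio r s :=
  le_min (div_nonneg hr hs) (div_nonneg hs hr)

theorem ratio_le_one' {r s : ℝ} (hr : 0 < r) (hs : 0 ≤ s) : ratio r s ≤ 1 := by
  rcases hs.eq_or_lt with rfl | hs
  · simp [ratio]
  · exact ratio_le_one hr hs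

theorem measurable_ratio_norm (r : ℝ) : Measurable fun y : E4 => ratio r ‖y‖ := by
  unfold ratio
  fun_prop

theorem integrable_ratio_mul (hF : Integrable F) (hr : 0 < r) :
    Integrable fun y => ratio r ‖y‖ * |F y| := by
  refine hF.abs.mono' ((measurable_ratio_norm r).aestronglyMeasurable.mul hF.abs.1)
    (.of_forall fun y => ?_)
  rw [norm_mul, Real.norm_of_nonneg (ratio_nonneg hr.le (norm_nonneg y)), Real.norm_eq_abs, abs_abs]
  exact mul_le_of_le_one_left (abs_nonneg _) (ratio_le_one' hr (norm_nonneg y))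

/-- Dominated convergence: the ratio is at most 1 and at most r/‖y‖. Hence the interaction is
eventually small, whatever the size of F. -/
theorem tendsto_interaction (hF : Integrable F) :
    Tendsto (interaction F) (𝓝[>] 0) (𝓝 0) := by
  have h : Tendsto (fun r => ∫ y, ratio r ‖y‖ * |F y|) (𝓝[>] 0) (𝓝 (∫ _ : E4, (0 : ℝ))) := by
    refine tendsto_integral_filter_of_dominated_convergence (fun y => |F y|) ?_ ?_ hF.abs ?_
    · filter_upwards [self_mem_nhdsWithin] with r hr
      exact (integrable_ratio_mul hF hr).1
    · filter_upwards [self_mem_nhdsWithin] with r (hr : 0 < r)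
      refine .of_forall fun y => ?_
      rw [norm_mul, Real.norm_of_nonneg (ratio_nonneg hr.le (norm_nonneg y)), Real.norm_eq_abs,
        abs_abs]
      exact mul_le_of_le_one_left (abs_nonneg _) (ratio_le_one' hr (norm_nonneg y))
    · refine .of_forall fun y => ?_
      have h1 : Tendsto (fun r : ℝ => r / ‖y‖ * |F y|) (𝓝[>] 0) (𝓝 0) := by
        have : Continuous fun r : ℝ => r / ‖y‖ * |F y| := by fun_prop
        simpa using (this.tendsto 0).mono_left nhdsWithin_le_nhds
      refine squeeze_zero' ?_ ?_ h1
      · filter_upwards [self_mem_nhdsWithin] with r (hr : 0 < r)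
        exact mul_nonneg (ratio_nonneg hr.le (norm_nonneg y)) (abs_nonneg _)
      · exact .of_forall fun r => mul_le_mul_of_nonneg_right (min_le_left _ _) (abs_nonneg _)
  have h2 := h.const_mul (8 * Real.pi ^ 2)⁻¹
  rw [integral_zero, mul_zero] at h2
  exact h2

/-- The truncation removes the singularity of log‖y‖ at the origin, and F vanishes for large ‖y‖, so
the factor is bounded where it matters. -/
theorem integrable_min_mul (hF : Integrable F) (hR : ∀ y, R < ‖y‖ → F y = 0) :
    Integrable fun y => min 0 (Real.log r - Real.log ‖y‖) * F y := by
  have hm : Measurable fun y : E4 => min 0 (Real.log r - Real.log ‖y‖) := by fun_prop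
  refine (hF.abs.const_mul (|Real.log R - Real.log r| + |Real.log r|)).mono'
    (hm.aestronglyMeasurable.mul hF.1) (.of_forall fun y => ?_)
  by_cases hy : R < ‖y‖
  · simp [hR y hy]
  rw [norm_mul, Real.norm_eq_abs, Real.norm_eq_abs]
  refine mul_le_mul_of_nonneg_right ?_ (abs_nonneg _)
  rcases le_total 0 (Real.log r - Real.log ‖y‖) with h | h
  · rw [min_eq_left h, abs_zero]; positivity
  rw [min_eq_right h, abs_of_nonpos h]
  -- At y = 0 the convention log 0 = 0 may leave log r behind; this is why |log r| appears in the
  -- bound.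
  rcases (norm_nonneg y).eq_or_lt with h0 | h0
  · rw [← h0, Real.log_zero]
    linarith [abs_nonneg (Real.log R - Real.log r), neg_abs_le (Real.log r),
      le_abs_self (Real.log r)]
  · linarith [Real.log_le_log h0 (not_lt.1 hy), le_abs_self (Real.log R - Real.log r),
      abs_nonneg (Real.log r)]

/-- `W` is the logarithmic potential of the compactly supported density `F`. -/
structure IsPotential (W F : E4 → ℝ) (R : ℝ) : Prop where
  integrable : Integrable F
  eq_zero : ∀ y, R < ‖y‖ → F y = 0
  continuousOn : ContinuousOn W {0}ᶜ
  integrable_kernel : ∀ x, x ≠ 0 → Integrable fun y => logKernel x y * F y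
  eq_integral : ∀ x, x ≠ 0 → ∫ y, logKernel x y * F y = 8 * Real.pi ^ 2 * W x

variable {x : E4}

theorem IsPotential.integrable_devKernel (h : IsPotential W F R) (hx : x ≠ 0) :
    Integrable fun y => devKernel x y * F y := by
  have h1 := integrable_min_mul h.integrable h.eq_zero (r := ‖x‖)
  refine ((h.integrable_kernel x hx).sub h1).congr (.of_forall fun y => ?_)
  simp only [Pi.sub_apply, devKernel]
  ring

theorem IsPotential.integral_devKernel (h : IsPotential W F R) (hx : x ≠ 0) :
    (8 * Real.pi ^ 2)⁻¹ * ∫ y, devKernel x y * F y = W x - radialPot F ‖x‖ := by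
  have h1 := integrable_min_mul h.integrable h.eq_zero (r := ‖x‖)
  have h2 : ∫ y, devKernel x y * F y = (∫ y, logKernel x y * F y) -
      ∫ y, min 0 (Real.log ‖x‖ - Real.log ‖y‖) * F y := by
    rw [← integral_sub (h.integrable_kernel x hx) h1]
    refine integral_congr_ae (.of_forall fun y => ?_)
    simp only [devKernel]
    ring
  rw [h2, h.eq_integral x hx, radialPot, mul_sub, inv_mul_cancel_left₀ (by positivity)]

theorem IsPotential.abs_sub_radialPot_le (h : IsPotential W F R) (hx : x ≠ 0) :
    |W x - radialPot F ‖x‖| ≤ (8 * Real.pi ^ 2)⁻¹ * ∫ y, |devKernel x y| * |F y| := by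
  rw [← h.integral_devKernel hx, abs_mul, abs_of_pos (by positivity : 0 < (8 * Real.pi ^ 2)⁻¹)]
  refine mul_le_mul_of_nonneg_left ?_ (by positivity)
  simpa only [abs_mul] using abs_integral_le_integral_abs (f := fun y => devKernel x y * F y)

theorem measurable_devKernel : Measurable fun p : E4 × E4 => devKernel p.1 p.2 := by
  unfold devKernel logKernel
  fun_prop

theorem ae_ne_zero : ∀ᵐ y : E4, y ≠ 0 := by
  simp [ae_iff]

/-- The density of the measure to which Jensen's inequality is applied. -/
def jensenWeight (F : E4 → ℝ) (q r : ℝ) (y : E4) : ℝ :=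
  4 * q * (8 * Real.pi ^ 2)⁻¹ * (ratio r ‖y‖ * |F y|)

theorem jensenWeight_nonneg (hq : 0 ≤ q) (hr : 0 < r) (y : E4) : 0 ≤ jensenWeight F q r y := by
  unfold jensenWeight
  exact mul_nonneg (by positivity) (mul_nonneg (ratio_nonneg hr.le (norm_nonneg y)) (abs_nonneg _))

theorem integrable_jensenWeight (hF : Integrable F) (hr : 0 < r) :
    Integrable (jensenWeight F q r) := by
  unfold jensenWeight
  exact (integrable_ratio_mul hF hr).const_mul _

theorem integral_jensenWeight : ∫ y, jensenWeight F q r y = 4 * q * interaction F r := by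
  unfold jensenWeight interaction
  rw [integral_const_mul, mul_assoc (4 * q)]

/-- The exponent controlled by `exists_lintegral_exp_devKernel_le`. -/
def devExponent (x y : E4) : ℝ := |devKernel x y| / (4 * ratio ‖x‖ ‖y‖)

theorem measurable_devExponent : Measurable fun p : E4 × E4 => devExponent p.1 p.2 := by
  unfold devExponent ratio
  refine Measurable.div (continuous_abs.measurable.comp measurable_devKernel) ?_
  fun_prop

theorem measurable_devExponent_right (x : E4) : Measurable (devExponent x) := by
  unfold devExponent devKernel logKernel ratio
  fun_prop

theorem jensenWeight_mul_devExponent (hx : 0 < ‖x‖) : ∀ᵐ y : E4,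
    jensenWeight F q ‖x‖ y * devExponent x y =
      q * (8 * Real.pi ^ 2)⁻¹ * (|devKernel x y| * |F y|) := by
  filter_upwards [ae_ne_zero] with y hy
  have := (ratio_pos hx (norm_pos_iff.2 hy)).ne'
  rw [jensenWeight, devExponent]
  field_simp

/-- The ratio in `jensenWeight` cancels the one dividing `devExponent`, so q|W - P| is at most the
weighted integral of an exponent with uniformly controlled exponential. The hypothesis `hm` says the
weight has mass at most 1. -/
theorem IsPotential.ofReal_exp_le (h : IsPotential W F R) (hq : 0 ≤ q)
    (hm : 4 * q * interaction F ‖x‖ ≤ 1) (hx : x ≠ 0) :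
    ENNReal.ofReal (Real.exp (q * |W x - radialPot F ‖x‖|)) ≤
      1 + ∫⁻ y, ENNReal.ofReal (jensenWeight F q ‖x‖ y) *
        ENNReal.ofReal (Real.exp (devExponent x y)) := by
  have hr : 0 < ‖x‖ := norm_pos_iff.2 hx
  have hae := jensenWeight_mul_devExponent (F := F) (q := q) hr
  have hi : Integrable fun y => |devKernel x y| * |F y| := by
    simpa only [abs_mul] using (h.integrable_devKernel hx).abs
  have hi2 : Integrable fun y => jensenWeight F q ‖x‖ y * devExponent x y :=
    (hi.const_mul _).congr (hae.mono fun y hy => hy.symm)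
  have h1 : ∫ y, jensenWeight F q ‖x‖ y ≤ 1 := integral_jensenWeight.trans_le hm
  have hJ := ofReal_exp_integral_le (μ := (volume : Measure E4)) (h := jensenWeight F q ‖x‖)
    (f := devExponent x) (.of_forall (jensenWeight_nonneg hq hr))
    (integrable_jensenWeight h.integrable hr) hi2 (measurable_devExponent_right x).aemeasurable h1
  have h2 : ∫ y, jensenWeight F q ‖x‖ y * devExponent x y =
      q * ((8 * Real.pi ^ 2)⁻¹ * ∫ y, |devKernel x y| * |F y|) := by
    rw [integral_congr_ae hae, integral_const_mul, mul_assoc]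
  have h3 : q * |W x - radialPot F ‖x‖| ≤ ∫ y, jensenWeight F q ‖x‖ y * devExponent x y := by
    rw [h2]
    exact mul_le_mul_of_nonneg_left (h.abs_sub_radialPot_le hx) hq
  exact (ENNReal.ofReal_le_ofReal (Real.exp_le_exp.2 h3)).trans hJ

theorem IsPotential.lintegral_exp_le (h : IsPotential W F R) (hq : 0 ≤ q) (hr : 0 < r)
    (hm : 4 * q * interaction F r ≤ 1) {M : ENNReal}
    (hM : ∀ y : E4, y ≠ 0 → ∫⁻ θ : Sph,
      ENNReal.ofReal (Real.exp (devExponent (r • (θ : E4)) y)) ∂sigma ≤ M) :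
    ∫⁻ θ : Sph, ENNReal.ofReal (Real.exp (q * |W (r • (θ : E4)) - radialPot F r|)) ∂sigma ≤
      sigma univ + ENNReal.ofReal (4 * q * interaction F r) * M := by
  have hc : Continuous fun p : Sph × E4 => (r • (p.1 : E4), p.2) := by fun_prop
  have hmk : Measurable fun p : Sph × E4 =>
      ENNReal.ofReal (Real.exp (devExponent (r • (p.1 : E4)) p.2)) :=
    (measurable_devExponent.comp hc.measurable).exp.ennreal_ofReal
  have hw := integrable_jensenWeight (q := q) h.integrable hr
  have hwm : AEMeasurable fun y => ENNReal.ofReal (jensenWeight F q r y) :=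
    hw.1.aemeasurable.ennreal_ofReal
  have hsw : AEMeasurable (Function.uncurry fun (θ : Sph) (y : E4) =>
      ENNReal.ofReal (jensenWeight F q r y) *
        ENNReal.ofReal (Real.exp (devExponent (r • (θ : E4)) y))) (sigma.prod volume) :=
    hwm.comp_snd.mul hmk.aemeasurable
  calc _ ≤ ∫⁻ θ : Sph, (1 + ∫⁻ y, ENNReal.ofReal (jensenWeight F q r y) * ENNReal.ofReal
          (Real.exp (devExponent (r • (θ : E4)) y))) ∂sigma := by
        refine lintegral_mono fun θ => ?_
        have hx : ‖r • (θ : E4)‖ = r := norm_smul_sphere hr.le θ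
        have := h.ofReal_exp_le (x := r • (θ : E4)) hq (by rwa [hx])
          (norm_pos_iff.1 (by rwa [hx]))
        rwa [hx] at this
    _ = sigma univ + ∫⁻ y, ENNReal.ofReal (jensenWeight F q r y) * ∫⁻ θ : Sph, ENNReal.ofReal
          (Real.exp (devExponent (r • (θ : E4)) y)) ∂sigma := by
        rw [lintegral_add_left measurable_const, lintegral_const, one_mul,
          lintegral_lintegral_swap hsw]
        congr 2 with y
        exact lintegral_const_mul' _ _ ENNReal.ofReal_ne_top
    _ ≤ sigma univ + ∫⁻ y, ENNReal.ofReal (jensenWeight F q r y) * M := by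
        refine add_le_add le_rfl (lintegral_mono_ae ?_)
        filter_upwards [ae_ne_zero] with y hy
        exact mul_le_mul_right (hM y hy) _
    _ = _ := by
        rw [lintegral_mul_const'' _ hwm, ← ofReal_integral_eq_lintegral_ofReal hw
          (.of_forall (jensenWeight_nonneg hq hr)), integral_jensenWeight]

theorem IsPotential.continuous_sphere (h : IsPotential W F R) (hr : 0 < r) :
    Continuous fun θ : Sph => W (r • (θ : E4)) := by
  refine h.continuousOn.comp_continuous (by fun_prop) fun θ => ?_
  rw [mem_compl_singleton_iff, ← norm_pos_iff, norm_smul_sphere hr.le]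
  exact hr

theorem integrable_of_continuous_sphere {g : Sph → ℝ} (hg : Continuous g) :
    Integrable g sigma :=
  hg.integrable_of_hasCompactSupport (HasCompactSupport.of_compactSpace g)

/-- After Fubini the integral of e^{q|W-P|} exceeds the sphere's area by at most a constant times
the interaction, which tends to 0. This upper bound also yields the lower one. -/
theorem IsPotential.tendsto_integral_exp (h : IsPotential W F R) (hq : 0 ≤ q) :
    Tendsto (fun r => ∫ θ : Sph, Real.exp (q * (W (r • (θ : E4)) - radialPot F r)) ∂sigma)
      (𝓝[>] 0) (𝓝 (2 * Real.pi ^ 2)) := by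
  obtain ⟨M, hMt, hM⟩ := exists_lintegral_exp_devKernel_le
  have hint := tendsto_interaction h.integrable
  have hlim : Tendsto (fun r => 4 * q * interaction F r) (𝓝[>] 0) (𝓝 0) := by
    simpa using hint.const_mul (4 * q)
  have hlim2 : Tendsto (fun r => 4 * q * interaction F r * M.toReal) (𝓝[>] 0) (𝓝 0) := by
    simpa using hlim.mul_const M.toReal
  rw [tendsto_iff_norm_sub_tendsto_zero]
  refine squeeze_zero' (.of_forall fun _ => norm_nonneg _) ?_ hlim2
  filter_upwards [self_mem_nhdsWithin, hlim.eventually_le_const one_pos] with r (hr : 0 < r) hr1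
  have hc : Continuous fun θ : Sph => q * (W (r • (θ : E4)) - radialPot F r) :=
    continuous_const.mul ((h.continuous_sphere hr).sub continuous_const)
  have hca : Continuous fun θ : Sph => Real.exp (q * |W (r • (θ : E4)) - radialPot F r|) :=
    Real.continuous_exp.comp
      (continuous_const.mul ((h.continuous_sphere hr).sub continuous_const).abs)
  have i1 := integrable_of_continuous_sphere hc.rexp
  have i2 := integrable_of_continuous_sphere hca
  have i3 : Integrable (fun _ : Sph => (2 : ℝ)) sigma := integrable_const _
  have hi0 : 0 ≤ interaction F r := mul_nonneg (by positivity) (integral_nonneg fun y =>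
    mul_nonneg (ratio_nonneg hr.le (norm_nonneg y)) (abs_nonneg _))
  have hbd : ∫ θ : Sph, Real.exp (q * |W (r • (θ : E4)) - radialPot F r|) ∂sigma ≤
      2 * Real.pi ^ 2 + 4 * q * interaction F r * M.toReal := by
    have h1 := h.lintegral_exp_le hq hr hr1 (M := M) fun y hy => by
      simpa only [devExponent, norm_smul_sphere hr.le] using hM r hr y hy
    rw [← ofReal_integral_eq_lintegral_ofReal i2 (.of_forall fun _ => (Real.exp_pos _).le)] at h1
    have h2 := ENNReal.toReal_mono (ENNReal.add_ne_top.2 ⟨measure_ne_top _ _,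
      ENNReal.mul_ne_top ENNReal.ofReal_ne_top hMt⟩) h1
    rw [ENNReal.toReal_ofReal (integral_nonneg fun _ => (Real.exp_pos _).le),
      ENNReal.toReal_add (measure_ne_top _ _) (ENNReal.mul_ne_top ENNReal.ofReal_ne_top hMt),
      ENNReal.toReal_mul, ENNReal.toReal_ofReal (by positivity)] at h2
    rwa [← sigma_real_univ]
  have hup : ∫ θ : Sph, Real.exp (q * (W (r • (θ : E4)) - radialPot F r)) ∂sigma ≤
      ∫ θ : Sph, Real.exp (q * |W (r • (θ : E4)) - radialPot F r|) ∂sigma := by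
    refine integral_mono i1 i2 fun θ => Real.exp_le_exp.2 ?_
    exact mul_le_mul_of_nonneg_left (le_abs_self _) hq
  -- From e^u + e^{|u|} ≥ e^u + e^{-u} ≥ 2.
  have hlo : ∫ θ : Sph, (2 - Real.exp (q * |W (r • (θ : E4)) - radialPot F r|)) ∂sigma ≤
      ∫ θ : Sph, Real.exp (q * (W (r • (θ : E4)) - radialPot F r)) ∂sigma := by
    refine integral_mono (i3.sub i2) i1 fun θ => ?_
    set t := W (r • (θ : E4)) - radialPot F r
    have h1 := Real.add_one_le_exp (q * t)
    have h2 := Real.add_one_le_exp (-(q * t))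
    have h3 : Real.exp (-(q * t)) ≤ Real.exp (q * |t|) := Real.exp_le_exp.2 (by
      nlinarith [neg_abs_le t])
    change 2 - Real.exp (q * |t|) ≤ Real.exp (q * t)
    linarith
  rw [integral_sub i3 i2, integral_const, sigma_real_univ, smul_eq_mul] at hlo
  rw [Real.norm_eq_abs, abs_le]
  constructor <;> linarith

end deviation

/-! ### Volume asymptotics at the origin -/

theorem sphMean_indicator_ball (g : E4 → ℝ) {r s : ℝ} (hs : 0 < s) :
    sphMean ((Metric.ball (0 : E4) r).indicator g) s = (Iio r).indicator (sphMean g) s := by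
  have h : ∀ θ : Sph, s • (θ : E4) ∈ Metric.ball (0 : E4) r ↔ s ∈ Iio r := fun θ => by
    rw [mem_ball_zero_iff, norm_smul_sphere hs.le, mem_Iio]
  by_cases hsr : s ∈ Iio r
  · simp only [sphMean, indicator_of_mem ((h _).2 hsr), indicator_of_mem hsr]
  · simp only [sphMean, indicator_of_notMem (fun h' => hsr ((h _).1 h')), indicator_of_notMem hsr,
      integral_zero]

theorem integrableOn_ball_polar {g : E4 → ℝ} {r : ℝ}
    (hg : IntegrableOn g (Metric.ball (0 : E4) r)) :
    IntegrableOn (fun s => s ^ 3 * sphMean g s) (Ioo 0 r) ∧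
      ∫ x in Metric.ball (0 : E4) r, g x = ∫ s in Ioo 0 r, s ^ 3 * sphMean g s := by
  have hi := (integrable_indicator_iff measurableSet_ball).2 hg
  have heq : EqOn (fun s => s ^ 3 * sphMean ((Metric.ball (0 : E4) r).indicator g) s)
      ((Iio r).indicator fun s => s ^ 3 * sphMean g s) (Ioi 0) := fun s hs => by
    simp only
    rw [sphMean_indicator_ball g hs]
    by_cases hsr : s ∈ Iio r <;> simp [hsr]
  constructor
  · have h := (integrableOn_congr_fun heq measurableSet_Ioi).1 (integrableOn_polar hi)
    rw [IntegrableOn, integrable_indicator_iff measurableSet_Iio, IntegrableOn,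
      Measure.restrict_restrict measurableSet_Iio, inter_comm, Ioi_inter_Iio] at h
    exact h
  · rw [← integral_indicator measurableSet_ball, integral_polar hi,
      setIntegral_congr_fun measurableSet_Ioi heq, integral_indicator measurableSet_Iio,
      Measure.restrict_restrict measurableSet_Iio, inter_comm, Ioi_inter_Iio]

theorem integral_Ioo_rpow {p r : ℝ} (hp : -1 < p) (hr : 0 < r) :
    ∫ s in Ioo 0 r, s ^ p = r ^ (p + 1) / (p + 1) := by
  rw [← integral_Ioc_eq_integral_Ioo, ← intervalIntegral.integral_of_le hr.le,
    integral_rpow (Or.inl hp), Real.zero_rpow (by linarith), sub_zero]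

section radial

variable {W F : E4 → ℝ} {R r s η q : ℝ}

/-- The total mass of `F` in units of `8π²`. -/
def totalMass (F : E4 → ℝ) : ℝ := (8 * Real.pi ^ 2)⁻¹ * ∫ y, F y

/-- The mass of `|F|` in the ball of radius `r`. -/
def localMass (F : E4 → ℝ) (r : ℝ) : ℝ :=
  (8 * Real.pi ^ 2)⁻¹ * ∫ y in Metric.ball (0 : E4) r, |F y|

theorem tendsto_localMass (hF : Integrable F) : Tendsto (localMass F) (𝓝[>] 0) (𝓝 0) := by
  have h : Tendsto (fun r => ∫ y, (Metric.ball (0 : E4) r).indicator (fun y => |F y|) y) (𝓝[>] 0)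
      (𝓝 (∫ _ : E4, (0 : ℝ))) := by
    refine tendsto_integral_filter_of_dominated_convergence (fun y => |F y|) ?_ ?_ hF.abs ?_
    · exact .of_forall fun r => (hF.abs.indicator measurableSet_ball).1
    · refine .of_forall fun r => .of_forall fun y => ?_
      simpa using norm_indicator_le_norm_self (fun y => |F y|) y
    · filter_upwards [ae_ne_zero] with y hy
      refine tendsto_const_nhds.congr' ?_
      filter_upwards [Ioo_mem_nhdsGT (norm_pos_iff.2 hy)] with r hr
      rw [indicator_of_notMem]
      rw [mem_ball_zero_iff, not_lt]
      exact hr.2.le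
  have h2 := h.const_mul (8 * Real.pi ^ 2)⁻¹
  rw [integral_zero, mul_zero] at h2
  simp only [integral_indicator measurableSet_ball] at h2
  exact h2

/-- For ‖y‖ ≥ r the two truncated logarithms differ by exactly log(r/s), and for ‖y‖ < r the
discrepancy is at most log(r/s). Only the mass inside the ball of radius r contributes to the error.
-/
theorem IsPotential.abs_radialPot_sub_le (h : IsPotential W F R) (hs : 0 < s) (hsr : s < r) :
    |radialPot F r - radialPot F s - totalMass F * Real.log (r / s)| ≤
      localMass F r * Real.log (r / s) := by
  have hr := hs.trans hsr
  have hlog : Real.log (r / s) = Real.log r - Real.log s := Real.log_div hr.ne' hs.ne'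
  have hl0 : 0 < Real.log r - Real.log s := sub_pos.2 (Real.log_lt_log hs hsr)
  have i1 := integrable_min_mul h.integrable h.eq_zero (r := r)
  have i2 := integrable_min_mul h.integrable h.eq_zero (r := s)
  have i3 := h.integrable.mul_const (Real.log r - Real.log s)
  have i12 : Integrable fun y => min 0 (Real.log r - Real.log ‖y‖) * F y -
    min 0 (Real.log s - Real.log ‖y‖) * F y := i1.sub i2
  have e : radialPot F r - radialPot F s - totalMass F * Real.log (r / s) =
      (8 * Real.pi ^ 2)⁻¹ * ∫ y, (min 0 (Real.log r - Real.log ‖y‖) * F y -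
        min 0 (Real.log s - Real.log ‖y‖) * F y - F y * (Real.log r - Real.log s)) := by
    rw [integral_sub i12 i3, integral_sub i1 i2, integral_mul_const, radialPot, radialPot,
      totalMass, hlog]
    ring
  rw [e, abs_mul, abs_of_pos (by positivity : 0 < (8 * Real.pi ^ 2)⁻¹), localMass, mul_assoc]
  refine mul_le_mul_of_nonneg_left ?_ (by positivity)
  rw [← integral_mul_const, ← integral_indicator measurableSet_ball]
  refine (abs_integral_le_integral_abs).trans (integral_mono_ae (i12.sub i3).abs
    ((h.integrable.abs.mul_const _).indicator measurableSet_ball) ?_)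
  filter_upwards [ae_ne_zero] with y hy
  have hy0 := norm_pos_iff.2 hy
  rw [← sub_mul, mul_comm (F y), ← sub_mul, abs_mul]
  by_cases hyr : ‖y‖ < r
  · rw [indicator_of_mem (mem_ball_zero_iff.2 hyr), mul_comm, hlog]
    refine mul_le_mul_of_nonneg_left ?_ (abs_nonneg _)
    have h1 := Real.log_lt_log hy0 hyr
    rw [min_eq_left (by linarith), abs_le]
    rcases le_total 0 (Real.log s - Real.log ‖y‖) with h2 | h2
    · rw [min_eq_left h2]; constructor <;> linarith
    · rw [min_eq_right h2]; constructor <;> linarith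
  · rw [indicator_of_notMem (by rwa [mem_ball_zero_iff])]
    have h1 := Real.log_le_log hr (not_lt.1 hyr)
    rw [min_eq_right (by linarith), min_eq_right (by linarith)]
    simp

theorem IsPotential.exp_radialPot_le (h : IsPotential W F R) (hs : 0 < s) (hsr : s < r)
    (hη : localMass F r ≤ η) :
    Real.exp (4 * radialPot F s) ≤
      Real.exp (4 * radialPot F r) * (s / r) ^ (4 * (totalMass F - η)) := by
  have hr := hs.trans hsr
  have h1 := (abs_le.1 (h.abs_radialPot_sub_le hs hsr)).1
  have hl0 : 0 < Real.log (r / s) := Real.log_pos ((one_lt_div hs).2 hsr)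
  rw [Real.rpow_def_of_pos (div_pos hs hr), ← Real.exp_add, Real.exp_le_exp, ← inv_div r s,
    Real.log_inv]
  nlinarith

theorem IsPotential.le_exp_radialPot (h : IsPotential W F R) (hs : 0 < s) (hsr : s < r)
    (hη : localMass F r ≤ η) :
    Real.exp (4 * radialPot F r) * (s / r) ^ (4 * (totalMass F + η)) ≤
      Real.exp (4 * radialPot F s) := by
  have hr := hs.trans hsr
  have h1 := (abs_le.1 (h.abs_radialPot_sub_le hs hsr)).2
  have hl0 : 0 < Real.log (r / s) := Real.log_pos ((one_lt_div hs).2 hsr)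
  rw [Real.rpow_def_of_pos (div_pos hs hr), ← Real.exp_add, Real.exp_le_exp, ← inv_div r s,
    Real.log_inv]
  nlinarith

/-- The spherical average of `exp (q (W - radialPot F))`. -/
def expMean (W F : E4 → ℝ) (q r : ℝ) : ℝ :=
  ∫ θ : Sph, Real.exp (q * (W (r • (θ : E4)) - radialPot F r)) ∂sigma

theorem sphMean_exp_eq (W F : E4 → ℝ) (q r : ℝ) :
    sphMean (fun x => Real.exp (q * W x)) r = Real.exp (q * radialPot F r) * expMean W F q r := by
  rw [sphMean, expMean, ← integral_const_mul]
  refine integral_congr_ae (.of_forall fun θ => ?_)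
  simp only
  rw [← Real.exp_add]
  ring_nf

theorem pow_mul_rpow_div {p : ℝ} (hs : 0 < s) (hr : 0 < r) :
    s ^ 3 * (s / r) ^ p = r ^ (-p) * s ^ (3 + p) := by
  rw [Real.div_rpow hs.le hr.le, Real.rpow_neg hr.le, Real.rpow_add hs,
    show (3 : ℝ) = ((3 : ℕ) : ℝ) by norm_num, Real.rpow_natCast]
  field_simp

theorem IsPotential.ballVol_le (h : IsPotential W F R) {C : ℝ} (hr : 0 < r)
    (hI : IntegrableOn (fun x => Real.exp (4 * W x)) (Metric.ball (0 : E4) r))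
    (hη : localMass F r ≤ η) (hβ : 0 < 1 + totalMass F - η)
    (hB : ∀ s ∈ Ioo 0 r, expMean W F 4 s ≤ C) :
    ballVol W r ≤ r ^ 4 * Real.exp (4 * radialPot F r) * C / (4 * (1 + totalMass F - η)) := by
  obtain ⟨hi, he⟩ := integrableOn_ball_polar hI
  set p := 4 * (totalMass F - η) with hp
  have hp1 : -1 < 3 + p := by linarith
  have hi2 : IntegrableOn (fun s => Real.exp (4 * radialPot F r) * C * r ^ (-p) * s ^ (3 + p))
      (Ioo 0 r) := (((intervalIntegral.integrableOn_Ioo_rpow_iff hr).2 hp1).const_mul _)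
  rw [ballVol, he]
  refine (setIntegral_mono_on hi hi2 measurableSet_Ioo fun s hs => ?_).trans_eq ?_
  · rw [sphMean_exp_eq W F]
    have h1 := h.exp_radialPot_le hs.1 hs.2 hη
    calc s ^ 3 * (Real.exp (4 * radialPot F s) * expMean W F 4 s)
        ≤ s ^ 3 * ((Real.exp (4 * radialPot F r) * (s / r) ^ p) * C) := by
          refine mul_le_mul_of_nonneg_left (mul_le_mul h1 (hB s hs) ?_ ?_) (pow_pos hs.1 3).le
          · exact integral_nonneg fun _ => (Real.exp_pos _).le
          · exact mul_nonneg (Real.exp_pos _).le (Real.rpow_nonneg (div_pos hs.1 hr).le _)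
      _ = Real.exp (4 * radialPot F r) * C * (s ^ 3 * (s / r) ^ p) := by ring
      _ = _ := by rw [pow_mul_rpow_div hs.1 hr]; ring
  · rw [integral_const_mul, integral_Ioo_rpow hp1 hr,
      show 4 * (1 + totalMass F - η) = 3 + p + 1 by rw [hp]; ring,
      show 3 + p + 1 = ((4 : ℕ) : ℝ) + p by push_cast; ring, Real.rpow_add hr, Real.rpow_natCast,
      Real.rpow_neg hr.le]
    have := (Real.rpow_pos_of_pos hr p).ne'
    field_simp

/-- Positivity of 1 + m + η is a conclusion: finite volume makes the comparison power of s
integrable at 0, which forces its exponent above -1. -/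
theorem IsPotential.le_ballVol (h : IsPotential W F R) {C : ℝ} (hC : 0 < C) (hr : 0 < r)
    (hI : IntegrableOn (fun x => Real.exp (4 * W x)) (Metric.ball (0 : E4) r))
    (hη : localMass F r ≤ η) (hB : ∀ s ∈ Ioo 0 r, C ≤ expMean W F 4 s) :
    0 < 1 + totalMass F + η ∧
    r ^ 4 * Real.exp (4 * radialPot F r) * C / (4 * (1 + totalMass F + η)) ≤ ballVol W r := by
  obtain ⟨hi, he⟩ := integrableOn_ball_polar hI
  set p := 4 * (totalMass F + η) with hp
  set c := Real.exp (4 * radialPot F r) * C * r ^ (-p) with hc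
  have hc0 : 0 < c := mul_pos (mul_pos (Real.exp_pos _) hC) (Real.rpow_pos_of_pos hr _)
  have hle : ∀ s ∈ Ioo 0 r, c * s ^ (3 + p) ≤
      s ^ 3 * sphMean (fun x => Real.exp (4 * W x)) s := by
    intro s hs
    rw [sphMean_exp_eq W F]
    have h1 := h.le_exp_radialPot hs.1 hs.2 hη
    calc c * s ^ (3 + p) = Real.exp (4 * radialPot F r) * C * (s ^ 3 * (s / r) ^ p) := by
          rw [pow_mul_rpow_div hs.1 hr]; ring
      _ = s ^ 3 * ((Real.exp (4 * radialPot F r) * (s / r) ^ p) * C) := by ring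
      _ ≤ _ := mul_le_mul_of_nonneg_left (mul_le_mul h1 (hB s hs) hC.le (Real.exp_pos _).le)
        (pow_pos hs.1 3).le
  have hi2 : IntegrableOn (fun s => c * s ^ (3 + p)) (Ioo 0 r) := by
    refine hi.mono' (by fun_prop) ((ae_restrict_iff' measurableSet_Ioo).2 (.of_forall fun s hs => ?_))
    rw [Real.norm_of_nonneg (mul_nonneg hc0.le (Real.rpow_nonneg hs.1.le _))]
    exact hle s hs
  have hi3 : IntegrableOn (fun s : ℝ => s ^ (3 + p)) (Ioo 0 r) :=
    (hi2.const_mul c⁻¹).congr (.of_forall fun s => inv_mul_cancel_left₀ hc0.ne' _)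
  have hp1 : -1 < 3 + p := (intervalIntegral.integrableOn_Ioo_rpow_iff hr).1 hi3
  have hβ : 0 < 1 + totalMass F + η := by linarith
  refine ⟨hβ, ?_⟩
  rw [ballVol, he]
  refine le_trans (le_of_eq ?_) (setIntegral_mono_on hi2 hi measurableSet_Ioo hle)
  rw [integral_const_mul, integral_Ioo_rpow hp1 hr,
      show 4 * (1 + totalMass F + η) = 3 + p + 1 by rw [hp]; ring,
      show 3 + p + 1 = ((4 : ℕ) : ℝ) + p by push_cast; ring, Real.rpow_add hr, Real.rpow_natCast,
      hc, Real.rpow_neg hr.le]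
  have := (Real.rpow_pos_of_pos hr p).ne'
  field_simp

/-- Squeeze between the two power-law comparisons with a common ε for the local mass and for the
deviation of the spherical means, then let ε → 0. -/
theorem IsPotential.tendsto_div_ballVol (h : IsPotential W F R) (hs : 0 < s)
    (hI : IntegrableOn (fun x => Real.exp (4 * W x)) (Metric.ball (0 : E4) s)) :
    Tendsto (fun r => r ^ 4 * Real.exp (4 * radialPot F r) / ballVol W r) (𝓝[>] 0)
      (𝓝 (4 * (1 + totalMass F) / (2 * Real.pi ^ 2))) := by
  set β := 1 + totalMass F with hβ
  have hπ : 0 < 2 * Real.pi ^ 2 := by positivity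
  have key : ∀ ε, 0 < ε → ε < 2 * Real.pi ^ 2 → ∀ᶠ r in 𝓝[>] 0,
      4 * (β - ε) / (2 * Real.pi ^ 2 + ε) ≤ r ^ 4 * Real.exp (4 * radialPot F r) / ballVol W r ∧
      r ^ 4 * Real.exp (4 * radialPot F r) / ballVol W r ≤ 4 * (β + ε) / (2 * Real.pi ^ 2 - ε) := by
    intro ε hε hε2
    have hm := (tendsto_localMass h.integrable).eventually_le_const hε
    have hB := h.tendsto_integral_exp (q := 4) (by norm_num)
    have hB2 := hB.eventually (Icc_mem_nhds (sub_lt_self _ hε) (lt_add_of_pos_right _ hε))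
    obtain ⟨δ, hδ, hδB⟩ := mem_nhdsGT_iff_exists_Ioo_subset.1 hB2
    filter_upwards [hm, Ioo_mem_nhdsGT (show 0 < min s δ from lt_min hs hδ)] with r hr1 hr2
    have hr := hr2.1
    have hIr := hI.mono_set (Metric.ball_subset_ball (hr2.2.trans_le (min_le_left s δ)).le)
    have hBr : ∀ t ∈ Ioo 0 r, expMean W F 4 t ∈
        Icc (2 * Real.pi ^ 2 - ε) (2 * Real.pi ^ 2 + ε) := fun t ht =>
      hδB ⟨ht.1, ht.2.trans (hr2.2.trans_le (min_le_right s δ))⟩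
    have hN : 0 < r ^ 4 * Real.exp (4 * radialPot F r) := mul_pos (pow_pos hr 4) (Real.exp_pos _)
    obtain ⟨hpos, hlow⟩ := h.le_ballVol (sub_pos.2 hε2) hr hIr hr1 fun t ht => (hBr t ht).1
    rw [← hβ] at hpos hlow
    have hv : 0 < ballVol W r := lt_of_lt_of_le
      (div_pos (mul_pos hN (sub_pos.2 hε2)) (by positivity)) hlow
    constructor
    -- If β - ε ≤ 0 the lower bound is nonpositive and needs no upper estimate of the volume. This
    -- covers the borderline β = 0.
    · rcases le_or_gt (β - ε) 0 with hb | hb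
      · exact (div_nonpos_of_nonpos_of_nonneg (by linarith) (by linarith)).trans
          (div_pos hN hv).le
      · have hup := h.ballVol_le hr hIr hr1 hb fun t ht => (hBr t ht).2
        rw [← hβ, le_div_iff₀ (by linarith)] at hup
        rw [div_le_div_iff₀ (by linarith) hv]
        linarith
    · rw [div_le_iff₀ (by linarith)] at hlow
      rw [div_le_div_iff₀ hv (by linarith)]
      linarith
  have c1 : Tendsto (fun ε : ℝ => 4 * (β - ε) / (2 * Real.pi ^ 2 + ε)) (𝓝[>] 0)
      (𝓝 (4 * β / (2 * Real.pi ^ 2))) := by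
    have : ContinuousAt (fun ε : ℝ => 4 * (β - ε) / (2 * Real.pi ^ 2 + ε)) 0 :=
      ContinuousAt.div (by fun_prop) (by fun_prop) (by simp)
    simpa using this.tendsto.mono_left nhdsWithin_le_nhds
  have c2 : Tendsto (fun ε : ℝ => 4 * (β + ε) / (2 * Real.pi ^ 2 - ε)) (𝓝[>] 0)
      (𝓝 (4 * β / (2 * Real.pi ^ 2))) := by
    have : ContinuousAt (fun ε : ℝ => 4 * (β + ε) / (2 * Real.pi ^ 2 - ε)) 0 :=
      ContinuousAt.div (by fun_prop) (by fun_prop) (by simp)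
    simpa using this.tendsto.mono_left nhdsWithin_le_nhds
  rw [tendsto_order]
  constructor
  · intro a ha
    obtain ⟨ε, h1, h2⟩ := ((c1.eventually_const_lt ha).and (Ioo_mem_nhdsGT hπ)).exists
    filter_upwards [key ε h2.1 h2.2] with r hr using h1.trans_le hr.1
  · intro a ha
    obtain ⟨ε, h1, h2⟩ := ((c2.eventually_lt_const ha).and (Ioo_mem_nhdsGT hπ)).exists
    filter_upwards [key ε h2.1 h2.2] with r hr using hr.2.trans_lt h1

/-- The sphere contributes (r e^P)³ and the ball (r e^P)⁴; the exponent 4/3 makes these factors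
cancel, and the means with q = 3 and q = 4 both tend to 2π². -/
theorem IsPotential.tendsto_isoperimetric (h : IsPotential W F R) (hs : 0 < s)
    (hI : IntegrableOn (fun x => Real.exp (4 * W x)) (Metric.ball (0 : E4) s)) :
    Tendsto (fun r => sphereVol W r ^ ((4 : ℝ) / 3) /
        (4 * (2 * Real.pi ^ 2) ^ ((1 : ℝ) / 3) * ballVol W r)) (𝓝[>] 0)
      (𝓝 (1 + totalMass F)) := by
  have hπ : 0 < 2 * Real.pi ^ 2 := by positivity
  have hA := h.tendsto_integral_exp (q := 3) (by norm_num)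
  have hA2 := (hA.rpow_const (p := (4 : ℝ) / 3) (Or.inl hπ.ne')).div_const
    (4 * (2 * Real.pi ^ 2) ^ ((1 : ℝ) / 3))
  have hlim := hA2.mul (h.tendsto_div_ballVol hs hI)
  have hval : (2 * Real.pi ^ 2) ^ ((4 : ℝ) / 3) / (4 * (2 * Real.pi ^ 2) ^ ((1 : ℝ) / 3)) *
      (4 * (1 + totalMass F) / (2 * Real.pi ^ 2)) = 1 + totalMass F := by
    have h1 : (2 * Real.pi ^ 2) ^ ((4 : ℝ) / 3) =
        2 * Real.pi ^ 2 * (2 * Real.pi ^ 2) ^ ((1 : ℝ) / 3) := by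
      rw [show (4 : ℝ) / 3 = 1 + 1 / 3 by norm_num, Real.rpow_add hπ, Real.rpow_one]
    have h2 := (Real.rpow_pos_of_pos hπ ((1 : ℝ) / 3)).ne'
    rw [h1]
    field_simp
  rw [hval] at hlim
  refine hlim.congr' ?_
  filter_upwards [self_mem_nhdsWithin] with r (hr : 0 < r)
  have e : sphereVol W r = (r * Real.exp (radialPot F r)) ^ (3 : ℝ) * expMean W F 3 r := by
    have := sphMean_exp_eq W F 3 r
    rw [sphMean] at this
    rw [sphereVol, sphereIntegral, this, show (3 : ℝ) = ((3 : ℕ) : ℝ) by norm_num,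
      Real.rpow_natCast, mul_pow, ← Real.exp_nat_mul]
    ring
  have e0 : 0 ≤ expMean W F 3 r := integral_nonneg fun _ => (Real.exp_pos _).le
  have hp : 0 < r * Real.exp (radialPot F r) := mul_pos hr (Real.exp_pos _)
  have e4 : (r * Real.exp (radialPot F r)) ^ (4 : ℝ) = r ^ 4 * Real.exp (4 * radialPot F r) := by
    rw [show (4 : ℝ) = ((4 : ℕ) : ℝ) by norm_num, Real.rpow_natCast, mul_pow, ← Real.exp_nat_mul]
  rw [e, Real.mul_rpow (Real.rpow_nonneg hp.le _) e0, ← Real.rpow_mul hp.le,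
    show (3 : ℝ) * (4 / 3) = 4 by norm_num, e4, div_mul_div_comm]
  unfold expMean
  ring

end radial

/-! ### Extension past the unit sphere and the total mass -/

section gluing

variable {U V : Set E4} {W w : E4 → ℝ} {R δ : ℝ}

theorem smul_sphere_ne_zero {r : ℝ} (hr : 0 < r) (θ : Sph) : r • (θ : E4) ≠ 0 :=
  norm_pos_iff.1 (by rwa [norm_smul_sphere hr.le])

theorem exists_smooth_extension (hU : IsOpen U) (hBU : Metric.closedBall (0 : E4) 1 \ {0} ⊆ U)
    (hw : SmoothOn U w) : ∃ W : E4 → ℝ, ∃ R ρ : ℝ, 1 < ρ ∧ SmoothOn {0}ᶜ W ∧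
      (∀ x, R < ‖x‖ → W x = 0) ∧ ∀ x, ‖x‖ < ρ → W x = w x := by
  -- Adding the open ball covers the origin, so that compactness of the closed ball yields a uniform
  -- margin δ.
  have hop : IsOpen (U ∪ Metric.ball (0 : E4) 1) := hU.union Metric.isOpen_ball
  have hsub : Metric.closedBall (0 : E4) 1 ⊆ U ∪ Metric.ball (0 : E4) 1 := fun x hx => by
    by_cases h0 : x = 0
    · right; simp [h0]
    · exact Or.inl (hBU ⟨hx, h0⟩)
  obtain ⟨δ, hδ, hδU⟩ := (isCompact_closedBall (0 : E4) 1).exists_cthickening_subset_open hop hsub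
  rw [cthickening_closedBall hδ.le zero_le_one] at hδU
  have hmem : ∀ x : E4, x ≠ 0 → ‖x‖ ≤ 1 + δ → x ∈ U := fun x h0 hx => by
    rcases hδU (mem_closedBall_zero_iff.2 (by linarith)) with h | h
    · exact h
    · exact hBU ⟨Metric.ball_subset_closedBall h, h0⟩
  let χ : ContDiffBump (0 : E4) := ⟨1 + δ / 2, 1 + δ, by linarith, by linarith⟩
  have hz : ∀ x : E4, 1 + δ < ‖x‖ → χ x * w x = 0 := fun x hx => by
    rw [χ.zero_of_le_dist (by rw [dist_zero_right]; exact hx.le), zero_mul]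
  refine ⟨fun x => χ x * w x, 1 + δ, 1 + δ / 2, by linarith, fun x hx => ?_, hz, fun x hx => ?_⟩
  · refine ContDiffAt.contDiffWithinAt ?_
    rcases le_or_gt ‖x‖ (1 + δ) with h | h
    · exact χ.contDiff.contDiffAt.mul (hw.contDiffAt hU (hmem x hx h))
    · exact (contDiffAt_const (c := (0 : ℝ))).congr_of_eventuallyEq <| by
        filter_upwards [(isOpen_norm_gt (1 + δ)).mem_nhds h] with y hy using hz y hy
  · simp only
    rw [χ.one_of_mem_closedBall (mem_closedBall_zero_iff.2 hx.le), one_mul]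

theorem integrable_lap_lap_of_ball (hW : SmoothOn {0}ᶜ W) (hR : ∀ x, R < ‖x‖ → W x = 0)
    (hB : IntegrableOn (lap (lap W)) (Metric.ball (0 : E4) 1)) : Integrable (lap (lap W)) := by
  have hV : IsOpen ({0}ᶜ : Set E4) := isOpen_compl_singleton
  have h0 : ∀ x, R < ‖x‖ → lap (lap W) x = 0 :=
    lap_zero_of_eqOn (isOpen_norm_gt R) (lap_zero_of_eqOn (isOpen_norm_gt R) hR)
  have hK : IntegrableOn (lap (lap W)) (Metric.closedBall (0 : E4) R \ Metric.ball 0 1) := by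
    refine ContinuousOn.integrableOn_compact
      ((isCompact_closedBall (0 : E4) R).diff Metric.isOpen_ball)
      (((hW.lap hV).lap hV).continuousOn.mono fun x hx h => hx.2 ?_)
    rw [mem_singleton_iff.1 h]
    exact Metric.mem_ball_self one_pos
  have hO : IntegrableOn (lap (lap W)) (Metric.closedBall (0 : E4) R)ᶜ :=
    integrableOn_zero.congr_fun (fun x hx => (h0 x (by
      rwa [mem_compl_iff, mem_closedBall_zero_iff, not_le] at hx)).symm)
      measurableSet_closedBall.compl
  rw [← integrableOn_univ]
  refine ((hB.union hK).union hO).mono_set fun x _ => ?_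
  by_cases h1 : x ∈ Metric.ball (0 : E4) 1
  · exact Or.inl (Or.inl h1)
  by_cases h2 : x ∈ Metric.closedBall (0 : E4) R
  · exact Or.inl (Or.inr ⟨h2, h1⟩)
  · exact Or.inr h2

/-- The divergence theorem on 1 ≤ |x| ≤ ρ: beyond the support there is no flux, so the exterior part
of the integral is minus the flux of ∇ΔW through the unit sphere. -/
theorem integral_lap_lap_eq (hW : SmoothOn {0}ᶜ W) (hR : ∀ x, R < ‖x‖ → W x = 0)
    (hF : Integrable (lap (lap W))) :
    ∫ x, lap (lap W) x =
      (∫ x in Metric.ball (0 : E4) 1, lap (lap W) x) - sphMean (euler (lap W)) 1 := by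
  have hV : IsOpen ({0}ᶜ : Set E4) := isOpen_compl_singleton
  have hl := hW.lap hV
  have hlz := lap_zero_of_eqOn (isOpen_norm_gt R) hR
  set ρ := max R 1 + 1 with hρ
  have hρ1 : 1 < ρ := by linarith [le_max_right R 1]
  have hρR : R < ρ := by linarith [le_max_left R 1]
  obtain ⟨i1, e1⟩ := integrableOn_ball_polar (r := 1) hF.integrableOn
  obtain ⟨i2, e2⟩ := integrableOn_ball_polar (r := ρ) hF.integrableOn
  have e3 : ∫ x in Metric.ball (0 : E4) ρ, lap (lap W) x = ∫ x, lap (lap W) x := by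
    refine setIntegral_eq_integral_of_forall_compl_eq_zero fun x hx => ?_
    rw [mem_ball_zero_iff, not_lt] at hx
    exact lap_zero_of_eqOn (isOpen_norm_gt R) hlz x (hρR.trans_le hx)
  have j1 : IntervalIntegrable (fun s => s ^ 3 * sphMean (lap (lap W)) s) volume 0 1 :=
    (intervalIntegrable_iff_integrableOn_Ioo_of_le zero_le_one).2 i1
  have j2 : IntervalIntegrable (fun s => s ^ 3 * sphMean (lap (lap W)) s) volume 0 ρ :=
    (intervalIntegrable_iff_integrableOn_Ioo_of_le (by linarith)).2 i2
  rw [← integral_Ioc_eq_integral_Ioo, ← intervalIntegral.integral_of_le zero_le_one] at e1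
  rw [← integral_Ioc_eq_integral_Ioo, ← intervalIntegral.integral_of_le (by linarith)] at e2
  have hftc : ∫ s in (1 : ℝ)..ρ, s ^ 3 * sphMean (lap (lap W)) s =
      ρ ^ 2 * sphMean (euler (lap W)) ρ - 1 ^ 2 * sphMean (euler (lap W)) 1 := by
    refine intervalIntegral.integral_eq_sub_of_hasDerivAt
      (f := fun r => r ^ 2 * sphMean (euler (lap W)) r) (fun r hr => ?_) (j1.symm.trans j2)
    rw [uIcc_of_le hρ1.le] at hr
    have hr0 : 0 < r := one_pos.trans_le hr.1
    exact hasDerivAt_flux hl hV (fun θ => smul_sphere_ne_zero hr0 θ) hr0.ne'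
  have hz : sphMean (euler (lap W)) ρ = 0 :=
    sphMean_eq_zero (euler_zero_of_eqOn (isOpen_norm_gt R) hlz) (by linarith) hρR
  have hadd := intervalIntegral.integral_add_adjacent_intervals j1 (j1.symm.trans j2)
  rw [hz] at hftc
  rw [← e3, e2, ← hadd, ← e1, hftc]
  ring

/-- The rotational terms have zero mean, and the constant 2 times the area 2π² gives 4π². -/
theorem sphereIntegral_tCurv (hw : SmoothOn V w) (hV : IsOpen V) (h0 : (0 : E4) ∉ V)
    (hS : ∀ θ : Sph, (1 : ℝ) • (θ : E4) ∈ V) :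
    sphereIntegral 1 (fun x =>
      tCurv (conformalMetric w) (fun y => ‖y‖ ^ 2) x * Real.exp (3 * w x)) =
      4 * Real.pi ^ 2 - 1 / 2 * sphMean (euler (lap w)) 1 := by
  have he := hw.euler hV
  have hf : ∀ i j, SmoothOn V fun y =>
      rot i j (euler w) y - 3 * rot i j w y - 2 * (euler w y * rot i j w y) := fun i j =>
    ((he.rot hV i j).sub (contDiffOn_const.mul (hw.rot hV i j))).sub
      (contDiffOn_const.mul (he.mul (hw.rot hV i j)))
  have hi : ∀ i j, Integrable (fun θ : Sph => rot i j (fun y =>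
      rot i j (euler w) y - 3 * rot i j w y - 2 * (euler w y * rot i j w y))
      ((1 : ℝ) • (θ : E4))) sigma := fun i j =>
    integrable_sphere ((hf i j).rot hV i j).continuousOn hS
  have hie : Integrable (fun θ : Sph => 1 / 2 * euler (lap w) ((1 : ℝ) • (θ : E4))) sigma :=
    (integrable_sphere ((hw.lap hV).euler hV).continuousOn hS).const_mul _
  have hi2 : Integrable (fun θ : Sph => (2 : ℝ) - 1 / 2 * euler (lap w) ((1 : ℝ) • (θ : E4)))
    sigma := (integrable_const _).sub hie
  have his : ∀ i, Integrable (fun θ : Sph => ∑ j, rot i j (fun y =>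
      rot i j (euler w) y - 3 * rot i j w y - 2 * (euler w y * rot i j w y))
      ((1 : ℝ) • (θ : E4))) sigma := fun i => integrable_finsetSum _ fun j _ => hi i j
  have hi3 : Integrable (fun θ : Sph => 1 / 2 * ∑ i, ∑ j, rot i j (fun y =>
      rot i j (euler w) y - 3 * rot i j w y - 2 * (euler w y * rot i j w y))
      ((1 : ℝ) • (θ : E4))) sigma := (integrable_finsetSum _ fun i _ => his i).const_mul _
  have hrot : ∀ i j, ∫ θ : Sph, rot i j (fun y =>
      rot i j (euler w) y - 3 * rot i j w y - 2 * (euler w y * rot i j w y))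
      ((1 : ℝ) • (θ : E4)) ∂sigma = 0 := fun i j => sphMean_rot (hf i j) hV hS i j
  rw [sphereIntegral, one_pow, one_mul]
  calc _ = ∫ θ : Sph, ((2 - 1 / 2 * euler (lap w) ((1 : ℝ) • (θ : E4))) +
        1 / 2 * ∑ i, ∑ j, rot i j (fun y =>
          rot i j (euler w) y - 3 * rot i j w y - 2 * (euler w y * rot i j w y))
          ((1 : ℝ) • (θ : E4))) ∂sigma :=
        integral_congr_ae (.of_forall fun θ =>
          tCurv_conformal hw hV h0 (hS θ) (norm_smul_sphere zero_le_one θ))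
    _ = _ := by
        rw [integral_add hi2 hi3, integral_sub (integrable_const _) hie, integral_const,
          sigma_real_univ, integral_const_mul, integral_const_mul,
          integral_finsetSum _ fun i _ => his i]
        simp_rw [integral_finsetSum _ fun j _ => hi _ j, hrot]
        simp only [Finset.sum_const_zero, mul_zero, add_zero, smul_eq_mul, sphMean]
        ring

end gluing

end LocalCGB
end

/-! ### The main theorem -/

theorem mainTheorem4 (w : LocalCGB.E4 → ℝ) (U : Set LocalCGB.E4) (hU : IsOpen U)
    (hBU : Metric.closedBall (0 : LocalCGB.E4) 1 \ {0} ⊆ U)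
    (hw : ContDiffOn ℝ ((⊤ : ℕ∞) : WithTop ℕ∞) w U)
    (hvol : IntegrableOn (fun x => Real.exp (4 * w x)) (Metric.ball (0 : LocalCGB.E4) 1))
    (hscal : ∃ r₁ : ℝ, 0 < r₁ ∧ ∀ x : LocalCGB.E4, 0 < ‖x‖ → ‖x‖ < r₁ →
      0 ≤ LocalCGB.scalarCurv (LocalCGB.conformalMetric w) x)
    (hQ : IntegrableOn
      (fun x => LocalCGB.qCurv (LocalCGB.conformalMetric w) x * Real.exp (4 * w x))
      (Metric.ball (0 : LocalCGB.E4) 1)) :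
    Tendsto
      (fun r : ℝ => LocalCGB.sphereVol w r ^ ((4 : ℝ) / 3) /
        (4 * (2 * Real.pi ^ 2) ^ ((1 : ℝ) / 3) * LocalCGB.ballVol w r))
      (𝓝[>] 0)
      (𝓝 (1 / (4 * Real.pi ^ 2) *
            LocalCGB.sphereIntegral 1 (fun x =>
              LocalCGB.tCurv (LocalCGB.conformalMetric w) (fun y => ‖y‖ ^ 2) x *
                Real.exp (3 * w x))
          + 1 / (4 * Real.pi ^ 2) *
            ∫ x in Metric.ball (0 : LocalCGB.E4) 1,
              LocalCGB.qCurv (LocalCGB.conformalMetric w) x * Real.exp (4 * w x))) := by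
  open LocalCGB in
  obtain ⟨r₁, hr₁, hscal⟩ := hscal
  obtain ⟨W, R, ρ, hρ, hW, hR, hWw⟩ := exists_smooth_extension hU hBU hw
  -- U may contain the origin, where the spherical formulas are not valid, so it is removed.
  have hV : IsOpen (U ∩ {0}ᶜ) := hU.inter isOpen_compl_singleton
  have h0V : (0 : E4) ∉ U ∩ {0}ᶜ := fun h => h.2 rfl
  have hmem : ∀ x : E4, 0 < ‖x‖ → ‖x‖ ≤ 1 → x ∈ U ∩ {0}ᶜ := fun x h0 h1 =>
    ⟨hBU ⟨mem_closedBall_zero_iff.2 h1, norm_pos_iff.1 h0⟩, norm_pos_iff.1 h0⟩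
  have hwV : SmoothOn (U ∩ {0}ᶜ) w := hw.mono inter_subset_left
  have hEq : EqOn W w (Metric.ball 0 ρ) := fun x hx => hWw x (mem_ball_zero_iff.1 hx)
  have hlap : EqOn (lap W) (lap w) (Metric.ball 0 ρ) := LocalCGB.EqOn.lap Metric.isOpen_ball hEq
  have hlaplap := LocalCGB.EqOn.lap Metric.isOpen_ball hlap
  have heul := LocalCGB.EqOn.euler Metric.isOpen_ball hlap
  have hball : Metric.ball (0 : E4) 1 ⊆ Metric.ball 0 ρ := Metric.ball_subset_ball hρ.le
  have hQF : ∀ᵐ x ∂(volume.restrict (Metric.ball (0 : E4) 1)),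
      qCurv (conformalMetric w) x * Real.exp (4 * w x) = 1 / 2 * lap (lap W) x := by
    -- The value of the curvature at the origin carries no information, and the origin is a null
    -- set.
    filter_upwards [ae_restrict_of_ae ae_ne_zero, ae_restrict_mem measurableSet_ball] with x h0 hx
    rw [hlaplap (hball hx)]
    exact qCurv_conformal hwV hV
      (hmem x (norm_pos_iff.2 h0) (mem_ball_zero_iff.1 hx).le)
  have hFB : IntegrableOn (lap (lap W)) (Metric.ball (0 : E4) 1) :=
    ((hQ.congr hQF).const_mul 2).congr (.of_forall fun x => by ring)
  have hF := integrable_lap_lap_of_ball hW hR hFB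
  have hvolW : IntegrableOn (fun x => Real.exp (4 * W x)) (Metric.ball (0 : E4) 1) :=
    hvol.congr_fun (fun x hx => by simp only [hEq (hball hx)]) measurableSet_ball
  have hr₀ : 0 < min r₁ 1 := lt_min hr₁ one_pos
  obtain ⟨c, hc⟩ := exists_lower_bound hr₀ hwV hV
    (fun x h0 hx => hmem x h0 (hx.le.trans (min_le_right _ _))) (fun x h0 hx => by
      have h1 := hscal x h0 (hx.trans_le (min_le_left _ _))
      rw [scalarCurv_conformal hwV hV (hmem x h0 (hx.le.trans (min_le_right _ _)))] at h1
      by_contra! hcon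
      nlinarith [mul_pos (Real.exp_pos (-2 * w x)) hcon])
  have hs1 : min r₁ 1 / 2 ≤ 1 := by linarith [min_le_right r₁ 1]
  have hsh := tendsto_integral_shell_abs (W := W) (half_pos hr₀)
    (fun x h0 hx => (hc x h0 hx).trans_eq (hWw x ((hx.trans hs1).trans_lt hρ)).symm)
    (hvolW.mono_set (Metric.ball_subset_ball hs1))
  have hpot : IsPotential W (lap (lap W)) R :=
    { integrable := hF
      eq_zero := lap_zero_of_eqOn (isOpen_norm_gt R) (lap_zero_of_eqOn (isOpen_norm_gt R) hR)
      continuousOn := hW.continuousOn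
      integrable_kernel := fun x hx => (integral_logKernel_mul_lap_lap hW hR hF hsh hx).1
      eq_integral := fun x hx => (integral_logKernel_mul_lap_lap hW hR hF hsh hx).2 }
  have hS : ∀ θ : Sph, (1 : ℝ) • (θ : E4) ∈ U ∩ {0}ᶜ := fun θ => by
    have h := norm_smul_sphere zero_le_one θ
    exact hmem _ (by rw [h]; exact one_pos) h.le
  -- The 4π² from T gives the 1, and the flux of Δw through the unit sphere, together with ½∫Δ²w
  -- over the ball, gives the total mass of Δ²W.
  have hconst : 1 + totalMass (lap (lap W)) = 1 / (4 * Real.pi ^ 2) *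
        sphereIntegral 1 (fun x =>
          tCurv (conformalMetric w) (fun y => ‖y‖ ^ 2) x * Real.exp (3 * w x)) +
      1 / (4 * Real.pi ^ 2) * ∫ x in Metric.ball (0 : E4) 1,
          qCurv (conformalMetric w) x * Real.exp (4 * w x) := by
    have he : sphMean (euler (lap W)) 1 = sphMean (euler (lap w)) 1 :=
      integral_congr_ae (.of_forall fun θ => heul (mem_ball_zero_iff.2 (by
        rwa [norm_smul_sphere zero_le_one])))
    rw [sphereIntegral_tCurv hwV hV h0V hS, integral_congr_ae hQF, integral_const_mul, totalMass,
      integral_lap_lap_eq hW hR hF, he]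
    field_simp
    ring
  rw [← hconst]
  refine (hpot.tendsto_isoperimetric one_pos hvolW).congr' ?_
  filter_upwards [Ioo_mem_nhdsGT (one_pos.trans hρ)] with r hr
  have e1 : sphereVol W r = sphereVol w r := by
    simp only [sphereVol, sphereIntegral]
    congr 2 with θ
    rw [hWw _ (by rw [norm_smul_sphere hr.1.le]; exact hr.2)]
  have e2 : ballVol W r = ballVol w r :=
    setIntegral_congr_fun measurableSet_ball fun x hx => by
      simp only [hWw x ((mem_ball_zero_iff.1 hx).trans hr.2)]
  rw [e1, e2]
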